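/- Let $d\ge 2$, $k\in\mathbb{N}_0$, $c>0$, $0<f_-\le f_+<\infty$, and let $f:[0,1]^d\to[f_-,f_+]$ be continuous. For $s>0$, $x\in\mathbb{R}^d$ and Borel $B\subseteq\mathbb{R}^d$ put $$a_s=\log s+k\log\log s-\log k!,\qquad \lambda_s(B)=cs\int_{B\cap[0,1]^d}f(x)\,dx,\qquad r_s(x)=\inf\{r>0:\lambda_s(B(x,r))\ge a_s\},$$ where $B(x,r)$ is the closed Euclidean ball of centre $x$ and radius $r$. For every $s>0$ let $\eta_s$ be a Poisson process on $\mathbb{R}^d$ with intensity measure $\lambda_s$, and let $$\xi_s=\sum_{x\in\eta_s\cap[0,1]^d}\mathbf{1}\{(\eta_s-\delta_x)(B(x,r_s(x)))\le k\}\,\delta_x$$ be the thinning that keeps the points $x$ of $\eta_s$ in $[0,1]^d$ whose ball $B(x,r_s(x))$ contains at most $k$ other points of $\eta_s$. Let $\nu$ be a Poisson process with intensity measure $B\mapsto\lambda_1(B\cap[0,1]^d)=c\int_{B\cap[0,1]^d}f\,dx$. Let $d_{\mathrm{TV}}(\xi,\nu)=\sup_A|\mathbb{P}(\xi\in A)-\mathbb{P}(\nu\in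 A)|$, where $A$ ranges over the measurable sets of locally finite counting measures on $\mathbb{R}^d$ (for the $\sigma$-field generated by the maps $\mu\mapsto\mu(B)$, $B$ Borel). Then $$d_{\mathrm{TV}}(\xi_s,\nu)=O\big((\log s)^{-\frac{d-1}{d+1}}\big)\qquad(s\to\infty).$$ Moreover, for a locally finite counting measure $\mu$ let $T_k(x,\mu)=\inf\{r>0:\mu(B(x,r))>k\}$, with $\inf\emptyset=\infty$ and $B(x,\infty)=\mathbb{R}^d$, and let a maximum over the empty set be $0$. Then for every $t\in\mathbb{R}$, $$\lim_{s\to\infty}\mathbb{P}\Big(\max_{x\in\eta_s\cap[0,1]^d}\lambda_s\big(B(x,T_k(x,\eta_s-\delta_x))\big)-a_s-\log\Big(c\int_{[0,1]^d}f\,dx\Big)\le t\Big)=e^{-e^{-t}}.$$ -/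

import Mathlib

open MeasureTheory ProbabilityTheory Filter Topology Asymptotics
open scoped ENNReal NNReal Nat

noncomputable section

/-- The Euclidean space `ℝ^d`. -/
abbrev Euc (d : ℕ) : Type := EuclideanSpace ℝ (Fin d)

/-- The unit cube `[0,1]^d`. -/
def unitCube (d : ℕ) : Set (Euc d) := {x | ∀ i, x i ∈ Set.Icc (0 : ℝ) 1}

/-- A locally finite counting measure: values in `ℕ ∪ {∞}`, finite on compact sets. -/
structure IsCountingConfig {d : ℕ} (μ : Measure (Euc d)) : Prop where
  natValued : ∀ B : Set (Euc d), MeasurableSet B → ∃ n : ℕ∞, μ B = (n : ℝ≥0∞)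
  finiteOnCompacts : ∀ K : Set (Euc d), IsCompact K → μ K < ∞

/-- The space `𝐍` of locally finite counting measures on `ℝ^d`. As a subtype of `Measure`, it
carries the σ-field generated by the evaluations `μ ↦ μ B` with `B` Borel. -/
abbrev Config (d : ℕ) : Type := {μ : Measure (Euc d) // IsCountingConfig μ}

/-- Restricting a configuration to a set of points gives a configuration. -/
theorem IsCountingConfig.restrict {d : ℕ} {μ : Measure (Euc d)} (h : IsCountingConfig μ)
    (S : Set (Euc d)) : IsCountingConfig (μ.restrict S) where
  natValued B hB := by
    rw [Measure.restrict_apply hB, ← measure_toMeasurable]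
    exact h.natValued _ (measurableSet_toMeasurable _ _)
  finiteOnCompacts K hK := (Measure.restrict_apply_le S K).trans_lt (h.finiteOnCompacts K hK)

/-- `η` is a Poisson process on `ℝ^d` with intensity measure `Λ`: a random element of `𝐍` whose
counts `η(B)` are Poisson distributed with mean `Λ(B)` (almost surely infinite if `Λ(B) = ∞`) and
are independent over pairwise disjoint Borel sets. -/
structure IsPoissonProcess {d : ℕ} {Ω : Type*} [MeasurableSpace Ω] (P : Measure Ω)
    (η : Ω → Config d) (Λ : Measure (Euc d)) : Prop where
  measurable : Measurable η
  law_of_finite : ∀ B : Set (Euc d), MeasurableSet B → Λ B ≠ ∞ → ∀ n : ℕ,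
    P {ω | (η ω).1 B = (n : ℝ≥0∞)} = poissonMeasure (Λ B).toNNReal {n}
  law_of_infinite : ∀ B : Set (Euc d), MeasurableSet B → Λ B = ∞ → ∀ᵐ ω ∂P, (η ω).1 B = ∞
  indep : ∀ (m : ℕ) (B : Fin m → Set (Euc d)), (∀ i, MeasurableSet (B i)) →
    Pairwise (fun i j => Disjoint (B i) (B j)) → iIndepFun (fun i ω => (η ω).1 (B i)) P

/-- Total variation distance between (the laws of) two random configurations,
`sup_A |P(X ∈ A) - P(Y ∈ A)|` over all measurable sets `A` of configurations. -/
def dTV {d : ℕ} {Ω : Type*} [MeasurableSpace Ω] (P : Measure Ω) (X Y : Ω → Config d) : ℝ :=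
  ⨆ A : {A : Set (Config d) // MeasurableSet A}, |P.real (X ⁻¹' A.1) - P.real (Y ⁻¹' A.1)|

/-- `a_s = log s + k log log s - log k!`. -/
def level (k : ℕ) (s : ℝ) : ℝ :=
  Real.log s + k * Real.log (Real.log s) - Real.log (k ! : ℝ)

/-- `λ_s(B) = c s ∫_B f dx`, where `f` lives on `[0,1]^d` (zero outside the cube). -/
def intensity {d : ℕ} (c : ℝ) (f : Euc d → ℝ) (s : ℝ) : Measure (Euc d) :=
  ENNReal.ofReal (c * s) •
    (volume.restrict (unitCube d)).withDensity (fun x => ENNReal.ofReal (f x))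

/-- `inf {r > 0 : Λ(B(x,r)) ≥ a}`, equal to `∞` if there is no such `r`. -/
def levelRadius {d : ℕ} (Λ : Measure (Euc d)) (a : ℝ) (x : Euc d) : ℝ≥0∞ :=
  ⨅ (r : ℝ) (_ : 0 < r ∧ ENNReal.ofReal a ≤ Λ (Metric.closedBall x r)), ENNReal.ofReal r

/-- The points of a configuration that lie in the unit cube. -/
def cubePoints {d : ℕ} (μ : Measure (Euc d)) : Set (Euc d) :=
  {x | x ∈ unitCube d ∧ 0 < μ {x}}

/-- The thinning keeping those points `x ∈ μ ∩ [0,1]^d` with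
`(μ - δ_x)(B(x, r(x))) ≤ k`. -/
def thinning {d : ℕ} (k : ℕ) (r : Euc d → ℝ≥0∞) (μ : Config d) : Config d :=
  ⟨μ.1.restrict {x | x ∈ cubePoints μ.1 ∧
      (μ.1 - Measure.dirac x) (Metric.closedEBall x (r x)) ≤ (k : ℝ≥0∞)},
    μ.2.restrict _⟩

/-- `T_k(x,μ) = inf {r > 0 : μ(B(x,r)) > k}`, equal to `∞` if there is no such `r`. -/
def nnRadius {d : ℕ} (k : ℕ) (x : Euc d) (μ : Measure (Euc d)) : ℝ≥0∞ :=
  ⨅ (r : ℝ) (_ : 0 < r ∧ (k : ℝ≥0∞) < μ (Metric.closedBall x r)), ENNReal.ofReal r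

/-- The maximal content `max_{x ∈ μ ∩ [0,1]^d} Λ(B(x, T_k(x, μ - δ_x)))`. -/
def maxContent {d : ℕ} (k : ℕ) (Λ : Measure (Euc d)) (μ : Config d) : ℝ≥0∞ :=
  ⨆ x ∈ cubePoints μ.1, Λ (Metric.closedEBall x (nnRadius k x (μ.1 - Measure.dirac x)))

end

noncomputable section

/-! ### Configurations -/

section Configurations

variable {d : ℕ}

/-! Spheres are null, so every ball B(x, r_s(x)) has content exactly a_s. By the Mecke formula the
kept points have mean measure s T(a_s) λ_1, where T(a) is the probability that a Poisson variable of
mean a is at most k. The level a_s is tuned so that s T(a_s) tends to 1, with an error governed by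
log log s / log s (`mul_poissonTail_level`, `isBigO_mul_poissonTail_sub`). All radii at points of
the cube are at most some ρ with ρ^d of order log s / s, so the restrictions of the thinning to sets
more than 3ρ apart are independent (`IsPoissonProcess.indepFun_thinning`).

A process with such finite-range dependence is close to a Poisson process if its mean measure is
nearly right and close pairs are rare (`IsPoissonProcess.comparison`). To see this, the space is cut
into small cells, and the cells of the process are exchanged one at a time for those of an
independent copy of the Poisson process (`hybrid_step`, `comparison_of_cells`). One exchange costs
the probability that the cell and its near past are both occupied, plus the discrepancy inside the
single cell. In the cell, a functional vanishing on the empty configuration is additive up to the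
number of pairs, so its mean is controlled by the mean measure (`Config.cell_bounds`).

Close pairs are counted by the two-point Mecke formula. Two level balls have equal content, hence so
do their two crescents; one crescent contains a ball, centred in the cube, of radius proportional to
the minimum of the distance and the two radii (`exists_closedBall_subset_crescent`). The process in
a crescent is independent of the process in the other ball. If y lies in the ball of x, it takes one
of the allowed places there, which gains a factor k / a (`poissonTail_le_succ`), and the quadratic
decay of the tail in the crescent content makes the integral over y converge. If y lies outside, the
crescent content is of order a; this gains 1 / a^2, against a neighbourhood of content of order a.
Either way the contribution is O(1 / log s). Altogether the error is O((log s)^(-p)) for every p <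
1, in particular for p = (d-1)/(d+1).

For the maximum: it is at most a exactly when the thinning at level a is empty
(`IsCubeDensity.maxContent_le_iff`). Raising the level to a_s + w multiplies the limiting intensity
by e^(-w). With w = t + log λ_1([0,1]^d) the probability that the limit process is empty is
exp(-e^(-t)). -/

theorem measurableSet_unitCube (d : ℕ) : MeasurableSet (unitCube d) := by
  have : unitCube d = ⋂ i, (fun x : Euc d => x i) ⁻¹' Set.Icc (0 : ℝ) 1 := by
    ext x; simp [unitCube]
  rw [this]
  exact MeasurableSet.iInter fun i => (by fun_prop : Measurable fun x : Euc d => x i)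
    measurableSet_Icc

theorem IsCountingConfig.add {μ ν : Measure (Euc d)} (hμ : IsCountingConfig μ)
    (hν : IsCountingConfig ν) : IsCountingConfig (μ + ν) where
  natValued B hB := by
    obtain ⟨m, hm⟩ := hμ.natValued B hB
    obtain ⟨n, hn⟩ := hν.natValued B hB
    exact ⟨m + n, by simp [hm, hn]⟩
  finiteOnCompacts K hK := by
    simpa using ⟨hμ.finiteOnCompacts K hK, hν.finiteOnCompacts K hK⟩

theorem isCountingConfig_dirac (x : Euc d) : IsCountingConfig (Measure.dirac x) where
  natValued B hB := by
    by_cases h : x ∈ B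
    · exact ⟨1, by simp [hB, h]⟩
    · exact ⟨0, by simp [hB, h]⟩
  finiteOnCompacts K _ := measure_lt_top _ _

theorem isCountingConfig_zero : IsCountingConfig (0 : Measure (Euc d)) where
  natValued B _ := ⟨0, by simp⟩
  finiteOnCompacts K _ := by simp

/-- Superposition of two configurations. -/
def Config.add (μ ν : Config d) : Config d := ⟨μ.1 + ν.1, μ.2.add ν.2⟩

/-- Restriction of a configuration to a set. -/
def Config.res (S : Set (Euc d)) (μ : Config d) : Config d := ⟨μ.1.restrict S, μ.2.restrict S⟩

/-- The configuration with a single point. -/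
def Config.pt (x : Euc d) : Config d := ⟨Measure.dirac x, isCountingConfig_dirac x⟩

/-- The empty configuration. -/
def Config.zero (d : ℕ) : Config d := ⟨0, isCountingConfig_zero⟩

theorem Config.measurable_eval {B : Set (Euc d)} (hB : MeasurableSet B) :
    Measurable fun μ : Config d => μ.1 B :=
  (Measure.measurable_coe hB).comp measurable_subtype_coe

theorem Config.measurable_of_eval {α : Type*} [MeasurableSpace α] {F : α → Config d}
    (h : ∀ B, MeasurableSet B → Measurable fun a => (F a).1 B) : Measurable F :=
  Measurable.subtype_mk (f := fun a => (F a).1) (Measure.measurable_of_measurable_coe _ h)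

theorem Config.measurable_add :
    Measurable fun p : Config d × Config d => Config.add p.1 p.2 := by
  refine Config.measurable_of_eval fun B hB => ?_
  simp only [Config.add, Measure.add_apply]
  exact ((Config.measurable_eval hB).comp measurable_fst).add
    ((Config.measurable_eval hB).comp measurable_snd)

theorem Config.measurable_res {S : Set (Euc d)} (hS : MeasurableSet S) :
    Measurable (Config.res S) := by
  refine Config.measurable_of_eval fun B hB => ?_
  simp only [Config.res, Measure.restrict_apply hB]
  exact Config.measurable_eval (hB.inter hS)

theorem Config.measurable_pt : Measurable (Config.pt (d := d)) :=
  Config.measurable_of_eval fun _ hB => (Measure.measurable_coe hB).comp Measure.measurable_dirac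

theorem Config.add_zero (μ : Config d) : Config.add μ (Config.zero d) = μ :=
  Subtype.ext (by simp [Config.add, Config.zero])

theorem Config.res_eq_zero {S : Set (Euc d)} {μ : Config d} (h : μ.1 S = 0) :
    Config.res S μ = Config.zero d :=
  Subtype.ext (by simpa [Config.res, Config.zero] using h)

theorem Config.res_union {S T : Set (Euc d)} (h : Disjoint S T) (hT : MeasurableSet T)
    (μ : Config d) : Config.res (S ∪ T) μ = Config.add (Config.res S μ) (Config.res T μ) :=
  Subtype.ext (Measure.restrict_union h hT)

theorem Config.res_res {S T : Set (Euc d)} (hS : MeasurableSet S)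
    (μ : Config d) : Config.res S (Config.res T μ) = Config.res (S ∩ T) μ :=
  Subtype.ext (Measure.restrict_restrict hS)

theorem Config.add_assoc (μ ν ρ : Config d) :
    Config.add (Config.add μ ν) ρ = Config.add μ (Config.add ν ρ) :=
  Subtype.ext (_root_.add_assoc μ.1 ν.1 ρ.1)

theorem Config.add_comm (μ ν : Config d) : Config.add μ ν = Config.add ν μ :=
  Subtype.ext (_root_.add_comm μ.1 ν.1)

instance Config.sigmaFinite (μ : Config d) : SigmaFinite μ.1 := by
  have : IsFiniteMeasureOnCompacts μ.1 := ⟨fun K hK => μ.2.finiteOnCompacts K hK⟩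
  infer_instance

theorem Config.countable_atoms (μ : Config d) : {x | 0 < μ.1 {x}}.Countable := by
  have := Measure.countable_meas_level_set_pos (μ := μ.1) (g := fun x : Euc d => x) measurable_id
  simpa using this

theorem Config.one_le_of_pos (μ : Config d) {B : Set (Euc d)} (hB : MeasurableSet B)
    (h : 0 < μ.1 B) : 1 ≤ μ.1 B := by
  obtain ⟨n, hn⟩ := μ.2.natValued B hB
  rw [hn] at h ⊢
  have : (1 : ℕ∞) ≤ n := by
    rw [Order.one_le_iff_ne_zero]
    rintro rfl
    simp at h
  exact_mod_cast this

theorem Config.lt_iff_add_one_le (μ : Config d) {B : Set (Euc d)} (hB : MeasurableSet B) (k : ℕ) :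
    (k : ℝ≥0∞) < μ.1 B ↔ ((k + 1 : ℕ) : ℝ≥0∞) ≤ μ.1 B := by
  obtain ⟨n, hn⟩ := μ.2.natValued B hB
  rw [hn]
  have h1 : ((k : ℕ) : ℝ≥0∞) = ((k : ℕ∞) : ℝ≥0∞) := by simp
  have h2 : (((k + 1 : ℕ)) : ℝ≥0∞) = (((k + 1 : ℕ) : ℕ∞) : ℝ≥0∞) := by simp
  rw [h1, h2, ENat.toENNReal_lt, ENat.toENNReal_le]
  push_cast
  rw [ENat.add_one_le_iff (by simp)]

theorem Config.exists_nat (μ : Config d) {B : Set (Euc d)} (hB : MeasurableSet B)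
    (h : μ.1 B ≠ ∞) : ∃ n : ℕ, μ.1 B = n := by
  obtain ⟨n, hn⟩ := μ.2.natValued B hB
  cases n with
  | top => simp [hn] at h
  | coe n => exact ⟨n, by simpa using hn⟩

/-- Continuity from above. For configurations it makes ball counts locally constant to the right of
a radius; for the intensity it shows that the infimum defining the level radius is attained. -/
theorem tendsto_measure_closedBall (μ : Measure (Euc d)) (x : Euc d) (r : ℝ)
    (hμ : μ (Metric.closedBall x (r + 1)) ≠ ∞) :
    Tendsto (fun n : ℕ => μ (Metric.closedBall x (r + 1 / ((n : ℝ) + 1)))) atTop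
      (𝓝 (μ (Metric.closedBall x r))) := by
  have hI : (⋂ n : ℕ, Metric.closedBall x (r + 1 / ((n : ℝ) + 1))) = Metric.closedBall x r := by
    ext y
    simp only [Set.mem_iInter, Metric.mem_closedBall]
    refine ⟨fun h => ?_, fun h n => h.trans (by linarith [Nat.one_div_pos_of_nat (α := ℝ) (n := n)])⟩
    have : Tendsto (fun n : ℕ => r + 1 / ((n : ℝ) + 1)) atTop (𝓝 (r + 0)) :=
      tendsto_const_nhds.add tendsto_one_div_add_atTop_nhds_zero_nat
    rw [_root_.add_zero] at this
    exact ge_of_tendsto' this h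
  rw [← hI]
  refine tendsto_measure_iInter_atTop (fun n => measurableSet_closedBall.nullMeasurableSet) ?_
    ⟨0, by simpa using hμ⟩
  intro m n hmn
  refine Metric.closedBall_subset_closedBall ?_
  gcongr

/-- The mass of slightly larger closed balls is the mass of the given one. -/
theorem Config.exists_closedBall_eq (μ : Config d) (x : Euc d) (r : ℝ) :
    ∃ r' > r, μ.1 (Metric.closedBall x r') = μ.1 (Metric.closedBall x r) := by
  have hlim := tendsto_measure_closedBall μ.1 x r
    (μ.2.finiteOnCompacts _ (isCompact_closedBall _ _)).ne
  have hfin : μ.1 (Metric.closedBall x r) ≠ ∞ :=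
    (μ.2.finiteOnCompacts _ (isCompact_closedBall _ _)).ne
  obtain ⟨m, hm⟩ := μ.exists_nat measurableSet_closedBall hfin
  have hlt : μ.1 (Metric.closedBall x r) < ((m + 1 : ℕ) : ℝ≥0∞) := by
    rw [hm]; exact_mod_cast Nat.lt_succ_self m
  obtain ⟨n, hn⟩ := (hlim.eventually_lt_const hlt).exists
  have hpos : (0 : ℝ) < 1 / ((n : ℝ) + 1) := Nat.one_div_pos_of_nat
  refine ⟨r + 1 / ((n : ℝ) + 1), by linarith, ?_⟩
  refine le_antisymm ?_ (measure_mono (Metric.closedBall_subset_closedBall (by linarith)))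
  obtain ⟨j, hj⟩ := μ.exists_nat (B := Metric.closedBall x (r + 1 / ((n : ℝ) + 1)))
    measurableSet_closedBall (μ.2.finiteOnCompacts _ (isCompact_closedBall _ _)).ne
  rw [hj] at hn ⊢
  rw [hm]
  have : j < m + 1 := by exact_mod_cast hn
  exact_mod_cast Nat.lt_succ_iff.mp this

/-- A configuration is carried by its atoms. -/
theorem Config.ae_atom (μ : Config d) : ∀ᵐ x ∂μ.1, 0 < μ.1 {x} := by
  rw [ae_iff]
  refine measure_null_of_locally_null _ fun x hx => ?_
  obtain ⟨r, hr, h⟩ := μ.exists_closedBall_eq x 0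
  refine ⟨Metric.closedBall x r, mem_nhdsWithin_of_mem_nhds (Metric.closedBall_mem_nhds x hr), ?_⟩
  simpa [h] using hx

/-- The set of atoms is countable. This settles measurability of sets that are described through the
configuration itself. -/
theorem Config.measurableSet_of_subset_atoms (μ : Config d) {S : Set (Euc d)}
    (h : ∀ x ∈ S, 0 < μ.1 {x}) : MeasurableSet S :=
  (μ.countable_atoms.mono h).measurableSet

/-- A configuration as a kernel from the space of configurations. -/
def configKernel (d : ℕ) : Kernel (Config d) (Euc d) := ⟨fun μ => μ.1, measurable_subtype_coe⟩

theorem configKernel_apply (μ : Config d) : configKernel d μ = μ.1 := rfl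

/-- The mass of a configuration is neither bounded nor necessarily finite. Cutting the space into
bounded disjoint shells, and the configurations according to the number of points in a shell, leaves
countably many kernels of bounded mass. S-finiteness gives measurability of integrals against a
random configuration. -/
instance : IsSFiniteKernel (configKernel d) := by
  classical
  let K : ℕ → Set (Euc d) := disjointed fun n : ℕ => Metric.closedBall 0 (n : ℝ)
  have hKm : ∀ n, MeasurableSet (K n) :=
    MeasurableSet.disjointed fun n => measurableSet_closedBall
  have hKU : ⋃ n, K n = Set.univ := by
    rw [iUnion_disjointed]
    exact Metric.iUnion_closedBall_nat 0
  have hKd : Pairwise (Function.onFun Disjoint K) := disjoint_disjointed _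
  have hKfin : ∀ (μ : Config d) n, μ.1 (K n) ≠ ∞ := fun μ n =>
    ((measure_mono (disjointed_subset _ n)).trans_lt
      (μ.2.finiteOnCompacts _ (isCompact_closedBall _ _))).ne
  have hs : ∀ n m : ℕ, MeasurableSet {μ : Config d | μ.1 (K n) = m} := fun n m =>
    Config.measurable_eval (hKm n) (measurableSet_singleton _)
  let κ : ℕ × ℕ → Kernel (Config d) (Euc d) := fun p =>
    Kernel.piecewise (hs p.1 p.2) (Kernel.restrict (configKernel d) (hKm p.1)) 0
  have hκ : ∀ p, IsFiniteKernel (κ p) := fun p => by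
    refine ⟨⟨p.2, by simp, fun μ => ?_⟩⟩
    simp only [κ, Kernel.piecewise_apply]
    split_ifs with h
    · rw [Kernel.restrict_apply, configKernel_apply, Measure.restrict_apply_univ]
      exact le_of_eq h
    · simp
  have : configKernel d = Kernel.sum κ := by
    ext μ B hB
    rw [Kernel.sum_apply' _ _ hB, ENNReal.tsum_prod']
    have h1 : ∀ n, ∑' m, κ (n, m) μ B = μ.1 (B ∩ K n) := fun n => by
      obtain ⟨m, hm⟩ := μ.exists_nat (hKm n) (hKfin μ n)
      rw [tsum_eq_single m]
      · simp only [κ, Kernel.piecewise_apply]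
        rw [if_pos (show μ ∈ {μ : Config d | μ.1 (K n) = m} from hm), Kernel.restrict_apply, configKernel_apply, Measure.restrict_apply hB]
      · intro m' hm'
        simp only [κ, Kernel.piecewise_apply]
        rw [if_neg]
        · simp
        · rw [Set.mem_ofPred_eq, hm]
          exact_mod_cast hm'.symm
    simp_rw [h1]
    rw [configKernel_apply, ← measure_iUnion (fun i j hij => (hKd hij).mono
      Set.inter_subset_right Set.inter_subset_right) fun n => hB.inter (hKm n),
      ← Set.inter_iUnion, hKU, Set.inter_univ]
  rw [this]
  exact Kernel.isSFiniteKernel_sum (hκs := fun p => inferInstance)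

theorem Config.measurable_lintegral {α : Type*} [MeasurableSpace α] {F : α → Config d}
    (hF : Measurable F) {g : α → Euc d → ℝ≥0∞} (hg : Measurable (Function.uncurry g)) :
    Measurable fun a => ∫⁻ x, g a x ∂(F a).1 :=
  Measurable.lintegral_kernel_prod_right (κ := (configKernel d).comap F hF) hg

theorem Config.measurable_section {α : Type*} [MeasurableSpace α] {F : α → Config d}
    (hF : Measurable F) {S : Set (α × Euc d)} (hS : MeasurableSet S) :
    Measurable fun a => (F a).1 (Prod.mk a ⁻¹' S) :=
  Kernel.measurable_kernel_prodMk_left (κ := (configKernel d).comap F hF) hS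

/-- At an atom the Dirac mass is dominated by `μ`, by integrality; only then is the truncated
difference of measures computed set by set. -/
theorem Config.sub_dirac_apply (μ : Config d) {x : Euc d} (hx : 0 < μ.1 {x}) {B : Set (Euc d)}
    (hB : MeasurableSet B) (hxB : x ∈ B) : (μ.1 - Measure.dirac x) B = μ.1 B - 1 := by
  rw [Measure.sub_apply hB]
  · simp [hxB]
  · refine Measure.le_iff.2 fun C hC => ?_
    rw [Measure.dirac_apply' _ hC]
    by_cases h : x ∈ C
    · simpa [h] using (μ.one_le_of_pos (measurableSet_singleton x) hx).trans
        (measure_mono (Set.singleton_subset_iff.2 h))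
    · simp [h]

theorem Config.sub_dirac_le_iff (μ : Config d) {x : Euc d} (hx : 0 < μ.1 {x}) {B : Set (Euc d)}
    (hB : MeasurableSet B) (hxB : x ∈ B) (k : ℕ) :
    (μ.1 - Measure.dirac x) B ≤ k ↔ μ.1 B ≤ ((k + 1 : ℕ) : ℝ≥0∞) := by
  rw [μ.sub_dirac_apply hx hB hxB, tsub_le_iff_right]
  push_cast
  rfl

end Configurations

/-! ### Poisson processes: joint laws, independence and the Mecke formula -/

section Poisson

variable {d : ℕ} {Ω : Type*} [MeasurableSpace Ω] {P : Measure Ω} {η : Ω → Config d}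
  {Λ : Measure (Euc d)}

/-- The atom with index `T` of the algebra generated by a family of sets. -/
def atomOf {ι : Type*} (B : ι → Set (Euc d)) (T : Set ι) : Set (Euc d) := {x | {i | x ∈ B i} = T}

theorem measurableSet_atomOf {ι : Type*} [Countable ι] {B : ι → Set (Euc d)}
    (hB : ∀ i, MeasurableSet (B i)) (T : Set ι) : MeasurableSet (atomOf B T) := by
  classical
  have : atomOf B T = ⋂ i, (if i ∈ T then B i else (B i)ᶜ) := by
    ext x
    simp only [atomOf, Set.ext_iff, Set.mem_ofPred_eq, Set.mem_iInter]
    refine forall_congr' fun i => ?_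
    by_cases h : i ∈ T <;> simp [h]
  rw [this]
  refine MeasurableSet.iInter fun i => ?_
  split_ifs
  exacts [hB i, (hB i).compl]

theorem disjoint_atomOf {ι : Type*} (B : ι → Set (Euc d)) {T T' : Set ι} (h : T ≠ T') :
    Disjoint (atomOf B T) (atomOf B T') := by
  rw [Set.disjoint_left]
  intro x hx hx'
  exact h (hx.symm.trans hx')

open Classical in
-- Reduces counts in overlapping sets to counts in disjoint ones, for which the definition of a
-- Poisson process provides independence.
theorem measure_eq_sum_atomOf {ι : Type*} [Fintype ι] {B : ι → Set (Euc d)}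
    (hB : ∀ i, MeasurableSet (B i)) {S : Set (Euc d)} (hS : MeasurableSet S)
    (μ : Measure (Euc d)) (j : ι) :
    μ (B j ∩ S) = ∑ T : Set ι, if j ∈ T then μ (atomOf B T ∩ S) else 0 := by
  rw [← Finset.sum_filter, ← measure_biUnion_finset]
  · congr 1
    ext x
    simp only [Set.mem_inter_iff, Finset.mem_filter, Finset.mem_univ, true_and, Set.mem_iUnion,
      exists_prop, atomOf, Set.mem_ofPred_eq]
    exact ⟨fun h => ⟨_, h.1, rfl, h.2⟩, fun ⟨T, h1, h2, h3⟩ => ⟨by rw [← h2] at h1; exact h1, h3⟩⟩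
  · intro T _ T' _ h
    exact (disjoint_atomOf B h).mono Set.inter_subset_left Set.inter_subset_left
  · exact fun T _ => (measurableSet_atomOf hB T).inter hS

theorem IsPoissonProcess.iIndepFun (h : IsPoissonProcess P η Λ) {ι : Type*} [Fintype ι]
    {C : ι → Set (Euc d)} (hC : ∀ i, MeasurableSet (C i))
    (hd : Pairwise fun i j => Disjoint (C i) (C j)) :
    iIndepFun (fun i ω => (η ω).1 (C i)) P := by
  let e := Fintype.equivFin ι
  have h1 := h.indep (Fintype.card ι) (fun i => C (e.symm i)) (fun i => hC _)
    (fun i j hij => hd (e.symm.injective.ne hij))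
  have h2 := h1.precomp (g := e) e.injective
  simpa using h2

theorem IsPoissonProcess.measurable_eval (h : IsPoissonProcess P η Λ) {B : Set (Euc d)}
    (hB : MeasurableSet B) : Measurable fun ω => (η ω).1 B :=
  (Config.measurable_eval hB).comp h.measurable

theorem IsPoissonProcess.joint_law [IsFiniteMeasure Λ] (h : IsPoissonProcess P η Λ)
    {ι : Type*} [Fintype ι] {C : ι → Set (Euc d)} (hC : ∀ i, MeasurableSet (C i))
    (hd : Pairwise fun i j => Disjoint (C i) (C j)) (n : ι → ℕ) :
    P {ω | ∀ i, (η ω).1 (C i) = n i} = ∏ i, poissonMeasure (Λ (C i)).toNNReal {n i} := by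
  have h1 := (h.iIndepFun hC hd).meas_iInter (s := fun i => {ω | (η ω).1 (C i) = n i})
    (fun i => ⟨{(n i : ℝ≥0∞)}, measurableSet_singleton _, rfl⟩)
  have h2 : {ω | ∀ i, (η ω).1 (C i) = n i} = ⋂ i, {ω | (η ω).1 (C i) = n i} := by
    ext; simp
  rw [h2, h1]
  exact Finset.prod_congr rfl fun i _ => h.law_of_finite _ (hC i) (measure_ne_top _ _) _

/-- The probabilities of the finite values of the total count are Poisson weights, and these already
add up to one. -/
theorem IsPoissonProcess.ae_finite [IsProbabilityMeasure P] [IsFiniteMeasure Λ]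
    (h : IsPoissonProcess P η Λ) : ∀ᵐ ω ∂P, (η ω).1 Set.univ ≠ ∞ := by
  have hm : ∀ n : ℕ, MeasurableSet {ω | (η ω).1 Set.univ = n} := fun n =>
    h.measurable_eval MeasurableSet.univ (measurableSet_singleton _)
  have h1 : P (⋃ n : ℕ, {ω | (η ω).1 Set.univ = n}) = 1 := by
    rw [measure_iUnion _ hm]
    · simp_rw [h.law_of_finite _ MeasurableSet.univ (measure_ne_top _ _)]
      have := measure_univ (μ := poissonMeasure (Λ Set.univ).toNNReal)
      rw [← Set.iUnion_of_singleton ℕ, measure_iUnion _ fun _ => measurableSet_singleton _] at this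
      · exact this
      · intro i j hij
        simpa using hij
    · intro i j hij
      refine Set.disjoint_left.2 fun ω (h1 : _ = _) (h2 : _ = _) => hij ?_
      exact_mod_cast h1.symm.trans h2
  have h2 : ∀ᵐ ω ∂P, ω ∈ ⋃ n : ℕ, {ω | (η ω).1 Set.univ = n} :=
    (mem_ae_iff_prob_eq_one (MeasurableSet.iUnion hm)).2 h1
  filter_upwards [h2] with ω hω
  obtain ⟨n, hn⟩ := Set.mem_iUnion.1 hω
  rw [show (η ω).1 Set.univ = n from hn]
  exact ENNReal.natCast_ne_top n

/-- Presents a random configuration as a stochastic process indexed by Borel sets, so that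
independence and uniqueness can be tested on finitely many counts. -/
theorem Config.comap_eval_eq : (inferInstance : MeasurableSpace (Config d)) =
    MeasurableSpace.comap (fun (μ : Config d) (B : {B : Set (Euc d) // MeasurableSet B}) => μ.1 B.1)
      MeasurableSpace.pi := by
  apply le_antisymm
  · have hmeas : Measurable[MeasurableSpace.comap (fun (μ : Config d)
        (B : {B : Set (Euc d) // MeasurableSet B}) => μ.1 B.1) MeasurableSpace.pi]
        (fun μ : Config d => μ) := by
      refine @Config.measurable_of_eval d _ (MeasurableSpace.comap _ _) _ fun B hB => ?_
      have h1 : Measurable fun f : {B : Set (Euc d) // MeasurableSet B} → ℝ≥0∞ => f ⟨B, hB⟩ :=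
        measurable_pi_apply _
      exact h1.comp (comap_measurable _)
    intro s hs
    exact hmeas hs
  · rw [← measurable_iff_comap_le]
    exact measurable_pi_lambda _ fun B => Config.measurable_eval B.2

theorem Config.comap_eq_comap_eval {α : Type*} (F : α → Config d) :
    MeasurableSpace.comap F inferInstance =
    MeasurableSpace.comap (fun a (B : {B : Set (Euc d) // MeasurableSet B}) => (F a).1 B.1)
      MeasurableSpace.pi := by
  rw [Config.comap_eval_eq, MeasurableSpace.comap_comp]
  rfl

/-- The restrictions of a Poisson process to disjoint sets are independent. -/
theorem IsPoissonProcess.indepFun_res [IsProbabilityMeasure P] (h : IsPoissonProcess P η Λ)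
    {S S' : Set (Euc d)} (hS : MeasurableSet S) (hS' : MeasurableSet S') (hd : Disjoint S S') :
    IndepFun (fun ω => Config.res S (η ω)) (fun ω => Config.res S' (η ω)) P := by
  classical
  rw [IndepFun_iff_Indep, Config.comap_eq_comap_eval, Config.comap_eq_comap_eval,
    ← IndepFun_iff_Indep]
  have hm : ∀ {S : Set (Euc d)}, MeasurableSet S → ∀ B : {B : Set (Euc d) // MeasurableSet B},
      Measurable fun ω => (Config.res S (η ω)).1 B.1 := fun hS B =>
    (Config.measurable_eval B.2).comp ((Config.measurable_res hS).comp h.measurable)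
  refine IndepFun.process_indepFun_process (hm hS) (hm hS') fun I J => ?_
  let BI : I → Set (Euc d) := fun i => i.1.1
  let BJ : J → Set (Euc d) := fun i => i.1.1
  have hBI : ∀ i, MeasurableSet (BI i) := fun i => i.1.2
  have hBJ : ∀ i, MeasurableSet (BJ i) := fun i => i.1.2
  -- The atoms of both families, cut down to `S` and `S'`, form a single disjoint family, hence have
  -- jointly independent counts; the two groups of counts are then functions of disjoint blocks.
  let C : Set I ⊕ Set J → Set (Euc d) :=
    Sum.elim (fun T => atomOf BI T ∩ S) (fun T => atomOf BJ T ∩ S')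
  have hC : ∀ i, MeasurableSet (C i) := by
    rintro (T | T)
    exacts [(measurableSet_atomOf hBI T).inter hS, (measurableSet_atomOf hBJ T).inter hS']
  have hCd : Pairwise fun i j => Disjoint (C i) (C j) := by
    rintro (T | T) (T' | T') hT
    · exact (disjoint_atomOf BI (by simpa using hT)).mono Set.inter_subset_left
        Set.inter_subset_left
    · exact hd.mono Set.inter_subset_right Set.inter_subset_right
    · exact hd.symm.mono Set.inter_subset_right Set.inter_subset_right
    · exact (disjoint_atomOf BJ (by simpa using hT)).mono Set.inter_subset_left
        Set.inter_subset_left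
  have hind := (h.iIndepFun hC hCd).indepFun_finset (Finset.univ.map ⟨Sum.inl, Sum.inl_injective⟩)
    (Finset.univ.map ⟨Sum.inr, Sum.inr_injective⟩) (by
      rw [Finset.disjoint_left]; simp) fun i => h.measurable_eval (hC i)
  have hL : Measurable fun (f : {x // x ∈ (Finset.univ : Finset (Set I)).map
      ⟨Sum.inl (β := Set J), Sum.inl_injective⟩} → ℝ≥0∞) (i : I) =>
      ∑ T : Set I, if i ∈ T then f ⟨Sum.inl T, by simp⟩ else 0 := by
    refine measurable_pi_lambda _ fun i => Finset.measurable_sum _ fun T _ => ?_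
    split_ifs
    exacts [measurable_pi_apply _, measurable_const]
  have hR : Measurable fun (f : {x // x ∈ (Finset.univ : Finset (Set J)).map
      ⟨Sum.inr (α := Set I), Sum.inr_injective⟩} → ℝ≥0∞) (i : J) =>
      ∑ T : Set J, if i ∈ T then f ⟨Sum.inr T, by simp⟩ else 0 := by
    refine measurable_pi_lambda _ fun i => Finset.measurable_sum _ fun T _ => ?_
    split_ifs
    exacts [measurable_pi_apply _, measurable_const]
  have := hind.comp hL hR
  convert this using 1
  · funext ω i
    simp only [Config.res, Function.comp]
    rw [Measure.restrict_apply i.1.2]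
    exact measure_eq_sum_atomOf hBI hS (η ω).1 i
  · funext ω i
    simp only [Config.res, Function.comp]
    rw [Measure.restrict_apply i.1.2]
    exact measure_eq_sum_atomOf hBJ hS' (η ω).1 i

/-- Two measures on the space of configurations agree if they give the same mass to the events
prescribing the numbers of points in the cells of finite measurable partitions that refine a
given set. -/
theorem Config.measure_ext_of_partition (B₀ : Set (Euc d)) (hB₀ : MeasurableSet B₀)
    (m₁ m₂ : Measure (Config d)) [IsFiniteMeasure m₂]
    (h₁ : ∀ᵐ μ ∂m₁, μ.1 Set.univ ≠ ∞) (h₂ : ∀ᵐ μ ∂m₂, μ.1 Set.univ ≠ ∞)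
    (h : ∀ (ι : Type) [Fintype ι] (C : ι → Set (Euc d)), (∀ i, MeasurableSet (C i)) →
      (Pairwise fun i j => Disjoint (C i) (C j)) → (⋃ i, C i = Set.univ) →
      (∃ J : Finset ι, B₀ = ⋃ i ∈ J, C i) → ∀ n : ι → ℕ,
      m₁ {μ | ∀ i, μ.1 (C i) = n i} = m₂ {μ | ∀ i, μ.1 (C i) = n i}) : m₁ = m₂ := by
  classical
  let Φ : Config d → {B : Set (Euc d) // MeasurableSet B} → ℝ≥0∞ := fun μ B => μ.1 B.1
  have hΦ : Measurable Φ := measurable_pi_lambda _ fun B => Config.measurable_eval B.2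
  -- the joint laws of finitely many evaluations agree
  have key : ∀ I : Finset {B : Set (Euc d) // MeasurableSet B},
      m₁.map (fun μ (i : I) => μ.1 i.1.1) = m₂.map (fun μ (i : I) => μ.1 i.1.1) := by
    intro I
    -- The index `none` adjoins `B₀`, so that the atoms refine it as the hypothesis requires.
    let B : Option I → Set (Euc d) := fun o => o.elim B₀ fun i => i.1.1
    have hB : ∀ i, MeasurableSet (B i) := by
      rintro (_ | i)
      exacts [hB₀, i.1.2]
    let C : Set (Option I) → Set (Euc d) := atomOf B
    have hC := measurableSet_atomOf hB
    have hBU : ∀ j, B j = ⋃ T ∈ Finset.univ.filter (fun T : Set (Option I) => j ∈ T), C T := by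
      intro j
      ext x
      simp only [Finset.mem_filter, Finset.mem_univ, true_and, Set.mem_iUnion, exists_prop, C,
        atomOf, Set.mem_ofPred_eq]
      exact ⟨fun h => ⟨_, h, rfl⟩, fun ⟨T, h1, h2⟩ => by rw [← h2] at h1; exact h1⟩
    have hCU : ⋃ T, C T = Set.univ :=
      Set.eq_univ_of_forall fun x => Set.mem_iUnion.2 ⟨_, rfl⟩
    have hcell := h (Set (Option I)) C hC (fun _ _ h => disjoint_atomOf B h) hCU
      ⟨_, hBU none⟩
    -- Almost all counts are finite, so the vector of counts may be taken in a countable space,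
    -- where a law is determined by its singletons.
    let V : Config d → Set (Option I) → ℕ := fun μ T => ⌊(μ.1 (C T)).toReal⌋₊
    have hV : Measurable V := measurable_pi_lambda _ fun T =>
      Nat.measurable_floor.comp (Config.measurable_eval (hC T)).ennreal_toReal
    have hVeq : ∀ μ : Config d, μ.1 Set.univ ≠ ∞ → ∀ T, μ.1 (C T) = V μ T := by
      intro μ hμ T
      obtain ⟨n, hn⟩ := μ.exists_nat (hC T)
        ((measure_mono (Set.subset_univ _)).trans_lt hμ.lt_top).ne
      simp only [V, C, hn, ENNReal.toReal_natCast, Nat.floor_natCast]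
    have hVset : ∀ (m : Measure (Config d)), (∀ᵐ μ ∂m, μ.1 Set.univ ≠ ∞) →
        ∀ n : Set (Option I) → ℕ, m.map V {n} = m {μ | ∀ T, μ.1 (C T) = n T} := by
      intro m hm n
      rw [Measure.map_apply hV (measurableSet_singleton _)]
      refine measure_congr ?_
      filter_upwards [hm] with μ hμ
      refine propext ⟨fun (h : V μ = n) T => by rw [hVeq μ hμ, h], fun h => ?_⟩
      funext T
      have h1 := h T
      rw [hVeq μ hμ] at h1
      exact_mod_cast h1
    have hVm : m₁.map V = m₂.map V := by
      refine Measure.ext_of_singleton fun n => ?_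
      rw [hVset m₁ h₁, hVset m₂ h₂, hcell]
    let G : (Set (Option I) → ℕ) → I → ℝ≥0∞ := fun f i =>
      ∑ T : Set (Option I), if some i ∈ T then (f T : ℝ≥0∞) else 0
    have hfac : ∀ (m : Measure (Config d)), (∀ᵐ μ ∂m, μ.1 Set.univ ≠ ∞) →
        m.map (fun μ (i : I) => μ.1 i.1.1) = (m.map V).map G := by
      intro m hm
      rw [Measure.map_map Measurable.of_discrete hV]
      refine Measure.map_congr ?_
      filter_upwards [hm] with μ hμ
      funext i
      have := measure_eq_sum_atomOf hB MeasurableSet.univ μ.1 (some i)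
      simp only [Set.inter_univ] at this
      exact this.trans (Finset.sum_congr rfl fun T _ => by rw [← hVeq μ hμ T])
    rw [hfac m₁ h₁, hfac m₂ h₂, hVm]
  have hmap : m₁.map Φ = m₂.map Φ := by
    refine IsProjectiveLimit.unique (P := fun I => m₂.map (fun μ (i : I) => μ.1 i.1.1)) ?_ ?_
    · intro I
      rw [Measure.map_map (Finset.measurable_restrict I) hΦ]
      exact key I
    · intro I
      rw [Measure.map_map (Finset.measurable_restrict I) hΦ]
      rfl
  refine Measure.ext fun s hs => ?_
  obtain ⟨t, ht, rfl⟩ : MeasurableSet[MeasurableSpace.comap Φ MeasurableSpace.pi] s := by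
    rw [← Config.comap_eval_eq]
    exact hs
  rw [← Measure.map_apply hΦ ht, ← Measure.map_apply hΦ ht, hmap]

/-- This recursion is the Mecke formula for one count, and the only property of the Poisson weights
used in deriving the general formula. -/
theorem poissonMeasure_succ (l : ℝ≥0) (n : ℕ) :
    (l : ℝ≥0∞) * poissonMeasure l {n} = ((n + 1 : ℕ) : ℝ≥0∞) * poissonMeasure l {n + 1} := by
  rw [poissonMeasure_singleton, poissonMeasure_singleton, ← ENNReal.ofReal_coe_nnreal,
    ← ENNReal.ofReal_natCast, ← ENNReal.ofReal_mul (by positivity),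
    ← ENNReal.ofReal_mul (by positivity)]
  congr 1
  rw [Nat.factorial_succ]
  have : ((n ! : ℕ) : ℝ) ≠ 0 := by positivity
  push_cast
  field_simp
  ring

end Poisson

/-! ### The Mecke formulas for one and two points, and simplicity of the process. -/

section Mecke

variable {d : ℕ} {Ω : Type*} [MeasurableSpace Ω] {P : Measure Ω} {η : Ω → Config d}
  {Λ : Measure (Euc d)}

theorem Config.add_pt_apply (μ : Config d) (x : Euc d) {B : Set (Euc d)} (hB : MeasurableSet B) :
    (Config.add μ (Config.pt x)).1 B = μ.1 B + B.indicator 1 x := by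
  simp [Config.add, Config.pt, hB]

theorem Config.measurable_add_pt {α : Type*} [MeasurableSpace α] {F : α → Config d}
    (hF : Measurable F) {p : α → Euc d} (hp : Measurable p) :
    Measurable fun a => Config.add (F a) (Config.pt (p a)) :=
  Config.measurable_add.comp (hF.prodMk (Config.measurable_pt.comp hp))

/-- The Mecke formula on the cells of a finite partition. -/
theorem IsPoissonProcess.mecke_partition [IsProbabilityMeasure P] [IsFiniteMeasure Λ]
    (h : IsPoissonProcess P η Λ) {ι : Type*} [Fintype ι] {C : ι → Set (Euc d)}
    (hC : ∀ i, MeasurableSet (C i)) (hd : Pairwise fun i j => Disjoint (C i) (C j)) (i : ι)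
    (n : ι → ℕ) :
    (n i : ℝ≥0∞) * P {ω | ∀ j, (η ω).1 (C j) = n j} =
      ∫⁻ x in C i, P {ω | ∀ j, (Config.add (η ω) (Config.pt x)).1 (C j) = n j} ∂Λ := by
  classical
  have hconst : ∀ x ∈ C i, {ω | ∀ j, (Config.add (η ω) (Config.pt x)).1 (C j) = n j} =
      {ω | ∀ j, (η ω).1 (C j) + (if j = i then 1 else 0) = n j} := by
    intro x hx
    ext ω
    refine forall_congr' fun j => ?_
    rw [Config.add_pt_apply _ _ (hC j)]
    by_cases hj : j = i
    · subst hj; simp [hx]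
    · have : x ∉ C j := fun h' => Set.disjoint_left.1 (hd hj) h' hx
      simp [this, hj]
  rw [setLIntegral_congr_fun (hC i) fun x hx => by rw [hconst x hx], setLIntegral_const]
  rcases Nat.eq_zero_or_pos (n i) with h0 | hpos
  · have : {ω | ∀ j, (η ω).1 (C j) + (if j = i then 1 else 0) = n j} = ∅ := by
      refine Set.eq_empty_of_forall_notMem fun ω hω => ?_
      have := hω i
      rw [h0] at this
      simp at this
    rw [this, h0]
    simp
  · obtain ⟨m, hm⟩ : ∃ m, n i = m + 1 := ⟨n i - 1, by omega⟩
    -- The added point fills one place in cell `i`, which lowers the prescribed count there from `m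
    -- + 1` to `m` and leaves the other cells alone.
    have hset : {ω | ∀ j, (η ω).1 (C j) + (if j = i then 1 else 0) = n j} =
        {ω | ∀ j, (η ω).1 (C j) = (Function.update n i m) j} := by
      ext ω
      refine forall_congr' fun j => ?_
      by_cases hj : j = i
      · subst hj
        simp only [if_true, Function.update_self, hm]
        push_cast
        exact ENNReal.add_left_inj ENNReal.one_ne_top
      · simp [hj]
    rw [hset, h.joint_law hC hd, h.joint_law hC hd,
      ← Finset.mul_prod_erase _ _ (Finset.mem_univ i),
      ← Finset.mul_prod_erase _ (fun j => poissonMeasure (Λ (C j)).toNNReal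
        {Function.update n i m j}) (Finset.mem_univ i)]
    have : ∏ j ∈ Finset.univ.erase i, poissonMeasure (Λ (C j)).toNNReal {Function.update n i m j} =
        ∏ j ∈ Finset.univ.erase i, poissonMeasure (Λ (C j)).toNNReal {n j} :=
      Finset.prod_congr rfl fun j hj => by
        rw [Function.update_of_ne (Finset.ne_of_mem_erase hj)]
    rw [this, Function.update_self, ← mul_assoc, hm, ← poissonMeasure_succ,
      ENNReal.coe_toNNReal (measure_ne_top _ _)]
    ring

/-- For fixed `B` both sides are measures in `E`. They need only be compared on count events of
partitions refining `B`, where the formula is a sum over the cells that make up `B`. -/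
theorem IsPoissonProcess.mecke_rectangle [IsProbabilityMeasure P] [IsFiniteMeasure Λ]
    (h : IsPoissonProcess P η Λ) {B : Set (Euc d)} (hB : MeasurableSet B) {E : Set (Config d)}
    (hE : MeasurableSet E) :
    ∫⁻ ω, (η ω).1 B * E.indicator 1 (η ω) ∂P =
      ∫⁻ x in B, P {ω | Config.add (η ω) (Config.pt x) ∈ E} ∂Λ := by
  classical
  have hηB : Measurable fun ω => (η ω).1 B := h.measurable_eval hB
  have hadd : Measurable fun p : Euc d × Ω => Config.add (η p.2) (Config.pt p.1) :=
    Config.measurable_add_pt (h.measurable.comp measurable_snd) measurable_fst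
  let m₁ : Measure (Config d) := (P.withDensity fun ω => (η ω).1 B).map η
  let m₂ : Measure (Config d) :=
    ((Λ.restrict B).prod P).map fun p => Config.add (η p.2) (Config.pt p.1)
  have hm₁ : ∀ E, MeasurableSet E → m₁ E = ∫⁻ ω, (η ω).1 B * E.indicator 1 (η ω) ∂P := by
    intro E hE
    rw [Measure.map_apply h.measurable hE, withDensity_apply _ (h.measurable hE),
      ← lintegral_indicator (h.measurable hE)]
    refine lintegral_congr fun ω => ?_
    by_cases hω : η ω ∈ E <;> simp [hω]
  have hm₂ : ∀ E, MeasurableSet E →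
      m₂ E = ∫⁻ x in B, P {ω | Config.add (η ω) (Config.pt x) ∈ E} ∂Λ := by
    intro E hE
    rw [Measure.map_apply hadd hE, Measure.prod_apply (hadd hE)]
    rfl
  have hfin := h.ae_finite
  have hu : MeasurableSet {μ : Config d | μ.1 Set.univ ≠ ∞} :=
    Config.measurable_eval MeasurableSet.univ (measurableSet_singleton _).compl
  suffices m₁ = m₂ by rw [← hm₁ E hE, ← hm₂ E hE, this]
  refine Config.measure_ext_of_partition B hB m₁ m₂ ?_ ?_ ?_
  · refine (ae_map_iff h.measurable.aemeasurable hu).2 ?_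
    exact (withDensity_absolutelyContinuous _ _).ae_le hfin
  · refine (ae_map_iff hadd.aemeasurable hu).2 ?_
    have : ∀ᵐ p ∂(Λ.restrict B).prod P, (η p.2).1 Set.univ ≠ ∞ :=
      (Measure.quasiMeasurePreserving_snd (μ := Λ.restrict B) (ν := P)).ae hfin
    filter_upwards [this] with p hp
    rw [Config.add_pt_apply _ _ MeasurableSet.univ]
    simpa using hp
  · rintro ι _ C hC hd - ⟨J, hJ⟩ n
    have hmeas : MeasurableSet {μ : Config d | ∀ i, μ.1 (C i) = n i} := by
      rw [show {μ : Config d | ∀ i, μ.1 (C i) = n i} = ⋂ i, {μ : Config d | μ.1 (C i) = n i} by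
        ext; simp]
      exact MeasurableSet.iInter fun i => Config.measurable_eval (hC i) (measurableSet_singleton _)
    rw [hm₁ _ hmeas, hm₂ _ hmeas]
    have hL : ∀ ω, (η ω).1 B * {μ : Config d | ∀ i, μ.1 (C i) = n i}.indicator 1 (η ω) =
        (∑ i ∈ J, (n i : ℝ≥0∞)) * {ω | ∀ i, (η ω).1 (C i) = n i}.indicator 1 ω := by
      intro ω
      by_cases hω : ∀ i, (η ω).1 (C i) = n i
      · rw [hJ, measure_biUnion_finset (fun i _ j _ hij => hd hij) fun i _ => hC i]
        simp only [hω]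
        simp [Set.indicator, hω]
      · simp [Set.indicator, hω]
    simp_rw [hL]
    have hmeas' : MeasurableSet {ω | ∀ i, (η ω).1 (C i) = n i} := h.measurable hmeas
    rw [lintegral_const_mul _ (measurable_one.indicator hmeas'),
      lintegral_indicator_one hmeas', Finset.sum_mul]
    have hR : ∫⁻ x in B, P {ω | Config.add (η ω) (Config.pt x) ∈
          {μ : Config d | ∀ i, μ.1 (C i) = n i}} ∂Λ =
        ∑ i ∈ J, ∫⁻ x in C i, P {ω | Config.add (η ω) (Config.pt x) ∈
          {μ : Config d | ∀ i, μ.1 (C i) = n i}} ∂Λ := by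
      rw [hJ, lintegral_biUnion_finset (fun i _ j _ hij => hd hij) fun i _ => hC i]
    rw [hR]
    exact Finset.sum_congr rfl fun i _ => h.mecke_partition hC hd i n

/-- **The Mecke formula** for a Poisson process with finite intensity measure. -/
theorem IsPoissonProcess.mecke [IsProbabilityMeasure P] [IsFiniteMeasure Λ]
    (h : IsPoissonProcess P η Λ) {g : Euc d → Config d → ℝ≥0∞}
    (hg : Measurable (Function.uncurry g)) :
    ∫⁻ ω, ∫⁻ x, g x (η ω) ∂(η ω).1 ∂P =
      ∫⁻ x, ∫⁻ ω, g x (Config.add (η ω) (Config.pt x)) ∂P ∂Λ := by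
  have hadd : Measurable fun p : Euc d × Ω => Config.add (η p.2) (Config.pt p.1) :=
    Config.measurable_add_pt (h.measurable.comp measurable_snd) measurable_fst
  let κ : Kernel Ω (Euc d) := (configKernel d).comap η h.measurable
  let m₁ : Measure (Euc d × Config d) := (P ⊗ₘ κ).map fun p => (p.2, η p.1)
  let m₂ : Measure (Euc d × Config d) :=
    (Λ.prod P).map fun p => (p.1, Config.add (η p.2) (Config.pt p.1))
  have hφ₁ : Measurable fun p : Ω × Euc d => (p.2, η p.1) :=
    measurable_snd.prodMk (h.measurable.comp measurable_fst)
  have hφ₂ : Measurable fun p : Euc d × Ω => (p.1, Config.add (η p.2) (Config.pt p.1)) :=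
    measurable_fst.prodMk hadd
  have hm₁ : ∀ {g : Euc d × Config d → ℝ≥0∞}, Measurable g →
      ∫⁻ p, g p ∂m₁ = ∫⁻ ω, ∫⁻ x, g (x, η ω) ∂(η ω).1 ∂P := by
    intro g hg
    rw [lintegral_map hg hφ₁, Measure.lintegral_compProd (f := fun p => g (p.2, η p.1)) (hg.comp hφ₁)]
    rfl
  have hm₂ : ∀ {g : Euc d × Config d → ℝ≥0∞}, Measurable g →
      ∫⁻ p, g p ∂m₂ = ∫⁻ x, ∫⁻ ω, g (x, Config.add (η ω) (Config.pt x)) ∂P ∂Λ := by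
    intro g hg
    rw [lintegral_map hg hφ₂, lintegral_prod (fun p => g (p.1, Config.add (η p.2) (Config.pt p.1)))
      (hg.comp hφ₂).aemeasurable]
  have hrect : ∀ {B : Set (Euc d)} {E : Set (Config d)}, MeasurableSet B → MeasurableSet E →
      m₁ (B ×ˢ E) = m₂ (B ×ˢ E) := by
    intro B E hB hE
    rw [← lintegral_indicator_one (hB.prod hE), ← lintegral_indicator_one (hB.prod hE),
      hm₁ (measurable_one.indicator (hB.prod hE)), hm₂ (measurable_one.indicator (hB.prod hE))]
    have h1 : ∀ ω, ∫⁻ x, (B ×ˢ E).indicator 1 (x, η ω) ∂(η ω).1 =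
        (η ω).1 B * E.indicator 1 (η ω) := by
      intro ω
      rw [← lintegral_indicator_one hB, ← lintegral_mul_const _ (measurable_one.indicator hB)]
      refine lintegral_congr fun x => ?_
      by_cases hx : x ∈ B <;> by_cases hE' : η ω ∈ E <;> simp [hx, hE', Set.indicator]
    have h2 : ∀ x, ∫⁻ ω, (B ×ˢ E).indicator 1 (x, Config.add (η ω) (Config.pt x)) ∂P =
        B.indicator (fun x => P {ω | Config.add (η ω) (Config.pt x) ∈ E}) x := by
      intro x
      have hmx : MeasurableSet {ω | Config.add (η ω) (Config.pt x) ∈ E} :=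
        (Config.measurable_add_pt h.measurable measurable_const) hE
      by_cases hx : x ∈ B
      · rw [Set.indicator_of_mem hx, ← lintegral_indicator_one hmx]
        refine lintegral_congr fun ω => ?_
        by_cases hE' : Config.add (η ω) (Config.pt x) ∈ E <;> simp [hx, hE', Set.indicator]
      · simp [hx, Set.indicator]
    simp_rw [h1, h2]
    rw [lintegral_indicator hB]
    exact h.mecke_rectangle hB hE
  have : m₁ = m₂ := by
    -- The uniqueness theorem is applied with `m₂` first, since finiteness is evident only for that
    -- measure.
    refine (ext_of_generate_finite _ generateFrom_prod.symm isPiSystem_prod ?_ ?_).symm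
    · rintro _ ⟨B, hB, E, hE, rfl⟩
      exact (hrect hB hE).symm
    · rw [← Set.univ_prod_univ]
      exact (hrect MeasurableSet.univ MeasurableSet.univ).symm
  have := congrArg (fun m => ∫⁻ p, Function.uncurry g p ∂m) this
  simp only [hm₁ hg, hm₂ hg] at this
  exact this

/-- The two-point Mecke formula, summing over pairs of points at different places. -/
theorem IsPoissonProcess.mecke_pair [IsProbabilityMeasure P] [IsFiniteMeasure Λ]
    (h : IsPoissonProcess P η Λ) {g : Euc d → Euc d → Config d → ℝ≥0∞}
    (hg : Measurable fun p : Euc d × Euc d × Config d => g p.1 p.2.1 p.2.2)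
    (hdiag : ∀ x μ, g x x μ = 0) :
    ∫⁻ ω, ∫⁻ x, ∫⁻ y, g x y (η ω) ∂(η ω).1 ∂(η ω).1 ∂P =
      ∫⁻ x, ∫⁻ y, ∫⁻ ω, g x y (Config.add (Config.add (η ω) (Config.pt y)) (Config.pt x))
        ∂P ∂Λ ∂Λ := by
  have h1 : Measurable (Function.uncurry fun (x : Euc d) (μ : Config d) => ∫⁻ y, g x y μ ∂μ.1) := by
    refine Config.measurable_lintegral (F := fun p : Euc d × Config d => p.2) measurable_snd
      (g := fun p y => g p.1 y p.2) ?_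
    exact hg.comp (by fun_prop : Measurable fun q : (Euc d × Config d) × Euc d =>
      (q.1.1, q.2, q.1.2))
  rw [h.mecke h1]
  refine lintegral_congr fun x => ?_
  -- The point `x` that was just added would be paired with itself; `hdiag` removes this term.
  have h2 : ∀ ω, ∫⁻ y, g x y (Config.add (η ω) (Config.pt x))
      ∂(Config.add (η ω) (Config.pt x)).1 =
      ∫⁻ y, g x y (Config.add (η ω) (Config.pt x)) ∂(η ω).1 := by
    intro ω
    simp only [Config.add]
    rw [lintegral_add_measure]
    simp [Config.pt, lintegral_dirac, hdiag]
  simp_rw [h2]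
  refine h.mecke (g := fun y μ => g x y (Config.add μ (Config.pt x))) ?_
  exact hg.comp (measurable_const.prodMk (measurable_fst.prodMk
    (Config.measurable_add_pt measurable_snd measurable_const)))

/-- The intensity measure of a Poisson process is its mean measure. -/
theorem IsPoissonProcess.lintegral_eval [IsProbabilityMeasure P] [IsFiniteMeasure Λ]
    (h : IsPoissonProcess P η Λ) {B : Set (Euc d)} (hB : MeasurableSet B) :
    ∫⁻ ω, (η ω).1 B ∂P = Λ B := by
  have := h.mecke_rectangle hB MeasurableSet.univ
  simpa using this

/-- A Poisson process with diffuse intensity measure is simple. -/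
theorem IsPoissonProcess.ae_simple [IsProbabilityMeasure P] [IsFiniteMeasure Λ]
    (h : IsPoissonProcess P η Λ) (hΛ : ∀ x, Λ {x} = 0) :
    ∀ᵐ ω ∂P, ∀ x, (η ω).1 {x} ≤ 1 := by
  have hdiag : MeasurableSet {p : (Euc d × Config d) × Euc d | p.2 = p.1.1} :=
    measurableSet_eq_fun measurable_snd (measurable_fst.comp measurable_fst)
  have hsing : Measurable fun p : Euc d × Config d => p.2.1 {p.1} := by
    have := Config.measurable_section (F := fun p : Euc d × Config d => p.2) measurable_snd hdiag
    exact this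
  have hset : MeasurableSet {p : Euc d × Config d | 1 < p.2.1 {p.1}} :=
    hsing measurableSet_Ioi
  have hg : Measurable (Function.uncurry fun (x : Euc d) (μ : Config d) =>
      {p : Euc d × Config d | 1 < p.2.1 {p.1}}.indicator (1 : Euc d × Config d → ℝ≥0∞) (x, μ)) :=
    measurable_one.indicator hset
  have h1 := h.mecke hg
  have h2 : ∀ x, ∫⁻ ω, {p : Euc d × Config d | 1 < p.2.1 {p.1}}.indicator (1 : Euc d × Config d → ℝ≥0∞)
      (x, Config.add (η ω) (Config.pt x)) ∂P = 0 := by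
    intro x
    -- For the added point to be multiple, the process itself must charge the place `x`, which has
    -- no intensity.
    have h0 : ∫⁻ ω, (η ω).1 {x} ∂P = 0 := by
      rw [h.lintegral_eval (measurableSet_singleton x), hΛ x]
    rw [lintegral_eq_zero_iff (h.measurable_eval (measurableSet_singleton x))] at h0
    rw [← lintegral_zero (μ := P)]
    refine lintegral_congr_ae ?_
    filter_upwards [h0] with ω hω
    refine Set.indicator_of_notMem ?_ _
    simp only [Set.mem_ofPred_eq, Config.add_pt_apply _ _ (measurableSet_singleton x)]
    rw [hω]
    simp
  simp_rw [h2, lintegral_zero] at h1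
  have hin : Measurable fun ω => ∫⁻ x, {p : Euc d × Config d | 1 < p.2.1 {p.1}}.indicator
      (1 : Euc d × Config d → ℝ≥0∞) (x, η ω) ∂(η ω).1 :=
    Config.measurable_lintegral h.measurable
      (hg.comp (measurable_snd.prodMk (h.measurable.comp measurable_fst)))
  rw [lintegral_eq_zero_iff hin] at h1
  filter_upwards [h1] with ω hω x
  by_contra! hx
  have hmx : MeasurableSet {x : Euc d | 1 < (η ω).1 {x}} :=
    (η ω).measurableSet_of_subset_atoms fun y hy => zero_lt_one.trans hy
  have h3 : ∫⁻ x, {p : Euc d × Config d | 1 < p.2.1 {p.1}}.indicator (1 : Euc d × Config d → ℝ≥0∞)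
      (x, η ω) ∂(η ω).1 = (η ω).1 {x : Euc d | 1 < (η ω).1 {x}} := by
    rw [← lintegral_indicator_one hmx]
    rfl
  have h4 : (η ω).1 {x} ≤ (η ω).1 {x : Euc d | 1 < (η ω).1 {x}} :=
    measure_mono (Set.singleton_subset_iff.2 hx)
  rw [← h3, hω] at h4
  exact absurd (h4.trans_lt zero_lt_one) (not_lt.2 hx.le)

end Mecke

/-! ### Comparison of point processes cell by cell -/

section Comparison

variable {d : ℕ} {Ω : Type*} [MeasurableSpace Ω] {P : Measure Ω}

theorem integrable_of_abs_le_one {α : Type*} [MeasurableSpace α] {m : Measure α}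
    [IsFiniteMeasure m] {f : α → ℝ} (hf : Measurable f) (hb : ∀ a, |f a| ≤ 1) : Integrable f m :=
  Integrable.of_bound hf.aestronglyMeasurable 1 (ae_of_all _ hb)

theorem abs_integral_le_one {α : Type*} [MeasurableSpace α] {m : Measure α}
    [IsProbabilityMeasure m] {f : α → ℝ} (hb : ∀ a, |f a| ≤ 1) : |∫ a, f a ∂m| ≤ 1 := by
  have := norm_integral_le_of_norm_le_const (μ := m) (f := f) (C := 1) (ae_of_all _ hb)
  simpa using this

theorem integral_indepFun_eq [IsProbabilityMeasure P] {α β : Type*} [MeasurableSpace α]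
    [MeasurableSpace β] {X : Ω → α} {Y : Ω → β} (hX : Measurable X) (hY : Measurable Y)
    (h : IndepFun X Y P) {f : α → β → ℝ} (hf : Measurable (Function.uncurry f))
    (hb : ∀ a b, |f a b| ≤ 1) :
    ∫ ω, f (X ω) (Y ω) ∂P = ∫ ω, ∫ ω', f (X ω) (Y ω') ∂P ∂P := by
  have := Measure.isProbabilityMeasure_map (μ := P) hX.aemeasurable
  have := Measure.isProbabilityMeasure_map (μ := P) hY.aemeasurable
  have h1 := (indepFun_iff_map_prod_eq_prod_map_map hX.aemeasurable hY.aemeasurable).1 h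
  calc ∫ ω, f (X ω) (Y ω) ∂P
      = ∫ p, Function.uncurry f p ∂(P.map fun ω => (X ω, Y ω)) := by
        rw [integral_map (hX.prodMk hY).aemeasurable hf.aestronglyMeasurable]
        rfl
    _ = ∫ a, ∫ b, f a b ∂(P.map Y) ∂(P.map X) := by
        rw [h1, integral_prod _ (integrable_of_abs_le_one hf fun p => hb p.1 p.2)]
        rfl
    _ = ∫ ω, ∫ ω', f (X ω) (Y ω') ∂P ∂P := by
        rw [integral_map (f := fun a => ∫ b, f a b ∂(P.map Y)) hX.aemeasurable
          (hf.stronglyMeasurable.integral_prod_right'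
            (f := Function.uncurry f)).aestronglyMeasurable]
        refine integral_congr_ae (ae_of_all _ fun ω => ?_)
        exact integral_map hY.aemeasurable
          (hf.comp measurable_prodMk_left).aestronglyMeasurable

theorem Config.eq_zero_of_univ {μ : Config d} (h : μ.1 Set.univ = 0) : μ = Config.zero d :=
  Subtype.ext (Measure.measure_univ_eq_zero.1 h)

/-- Replacing one cell of the configuration `X` by the corresponding cell of an independent copy
of `Y`. -/
theorem hybrid_step [IsProbabilityMeasure P] {h : Config d → ℝ} (hh : Measurable h)
    (h0 : ∀ μ, 0 ≤ h μ) (h1 : ∀ μ, h μ ≤ 1) {U U₀ β W γ : Ω → Config d}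
    (hU : Measurable U) (hU₀ : Measurable U₀) (hβ : Measurable β) (hW : Measurable W)
    (hγ : Measurable γ) {A : Set Ω} (hA : MeasurableSet A) (hUA : ∀ ω ∉ A, U ω = U₀ ω)
    (hi : IndepFun U₀ β P) (hi' : IndepFun W γ P) {ε : ℝ}
    (hε : ∀ F : Config d → ℝ, Measurable F → (∀ μ, |F μ| ≤ 1) → F (Config.zero d) = 0 →
      ∫ ω, F (β ω) ∂P ≤ ∫ ω, F (γ ω) ∂P + ε) :
    ∫ p, h (Config.add (Config.add (U p.1) (W p.2)) (β p.1)) ∂(P.prod P) ≤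
      ∫ p, h (Config.add (Config.add (U p.1) (W p.2)) (γ p.2)) ∂(P.prod P) +
        (2 * P.real (A ∩ {ω | (β ω).1 Set.univ ≠ 0}) +
          2 * (P.real A * P.real {ω | (γ ω).1 Set.univ ≠ 0}) + ε) := by
  -- The increment vanishes when the cell `b` is empty. Hence changing `U` to `U₀` matters only on
  -- `A` together with an occupied cell, and then by at most 2.
  let g : Config d → Config d → ℝ := fun a b => h (Config.add a b) - h a
  have hg : Measurable (Function.uncurry g) :=
    (hh.comp Config.measurable_add).sub (hh.comp measurable_fst)
  have hgb : ∀ a b, |g a b| ≤ 1 := fun a b => by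
    rw [abs_le]
    constructor <;> simp only [g] <;> linarith [h0 (Config.add a b), h1 (Config.add a b), h0 a, h1 a]
  have hg0 : ∀ a, g a (Config.zero d) = 0 := fun a => by simp [g, Config.add_zero]
  have hgm : ∀ {α : Type _} [MeasurableSpace α] {F G : α → Config d}, Measurable F → Measurable G →
      Measurable fun x => g (F x) (G x) := fun hF hG => hg.comp (hF.prodMk hG)
  have hgm₀ : ∀ {α : Type} [MeasurableSpace α] {F G : α → Config d}, Measurable F → Measurable G →
      Measurable fun x => g (F x) (G x) := fun hF hG => hg.comp (hF.prodMk hG)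
  have huniv : ∀ {γ : Ω → Config d}, Measurable γ → MeasurableSet {ω | (γ ω).1 Set.univ ≠ 0} :=
    fun hγ => ((Config.measurable_eval MeasurableSet.univ).comp hγ)
      (measurableSet_singleton 0).compl
  have mU : Measurable fun p : Ω × Ω => Config.add (U p.1) (W p.2) :=
    Config.measurable_add.comp ((hU.comp measurable_fst).prodMk (hW.comp measurable_snd))
  have mU₀ : Measurable fun p : Ω × Ω => Config.add (U₀ p.1) (W p.2) :=
    Config.measurable_add.comp ((hU₀.comp measurable_fst).prodMk (hW.comp measurable_snd))
  have mβ : Measurable fun p : Ω × Ω => β p.1 := hβ.comp measurable_fst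
  have mγ : Measurable fun p : Ω × Ω => γ p.2 := hγ.comp measurable_snd
  have hint : ∀ {F G : Ω × Ω → Config d}, Measurable F → Measurable G →
      Integrable (fun p => g (F p) (G p)) (P.prod P) := fun hF hG =>
    integrable_of_abs_le_one (hgm hF hG) fun p => hgb _ _
  have hhint : ∀ {F : Ω × Ω → Config d}, Measurable F →
      Integrable (fun p => h (F p)) (P.prod P) := fun hF =>
    integrable_of_abs_le_one (hh.comp hF) fun p => by
      rw [abs_of_nonneg (h0 _)]; exact h1 _
  -- passage from the differences to `g`
  have e1 : ∀ {G : Ω × Ω → Config d}, Measurable G →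
      ∫ p, h (Config.add (Config.add (U p.1) (W p.2)) (G p)) ∂(P.prod P) =
      ∫ p, g (Config.add (U p.1) (W p.2)) (G p) ∂(P.prod P) +
        ∫ p, h (Config.add (U p.1) (W p.2)) ∂(P.prod P) := by
    intro G hG
    rw [← integral_add (hint mU hG) (hhint mU)]
    simp [g]
  rw [e1 mβ, e1 mγ]
  -- first replacement of `U` by `U₀`
  have s1 : ∫ p, g (Config.add (U p.1) (W p.2)) (β p.1) ∂(P.prod P) ≤
      ∫ p, g (Config.add (U₀ p.1) (W p.2)) (β p.1) ∂(P.prod P) +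
        2 * P.real (A ∩ {ω | (β ω).1 Set.univ ≠ 0}) := by
    have hm : MeasurableSet ((A ∩ {ω | (β ω).1 Set.univ ≠ 0}) ×ˢ (Set.univ : Set Ω)) :=
      (hA.inter (huniv hβ)).prod MeasurableSet.univ
    have hr : 2 * P.real (A ∩ {ω | (β ω).1 Set.univ ≠ 0}) =
        ∫ p, ((A ∩ {ω | (β ω).1 Set.univ ≠ 0}) ×ˢ (Set.univ : Set Ω)).indicator
          (fun _ => (2 : ℝ)) p ∂(P.prod P) := by
      rw [integral_indicator_const _ hm, measureReal_prod_prod]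
      simp [mul_comm]
    rw [hr, ← integral_add (hint mU₀ mβ) ((integrable_const _).indicator hm)]
    refine integral_mono (hint mU mβ) ((hint mU₀ mβ).add ((integrable_const _).indicator hm)) ?_
    intro p
    by_cases hb : (β p.1).1 Set.univ = 0
    · simp only [Config.eq_zero_of_univ hb, hg0, zero_add]
      exact Set.indicator_nonneg (fun _ _ => zero_le_two) _
    · by_cases ha : p.1 ∈ A
      · have : p ∈ (A ∩ {ω | (β ω).1 Set.univ ≠ 0}) ×ˢ (Set.univ : Set Ω) :=
          ⟨⟨ha, hb⟩, trivial⟩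
        simp only [Set.indicator_of_mem this]
        linarith [abs_le.1 (hgb (Config.add (U p.1) (W p.2)) (β p.1)),
          abs_le.1 (hgb (Config.add (U₀ p.1) (W p.2)) (β p.1))]
      · have : p ∉ (A ∩ {ω | (β ω).1 Set.univ ≠ 0}) ×ˢ (Set.univ : Set Ω) := fun h => ha h.1.1
        simp only [Set.indicator_of_notMem this, hUA _ ha, add_zero, le_refl]
  -- second replacement of `U` by `U₀`
  have s2 : ∫ p, g (Config.add (U₀ p.1) (W p.2)) (γ p.2) ∂(P.prod P) ≤
      ∫ p, g (Config.add (U p.1) (W p.2)) (γ p.2) ∂(P.prod P) +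
        2 * (P.real A * P.real {ω | (γ ω).1 Set.univ ≠ 0}) := by
    have hm : MeasurableSet (A ×ˢ {ω | (γ ω).1 Set.univ ≠ 0}) := hA.prod (huniv hγ)
    have hr : 2 * (P.real A * P.real {ω | (γ ω).1 Set.univ ≠ 0}) =
        ∫ p, (A ×ˢ {ω | (γ ω).1 Set.univ ≠ 0}).indicator (fun _ => (2 : ℝ)) p ∂(P.prod P) := by
      rw [integral_indicator_const _ hm, measureReal_prod_prod, smul_eq_mul, mul_comm]
    rw [hr, ← integral_add (hint mU mγ) ((integrable_const _).indicator hm)]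
    refine integral_mono (hint mU₀ mγ) ((hint mU mγ).add ((integrable_const _).indicator hm)) ?_
    intro p
    by_cases hb : (γ p.2).1 Set.univ = 0
    · simp only [Config.eq_zero_of_univ hb, hg0, zero_add]
      exact Set.indicator_nonneg (fun _ _ => zero_le_two) _
    · by_cases ha : p.1 ∈ A
      · have : p ∈ A ×ˢ {ω | (γ ω).1 Set.univ ≠ 0} := ⟨ha, hb⟩
        simp only [Set.indicator_of_mem this]
        linarith [abs_le.1 (hgb (Config.add (U p.1) (W p.2)) (γ p.2)),
          abs_le.1 (hgb (Config.add (U₀ p.1) (W p.2)) (γ p.2))]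
      · have : p ∉ A ×ˢ {ω | (γ ω).1 Set.univ ≠ 0} := fun h => ha h.1
        simp only [Set.indicator_of_notMem this, hUA _ ha, add_zero, le_refl]
  -- comparison of the two cells given the independent remainder
  have s3 : ∫ p, g (Config.add (U₀ p.1) (W p.2)) (β p.1) ∂(P.prod P) ≤
      ∫ p, g (Config.add (U₀ p.1) (W p.2)) (γ p.2) ∂(P.prod P) + ε := by
    have mtriple : ∀ {β : Ω → Config d}, Measurable β →
        Measurable fun q : (Ω × Ω) × Ω => g (Config.add (U₀ q.1.1) (W q.1.2)) (β q.2) := fun hβ =>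
      hgm (mU₀.comp measurable_fst) (hβ.comp measurable_snd)
    have hint2 : ∀ {β : Ω → Config d}, Measurable β →
        Integrable (fun p : Ω × Ω => ∫ ω', g (Config.add (U₀ p.1) (W p.2)) (β ω') ∂P)
          (P.prod P) := fun hβ =>
      integrable_of_abs_le_one
        (mtriple hβ).stronglyMeasurable.integral_prod_right'.measurable
        fun p => abs_integral_le_one fun ω' => hgb _ _
    have l1 : ∫ p, g (Config.add (U₀ p.1) (W p.2)) (β p.1) ∂(P.prod P) =
        ∫ p, (∫ ω', g (Config.add (U₀ p.1) (W p.2)) (β ω') ∂P) ∂(P.prod P) := by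
      rw [integral_prod_symm _ (hint mU₀ mβ), integral_prod_symm _ (hint2 hβ)]
      refine integral_congr_ae (ae_of_all _ fun ω₂ => ?_)
      refine integral_indepFun_eq (f := fun u b => g (Config.add u (W ω₂)) b) hU₀ hβ hi ?_
        fun _ _ => hgb _ _
      exact hgm₀ (Config.measurable_add.comp (measurable_fst.prodMk measurable_const))
        measurable_snd
    have l2 : ∫ p, g (Config.add (U₀ p.1) (W p.2)) (γ p.2) ∂(P.prod P) =
        ∫ p, (∫ ω', g (Config.add (U₀ p.1) (W p.2)) (γ ω') ∂P) ∂(P.prod P) := by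
      rw [integral_prod _ (hint mU₀ mγ), integral_prod _ (hint2 hγ)]
      refine integral_congr_ae (ae_of_all _ fun ω₁ => ?_)
      refine integral_indepFun_eq (f := fun u b => g (Config.add (U₀ ω₁) u) b) hW hγ hi' ?_
        fun _ _ => hgb _ _
      exact hgm₀ (Config.measurable_add.comp (measurable_const.prodMk measurable_fst))
        measurable_snd
    rw [l1, l2]
    have : ∫ p, (∫ ω', g (Config.add (U₀ p.1) (W p.2)) (γ ω') ∂P) ∂(P.prod P) + ε =
        ∫ p, ((∫ ω', g (Config.add (U₀ p.1) (W p.2)) (γ ω') ∂P) + ε) ∂(P.prod P) := by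
      rw [integral_add (hint2 hγ) (integrable_const _)]
      simp
    rw [this]
    refine integral_mono (hint2 hβ) ((hint2 hγ).add (integrable_const _)) fun p => ?_
    exact hε (fun b => g (Config.add (U₀ p.1) (W p.2)) b) (hgm₀ measurable_const measurable_id)
      (fun μ => hgb _ _) (hg0 _)
  linarith

/-- **Comparison of point processes.** If the points of `X` in a cell are independent of the points
of `X` in the earlier cells that are far away, and `Y` has independent cells, then the laws of `X`
and `Y` are close as soon as their restrictions to the single cells are close and it is unlikely
that both a cell and its near past contain points. -/
theorem comparison_of_cells [IsProbabilityMeasure P] {X Y : Ω → Config d}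
    (hX : Measurable X) (hY : Measurable Y) (n : ℕ) (Q N : ℕ → Set (Euc d))
    (hQ : ∀ i, MeasurableSet (Q i)) (hN : ∀ i, MeasurableSet (N i))
    (hQd : Pairwise fun i j => Disjoint (Q i) (Q j))
    (hXs : ∀ᵐ ω ∂P, (X ω).1 (⋃ j ∈ Finset.range n, Q j)ᶜ = 0)
    (hYs : ∀ᵐ ω ∂P, (Y ω).1 (⋃ j ∈ Finset.range n, Q j)ᶜ = 0)
    (hXi : ∀ i < n, IndepFun (fun ω => Config.res ((⋃ j ∈ Finset.range i, Q j) \ N i) (X ω))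
      (fun ω => Config.res (Q i) (X ω)) P)
    (hYi : ∀ i < n, IndepFun (fun ω => Config.res (⋃ j ∈ Finset.Ico (i + 1) n, Q j) (Y ω))
      (fun ω => Config.res (Q i) (Y ω)) P)
    (ε : ℕ → ℝ) (hε : ∀ i < n, ∀ F : Config d → ℝ, Measurable F → (∀ μ, |F μ| ≤ 1) →
      F (Config.zero d) = 0 →
      ∫ ω, F (Config.res (Q i) (X ω)) ∂P ≤ ∫ ω, F (Config.res (Q i) (Y ω)) ∂P + ε i)
    {A : Set (Config d)} (hA : MeasurableSet A) :
    P.real (X ⁻¹' A) ≤ P.real (Y ⁻¹' A) + ∑ i ∈ Finset.range n,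
      (2 * P.real {ω | (X ω).1 ((⋃ j ∈ Finset.range i, Q j) ∩ N i) ≠ 0 ∧ (X ω).1 (Q i) ≠ 0} +
        2 * (P.real {ω | (X ω).1 ((⋃ j ∈ Finset.range i, Q j) ∩ N i) ≠ 0} *
          P.real {ω | (Y ω).1 (Q i) ≠ 0}) + ε i) := by
  classical
  let U : ℕ → Set (Euc d) := fun i => ⋃ j ∈ Finset.range i, Q j
  let V : ℕ → Set (Euc d) := fun i => ⋃ j ∈ Finset.Ico i n, Q j
  have hU : ∀ i, MeasurableSet (U i) := fun i => Finset.measurableSet_biUnion _ fun j _ => hQ j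
  have hV : ∀ i, MeasurableSet (V i) := fun i => Finset.measurableSet_biUnion _ fun j _ => hQ j
  let h : Config d → ℝ := A.indicator fun _ => 1
  have hh : Measurable h := measurable_const.indicator hA
  have h0 : ∀ μ, 0 ≤ h μ := fun μ => Set.indicator_nonneg (fun _ _ => zero_le_one) _
  have h1 : ∀ μ, h μ ≤ 1 := fun μ => Set.indicator_le_self' (fun _ _ => zero_le_one) _
  -- The hybrids live on `P.prod P`: the first `i` cells come from `X`, the others from an
  -- independent copy of `Y`. They interpolate between the law of `Y` at 0 and that of `X` at `n`.
  let H : ℕ → ℝ := fun i =>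
    ∫ p, h (Config.add (Config.res (U i) (X p.1)) (Config.res (V i) (Y p.2))) ∂(P.prod P)
  let e : ℕ → ℝ := fun i =>
    2 * P.real {ω | (X ω).1 (U i ∩ N i) ≠ 0 ∧ (X ω).1 (Q i) ≠ 0} +
        2 * (P.real {ω | (X ω).1 (U i ∩ N i) ≠ 0} * P.real {ω | (Y ω).1 (Q i) ≠ 0}) + ε i
  have hres : ∀ {X : Ω → Config d}, Measurable X → ∀ {S}, MeasurableSet S →
      Measurable fun ω => Config.res S (X ω) := fun hX _ hS => (Config.measurable_res hS).comp hX
  have hstep : ∀ i < n, H (i + 1) ≤ H i + e i := by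
    intro i hin
    have hUs : U (i + 1) = U i ∪ Q i := by
      simp only [U, Finset.range_add_one, Finset.set_biUnion_insert]
      exact Set.union_comm _ _
    have hVs : V i = V (i + 1) ∪ Q i := by
      simp only [V, ← Finset.insert_Ico_add_one_left_eq_Ico hin, Finset.set_biUnion_insert]
      exact Set.union_comm _ _
    have dU : Disjoint (U i) (Q i) := by
      simp only [U, Set.disjoint_iUnion_left]
      intro j hj
      exact hQd (Finset.mem_range.1 hj).ne
    have dV : Disjoint (V (i + 1)) (Q i) := by
      simp only [V, Set.disjoint_iUnion_left]
      intro j hj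
      exact hQd (by have := (Finset.mem_Ico.1 hj).1; omega)
    have hAm : MeasurableSet {ω | (X ω).1 (U i ∩ N i) ≠ 0} :=
      ((Config.measurable_eval ((hU i).inter (hN i))).comp hX) (measurableSet_singleton 0).compl
    have key := hybrid_step (P := P) hh h0 h1 (hres hX (hU i)) (hres hX ((hU i).diff (hN i)))
      (hres hX (hQ i)) (hres hY (hV (i + 1))) (hres hY (hQ i)) hAm (by
        intro ω hω
        have hz : (X ω).1 (U i ∩ N i) = 0 := by simpa using hω
        have := Config.res_union (S := U i \ N i) (T := U i ∩ N i)
          Set.disjoint_sdiff_inter ((hU i).inter (hN i)) (X ω)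
        rw [Set.sdiff_union_inter, Config.res_eq_zero hz, Config.add_zero] at this
        exact this) (hXi i hin) (hYi i hin) (hε i hin)
    have hl : H (i + 1) = ∫ p, h (Config.add (Config.add (Config.res (U i) (X p.1))
        (Config.res (V (i + 1)) (Y p.2))) (Config.res (Q i) (X p.1))) ∂(P.prod P) := by
      simp only [H, hUs]
      refine integral_congr_ae (ae_of_all _ fun p => ?_)
      simp only
      rw [Config.res_union dU (hQ i), Config.add_assoc, Config.add_assoc,
        Config.add_comm (Config.res (Q i) _)]
    have hr : H i = ∫ p, h (Config.add (Config.add (Config.res (U i) (X p.1))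
        (Config.res (V (i + 1)) (Y p.2))) (Config.res (Q i) (Y p.2))) ∂(P.prod P) := by
      simp only [H, hVs]
      refine integral_congr_ae (ae_of_all _ fun p => ?_)
      simp only
      rw [Config.res_union dV (hQ i), Config.add_assoc]
    rw [hl, hr]
    refine key.trans (le_of_eq ?_)
    simp only [Config.res, Measure.restrict_apply_univ, e]
    rfl
  have hsum : ∀ i ≤ n, H i ≤ H 0 + ∑ j ∈ Finset.range i, e j := by
    intro i
    induction i with
    | zero => simp
    | succ i ih =>
      intro hi
      rw [Finset.sum_range_succ]
      linarith [ih (by omega), hstep i (by omega)]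
  have hae : ∀ {X : Ω → Config d}, Measurable X →
      (∀ᵐ ω ∂P, (X ω).1 (⋃ j ∈ Finset.range n, Q j)ᶜ = 0) →
      P.real (X ⁻¹' A) = ∫ ω, h (Config.res (U n) (X ω)) ∂P := by
    intro X hX hXs
    rw [← integral_indicator_one (hX hA)]
    refine integral_congr_ae ?_
    filter_upwards [hXs] with ω hω
    have : Config.res (U n) (X ω) = X ω := Subtype.ext (Measure.restrict_eq_self_of_ae_mem (by
      rw [ae_iff]; exact hω))
    rw [this]
    rfl
  have hVn : V n = ∅ := by simp [V]
  have hV0 : V 0 = U n := by simp [V, U]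
  have hU0 : U 0 = ∅ := by simp [U]
  have hHn : H n = P.real (X ⁻¹' A) := by
    rw [hae hX hXs]
    simp only [H, hVn]
    have : ∀ p : Ω × Ω, h (Config.add (Config.res (U n) (X p.1)) (Config.res ∅ (Y p.2))) =
        h (Config.res (U n) (X p.1)) := fun p => by
      rw [Config.res_eq_zero (measure_empty), Config.add_zero]
    simp_rw [this]
    rw [integral_fun_fst (fun ω => h (Config.res (U n) (X ω)))]
    simp
  have hH0 : H 0 = P.real (Y ⁻¹' A) := by
    rw [hae hY hYs]
    simp only [H, hU0, hV0]
    have : ∀ p : Ω × Ω, h (Config.add (Config.res ∅ (X p.1)) (Config.res (U n) (Y p.2))) =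
        h (Config.res (U n) (Y p.2)) := fun p => by
      rw [Config.add_comm, Config.res_eq_zero (measure_empty), Config.add_zero]
    simp_rw [this]
    rw [integral_fun_snd (fun ω => h (Config.res (U n) (Y ω)))]
    simp
  have := hsum n le_rfl
  rwa [hHn, hH0] at this

end Comparison

/-! ### Total variation bound from mean measures and close pairs. -/

section PoissonComparison

variable {d : ℕ} {Ω : Type*} [MeasurableSpace Ω] {P : Measure Ω}

/-- The mass of the pairs of points at different places in `Q`. -/
def pairMass (μ : Measure (Euc d)) (Q : Set (Euc d)) : ℝ≥0∞ := ∫⁻ x in Q, μ (Q \ {x}) ∂μ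

/-- A functional of the points in a cell is, up to the number of pairs of points, additive. -/
theorem Config.cell_bounds (μ : Config d) {Q : Set (Euc d)} (hQ : MeasurableSet Q)
    (hfin : μ.1 Q ≠ ∞) (hs : ∀ x, μ.1 {x} ≤ 1) {F : Config d → ℝ≥0∞} (h1 : ∀ μ, F μ ≤ 1)
    (h0 : F (Config.zero d) = 0) :
    F (Config.res Q μ) ≤ ∫⁻ x in Q, F (Config.pt x) ∂μ.1 + pairMass μ.1 Q ∧
      ∫⁻ x in Q, F (Config.pt x) ∂μ.1 ≤ F (Config.res Q μ) + pairMass μ.1 Q := by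
  obtain ⟨n, hn⟩ := μ.exists_nat hQ hfin
  -- With at most one point the functional and its additive version coincide. With `n ≥ 2` simple
  -- points each has another one in the cell, so the pair mass is at least `n` and dominates both
  -- quantities.
  rcases Nat.lt_or_ge n 2 with hlt | hge
  · interval_cases n
    · have hz : μ.1 Q = 0 := by simpa using hn
      have hr : μ.1.restrict Q = 0 := Measure.restrict_eq_zero.2 hz
      rw [Config.res_eq_zero hz, h0, hr]
      simp
    · have hne : μ.1 Q ≠ 0 := by rw [hn]; simp
      have hex : ∃ x ∈ Q, 0 < μ.1 {x} := by
        by_contra! hcon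
        refine hne (measure_mono_null (fun x hx => ?_) (ae_iff.1 μ.ae_atom))
        exact not_lt.2 (hcon x hx)
      obtain ⟨x, hxQ, hx⟩ := hex
      have hx1 : μ.1 {x} = 1 := le_antisymm (hs x) (μ.one_le_of_pos (measurableSet_singleton x) hx)
      have hdiff : μ.1 (Q \ {x}) = 0 := by
        rw [measure_sdiff (Set.singleton_subset_iff.2 hxQ)
          (measurableSet_singleton x).nullMeasurableSet (by simp [hx1]), hn, hx1]
        simp
      have hres : μ.1.restrict Q = Measure.dirac x := by
        have hQu : Q = {x} ∪ (Q \ {x}) := by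
          rw [Set.union_sdiff_cancel (Set.singleton_subset_iff.2 hxQ)]
        rw [hQu, Measure.restrict_union Set.disjoint_sdiff_right
          (hQ.diff (measurableSet_singleton x)), Measure.restrict_eq_zero.2 hdiff, _root_.add_zero,
          Measure.restrict_singleton, hx1, one_smul]
      have hpt : Config.res Q μ = Config.pt x := Subtype.ext hres
      rw [hpt, hres, lintegral_dirac]
      exact ⟨le_self_add, le_self_add⟩
  · have hp : (n : ℝ≥0∞) ≤ pairMass μ.1 Q := by
      have hle : ∀ x, (1 : ℝ≥0∞) ≤ μ.1 (Q \ {x}) := by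
        intro x
        have : μ.1 Q ≤ μ.1 (Q \ {x}) + 1 :=
          (measure_mono (by intro y hy; by_cases h : y = x <;> simp [h, hy])).trans
            ((measure_union_le (Q \ {x}) {x}).trans (by gcongr; exact hs x))
        rw [hn] at this
        have h2 : (1 : ℝ≥0∞) + 1 ≤ μ.1 (Q \ {x}) + 1 := by
          rw [one_add_one_eq_two]
          exact le_trans (by exact_mod_cast hge) this
        exact (ENNReal.add_le_add_iff_right ENNReal.one_ne_top).1 h2
      calc (n : ℝ≥0∞) = ∫⁻ _ in Q, 1 ∂μ.1 := by rw [setLIntegral_one, hn]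
        _ ≤ pairMass μ.1 Q := lintegral_mono fun x => hle x
    have hn1 : (1 : ℝ≥0∞) ≤ n := by exact_mod_cast (by omega : 1 ≤ n)
    refine ⟨(h1 _).trans (hn1.trans (hp.trans le_add_self)), ?_⟩
    calc ∫⁻ x in Q, F (Config.pt x) ∂μ.1 ≤ ∫⁻ _ in Q, 1 ∂μ.1 := lintegral_mono fun x => h1 _
      _ = n := by rw [setLIntegral_one, hn]
      _ ≤ _ := hp.trans le_add_self

theorem measurable_pairMass {α : Type*} [MeasurableSpace α] {X : α → Config d} (hX : Measurable X)
    {Q : Set (Euc d)} (hQ : MeasurableSet Q) : Measurable fun a => pairMass (X a).1 Q := by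
  have hdiag : MeasurableSet {p : (α × Euc d) × Euc d | p.2 ∈ Q ∧ p.2 ≠ p.1.2} :=
    (measurable_snd hQ).inter
      (measurableSet_eq_fun measurable_snd (measurable_snd.comp measurable_fst)).compl
  have h1 := Config.measurable_section (F := fun p : α × Euc d => X p.1)
    (hX.comp measurable_fst) hdiag
  exact Config.measurable_lintegral ((Config.measurable_res hQ).comp hX)
    (g := fun a x => (X a).1 (Q \ {x})) h1

/-- Passing to the additive version of `F` and back costs the pairs of `X` and of `Y`; in between,
only the mean measures enter. -/
theorem cell_comparison_le {X Y : Ω → Config d}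
    (hX : Measurable X) (hY : Measurable Y)
    (hXf : ∀ᵐ ω ∂P, (X ω).1 Set.univ ≠ ∞) (hYf : ∀ᵐ ω ∂P, (Y ω).1 Set.univ ≠ ∞)
    (hXs : ∀ᵐ ω ∂P, ∀ x, (X ω).1 {x} ≤ 1) (hYs : ∀ᵐ ω ∂P, ∀ x, (Y ω).1 {x} ≤ 1)
    {mX mY σ : Measure (Euc d)}
    (hmX : ∀ f : Euc d → ℝ≥0∞, Measurable f → ∫⁻ ω, ∫⁻ x, f x ∂(X ω).1 ∂P = ∫⁻ x, f x ∂mX)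
    (hmY : ∀ f : Euc d → ℝ≥0∞, Measurable f → ∫⁻ ω, ∫⁻ x, f x ∂(Y ω).1 ∂P = ∫⁻ x, f x ∂mY)
    (hσ : mX ≤ mY + σ) {Q : Set (Euc d)} (hQ : MeasurableSet Q)
    {F : Config d → ℝ≥0∞} (hF : Measurable F) (h1 : ∀ μ, F μ ≤ 1) (h0 : F (Config.zero d) = 0) :
    ∫⁻ ω, F (Config.res Q (X ω)) ∂P ≤ ∫⁻ ω, F (Config.res Q (Y ω)) ∂P +
      (∫⁻ ω, pairMass (X ω).1 Q ∂P + ∫⁻ ω, pairMass (Y ω).1 Q ∂P + σ Q) := by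
  have hFp : Measurable fun x => Q.indicator (fun x => F (Config.pt x)) x :=
    (hF.comp Config.measurable_pt).indicator hQ
  have hne : ∀ {μ : Config d}, μ.1 Set.univ ≠ ∞ → μ.1 Q ≠ ∞ := fun h =>
    ((measure_mono (Set.subset_univ _)).trans_lt h.lt_top).ne
  calc ∫⁻ ω, F (Config.res Q (X ω)) ∂P
      ≤ ∫⁻ ω, ((∫⁻ x, Q.indicator (fun x => F (Config.pt x)) x ∂(X ω).1) +
          pairMass (X ω).1 Q) ∂P := by
        refine lintegral_mono_ae ?_
        filter_upwards [hXf, hXs] with ω hf hs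
        rw [lintegral_indicator hQ]
        exact ((X ω).cell_bounds hQ (hne hf) hs h1 h0).1
    _ = ∫⁻ x, Q.indicator (fun x => F (Config.pt x)) x ∂mX + ∫⁻ ω, pairMass (X ω).1 Q ∂P := by
        rw [lintegral_add_right _ (measurable_pairMass hX hQ), hmX _ hFp]
    _ ≤ (∫⁻ x, Q.indicator (fun x => F (Config.pt x)) x ∂mY + σ Q) +
          ∫⁻ ω, pairMass (X ω).1 Q ∂P := by
        gcongr
        refine (lintegral_mono' hσ le_rfl).trans ?_
        rw [lintegral_add_measure]
        gcongr
        rw [lintegral_indicator hQ, ← setLIntegral_one]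
        exact lintegral_mono fun x => h1 _
    _ ≤ ((∫⁻ ω, F (Config.res Q (Y ω)) ∂P + ∫⁻ ω, pairMass (Y ω).1 Q ∂P) + σ Q) +
          ∫⁻ ω, pairMass (X ω).1 Q ∂P := by
        gcongr
        rw [← hmY _ hFp, ← lintegral_add_right _ (measurable_pairMass hY hQ)]
        refine lintegral_mono_ae ?_
        filter_upwards [hYf, hYs] with ω hf hs
        rw [lintegral_indicator hQ]
        exact ((Y ω).cell_bounds hQ (hne hf) hs h1 h0).2
    _ = _ := by ring

/-- The one-sided bound is applied to the positive part of `F`, and with `X` and `Y` exchanged to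
the negative part; hence the factor 2. -/
theorem cell_comparison [IsProbabilityMeasure P] {X Y : Ω → Config d}
    (hX : Measurable X) (hY : Measurable Y)
    (hXf : ∀ᵐ ω ∂P, (X ω).1 Set.univ ≠ ∞) (hYf : ∀ᵐ ω ∂P, (Y ω).1 Set.univ ≠ ∞)
    (hXs : ∀ᵐ ω ∂P, ∀ x, (X ω).1 {x} ≤ 1) (hYs : ∀ᵐ ω ∂P, ∀ x, (Y ω).1 {x} ≤ 1)
    {mX mY σ : Measure (Euc d)}
    (hmX : ∀ f : Euc d → ℝ≥0∞, Measurable f → ∫⁻ ω, ∫⁻ x, f x ∂(X ω).1 ∂P = ∫⁻ x, f x ∂mX)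
    (hmY : ∀ f : Euc d → ℝ≥0∞, Measurable f → ∫⁻ ω, ∫⁻ x, f x ∂(Y ω).1 ∂P = ∫⁻ x, f x ∂mY)
    (hσ : mX ≤ mY + σ) (hσ' : mY ≤ mX + σ) {Q : Set (Euc d)} (hQ : MeasurableSet Q)
    {e : ℝ≥0∞} (he : e ≠ ∞)
    (hle : ∫⁻ ω, pairMass (X ω).1 Q ∂P + ∫⁻ ω, pairMass (Y ω).1 Q ∂P + σ Q ≤ e)
    {F : Config d → ℝ} (hF : Measurable F) (hb : ∀ μ, |F μ| ≤ 1) (h0 : F (Config.zero d) = 0) :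
    ∫ ω, F (Config.res Q (X ω)) ∂P ≤ ∫ ω, F (Config.res Q (Y ω)) ∂P + 2 * e.toReal := by
  have hres : ∀ {X : Ω → Config d}, Measurable X → Measurable fun ω => F (Config.res Q (X ω)) :=
    fun hX => hF.comp ((Config.measurable_res hQ).comp hX)
  have hint : ∀ {X : Ω → Config d}, Measurable X →
      Integrable (fun ω => F (Config.res Q (X ω))) P := fun hX =>
    integrable_of_abs_le_one (hres hX) fun _ => hb _
  have hone : ∀ {G : Config d → ℝ}, (∀ μ, |G μ| ≤ 1) → ∀ μ, ENNReal.ofReal (G μ) ≤ 1 :=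
    fun hG μ => ENNReal.ofReal_le_one.2 ((le_abs_self _).trans (hG μ))
  have hfin : ∀ {G : Config d → ℝ} {X : Ω → Config d}, (∀ μ, |G μ| ≤ 1) →
      ∫⁻ ω, ENNReal.ofReal (G (Config.res Q (X ω))) ∂P ≠ ∞ := by
    intro G X hG
    refine ((lintegral_mono fun ω => hone hG _).trans_lt ?_).ne
    simp
  have hb' : ∀ μ, |(-F μ)| ≤ 1 := fun μ => by rw [abs_neg]; exact hb μ
  have hp := cell_comparison_le hX hY hXf hYf hXs hYs hmX hmY hσ hQ
    (F := fun μ => ENNReal.ofReal (F μ)) hF.ennreal_ofReal (hone hb) (by simp [h0])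
  have hm := cell_comparison_le hY hX hYf hXf hYs hXs hmY hmX hσ' hQ
    (F := fun μ => ENNReal.ofReal (-F μ)) hF.neg.ennreal_ofReal (hone (G := fun μ => -F μ) hb')
    (by simp [h0])
  rw [add_comm (∫⁻ ω, pairMass (Y ω).1 Q ∂P)] at hm
  have hp' := ENNReal.toReal_mono (ENNReal.add_ne_top.2 ⟨hfin hb, he⟩) (hp.trans (by gcongr))
  have hm' := ENNReal.toReal_mono
    (ENNReal.add_ne_top.2 ⟨hfin (G := fun μ => -F μ) hb', he⟩) (hm.trans (by gcongr))
  rw [ENNReal.toReal_add (hfin hb) he] at hp'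
  rw [ENNReal.toReal_add (hfin (G := fun μ => -F μ) hb') he] at hm'
  rw [integral_eq_lintegral_pos_part_sub_lintegral_neg_part (hint hX),
    integral_eq_lintegral_pos_part_sub_lintegral_neg_part (hint hY)]
  linarith

/-- A point process `X` is close in total variation to a Poisson process if it is locally
dependent, has nearly the right intensity and few pairs of close points. -/
theorem IsPoissonProcess.comparison [IsProbabilityMeasure P] {X Y : Ω → Config d}
    {mX mY σ : Measure (Euc d)} [IsFiniteMeasure mY] (hX : Measurable X)
    (hY : IsPoissonProcess P Y mY) (hdiff : ∀ x, mY {x} = 0) {K : Set (Euc d)} (hK : IsCompact K)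
    (hYK : mY Kᶜ = 0) (hXK : ∀ᵐ ω ∂P, (X ω).1 Kᶜ = 0)
    (hXf : ∀ᵐ ω ∂P, (X ω).1 Set.univ ≠ ∞) (hXs : ∀ᵐ ω ∂P, ∀ x, (X ω).1 {x} ≤ 1)
    (hmX : ∀ f : Euc d → ℝ≥0∞, Measurable f → ∫⁻ ω, ∫⁻ x, f x ∂(X ω).1 ∂P = ∫⁻ x, f x ∂mX)
    (hσ : mX ≤ mY + σ) (hσ' : mY ≤ mX + σ) {r δ R : ℝ} (hδ : 0 < δ) (hr : 0 ≤ r)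
    (hR : r + 4 * δ ≤ R)
    (hloc : ∀ S T : Set (Euc d), MeasurableSet S → MeasurableSet T →
      (∀ x ∈ S, ∀ y ∈ T, r < dist x y) →
      IndepFun (fun ω => Config.res S (X ω)) (fun ω => Config.res T (X ω)) P)
    {b : ℝ} (hb0 : 0 ≤ b)
    (hb : ∫⁻ ω, ∫⁻ x, (X ω).1 {y | y ≠ x ∧ dist y x ≤ R} ∂(X ω).1 ∂P +
      ∫⁻ x, mX (Metric.closedBall x R) ∂mY + ∫⁻ x, mY (Metric.closedBall x R) ∂mY +
      σ Set.univ ≤ ENNReal.ofReal b) {A : Set (Config d)} (hA : MeasurableSet A) :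
    P.real (X ⁻¹' A) ≤ P.real (Y ⁻¹' A) + 2 * b := by
  classical
  have hYm := hY.measurable
  have hmY : ∀ f : Euc d → ℝ≥0∞, Measurable f →
      ∫⁻ ω, ∫⁻ x, f x ∂(Y ω).1 ∂P = ∫⁻ x, f x ∂mY := by
    intro f hf
    rw [hY.mecke (g := fun x _ => f x) (hf.comp measurable_fst)]
    simp
  have hmean : ∀ {B : Set (Euc d)}, MeasurableSet B → ∫⁻ ω, (X ω).1 B ∂P = mX B := by
    intro B hB
    have := hmX (B.indicator 1) (measurable_one.indicator hB)
    simpa [lintegral_indicator_one hB] using this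
  -- the cells
  let D : ℕ → Set (Euc d) := fun i => Metric.ball (TopologicalSpace.denseSeq (Euc d) i) δ
  let Q : ℕ → Set (Euc d) := disjointed D
  have hQ : ∀ i, MeasurableSet (Q i) := MeasurableSet.disjointed fun i => measurableSet_ball
  have hQd : Pairwise fun i j => Disjoint (Q i) (Q j) := disjoint_disjointed D
  have hQdist : ∀ i, ∀ x ∈ Q i, ∀ y ∈ Q i, dist x y < 2 * δ := by
    intro i x hx y hy
    have h1 := disjointed_subset D i hx
    have h2 := disjointed_subset D i hy
    have := dist_triangle_right x y (TopologicalSpace.denseSeq (Euc d) i)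
    linarith [Metric.mem_ball.1 h1, Metric.mem_ball.1 h2]
  obtain ⟨n, hn⟩ : ∃ n, K ⊆ ⋃ j ∈ Finset.range n, Q j := by
    have hcov : K ⊆ ⋃ i, D i := fun x _ => by
      obtain ⟨i, hi⟩ := Metric.denseRange_iff.1
        (TopologicalSpace.denseRange_denseSeq (Euc d)) x δ hδ
      exact Set.mem_iUnion.2 ⟨i, Metric.mem_ball.2 hi⟩
    obtain ⟨t, ht⟩ := hK.elim_finite_subcover D (fun i => Metric.isOpen_ball) hcov
    obtain ⟨n, hn⟩ := t.exists_nat_subset_range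
    refine ⟨n, ht.trans fun x hx => ?_⟩
    obtain ⟨i, hi, hxi⟩ := Set.mem_iUnion₂.1 hx
    have h1 : x ∈ ⋃ j ≤ i, Q j := by
      have := partialSups_disjointed D
      have h2 : partialSups Q i = partialSups D i := congrFun (congrArg DFunLike.coe this) i
      rw [partialSups_eq_biSup, partialSups_eq_biSup] at h2
      rw [show (⋃ j ≤ i, Q j) = ⋃ j ≤ i, D j from h2]
      exact Set.mem_iUnion₂.2 ⟨i, le_rfl, hxi⟩
    obtain ⟨j, hj, hxj⟩ := Set.mem_iUnion₂.1 h1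
    have := Finset.mem_range.1 (hn hi)
    exact Set.mem_iUnion₂.2 ⟨j, Finset.mem_range.2 (by omega), hxj⟩
  let U : ℕ → Set (Euc d) := fun i => ⋃ j ∈ Finset.range i, Q j
  have hU : ∀ i, MeasurableSet (U i) := fun i => Finset.measurableSet_biUnion _ fun j _ => hQ j
  -- Off this thickening the distance to every point of the cell exceeds `r`, as `hloc` requires. On
  -- it some point of the cell is nearer than `r + δ`, so all of them are within `r + 3 * δ`, since
  -- two points of a cell have distance less than `2 * δ`.
  let N : ℕ → Set (Euc d) := fun i => Metric.cthickening r (Q i)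
  have hN : ∀ i, MeasurableSet (N i) := fun i => Metric.isClosed_cthickening.measurableSet
  have hUN : ∀ i, MeasurableSet (U i ∩ N i) := fun i => (hU i).inter (hN i)
  have dU : ∀ i, Disjoint (U i) (Q i) := by
    intro i
    simp only [U, Set.disjoint_iUnion_left]
    intro j hj
    exact hQd (Finset.mem_range.1 hj).ne
  have hNdist : ∀ i, ∀ y ∈ N i, ∀ x ∈ Q i, dist y x ≤ R := by
    intro i y hy x hx
    have h1 : Metric.infEDist y (Q i) < ENNReal.ofReal (r + δ) :=
      (Metric.mem_cthickening_iff.1 hy).trans_lt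
        ((ENNReal.ofReal_lt_ofReal_iff (by linarith)).2 (by linarith))
    obtain ⟨q, hq, hyq⟩ := Metric.infEDist_lt_iff.1 h1
    rw [edist_dist, ENNReal.ofReal_lt_ofReal_iff (by linarith)] at hyq
    have := dist_triangle y q x
    linarith [hQdist i q hq x hx]
  -- the error terms
  let e : ℕ → ℝ≥0∞ := fun i =>
    ∫⁻ ω, pairMass (X ω).1 (Q i) ∂P + ∫⁻ ω, pairMass (Y ω).1 (Q i) ∂P + σ (Q i)
  let a : ℕ → ℝ≥0∞ := fun i => ∫⁻ ω, (X ω).1 (U i ∩ N i) * (X ω).1 (Q i) ∂P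
  let a' : ℕ → ℝ≥0∞ := fun i => mX (U i ∩ N i) * mY (Q i)
  -- By the Mecke formula the other points seen from a point of `Y` again form a copy of `Y`, and
  -- deleting one place changes nothing because `mY` is diffuse.
  have hpY : ∀ i, ∫⁻ ω, pairMass (Y ω).1 (Q i) ∂P = mY (Q i) * mY (Q i) := by
    intro i
    have hm : MeasurableSet {p : (Euc d × Config d) × Euc d | p.2 ∈ Q i ∧ p.2 ≠ p.1.1} :=
      (measurable_snd (hQ i)).inter
        (measurableSet_eq_fun measurable_snd (measurable_fst.comp measurable_fst)).compl
    have hg : Measurable (Function.uncurry fun (x : Euc d) (μ : Config d) =>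
        (Q i).indicator (fun x => μ.1 (Q i \ {x})) x) := by
      have h1 := Config.measurable_section (F := fun p : Euc d × Config d => p.2)
        measurable_snd hm
      exact Measurable.indicator (f := fun p : Euc d × Config d => p.2.1 (Q i \ {p.1}))
        (s := {p | p.1 ∈ Q i}) h1 (measurable_fst (hQ i))
    have h2 := hY.mecke hg
    simp_rw [lintegral_indicator (hQ i)] at h2
    have h3 : ∀ x, ∫⁻ ω, (Q i).indicator (fun x => (Config.add (Y ω) (Config.pt x)).1
        (Q i \ {x})) x ∂P = (Q i).indicator (fun _ => mY (Q i)) x := by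
      intro x
      by_cases hx : x ∈ Q i
      · simp only [Set.indicator_of_mem hx]
        have h4 : ∀ ω, (Config.add (Y ω) (Config.pt x)).1 (Q i \ {x}) = (Y ω).1 (Q i \ {x}) :=
          fun ω => by
            rw [Config.add_pt_apply _ _ ((hQ i).diff (measurableSet_singleton x))]
            simp
        simp_rw [h4]
        rw [hY.lintegral_eval ((hQ i).diff (measurableSet_singleton x)),
          measure_sdiff_null (hdiff x)]
      · simp [hx]
    have h5 : ∀ x, ∫⁻ ω, (Q i).indicator (fun y => (Config.add (Y ω) (Config.pt x)).1
        (Q i \ {y})) x ∂P = (Q i).indicator (fun _ => mY (Q i)) x := by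
      intro x
      rw [← h3 x]
      refine lintegral_congr fun ω => ?_
      by_cases hx : x ∈ Q i <;> simp [hx]
    simp_rw [h5] at h2
    rw [lintegral_indicator_const (hQ i)] at h2
    exact h2
  -- A pair consisting of a point of cell `i` and a point of its near past or of the same cell is a
  -- close pair. Each ordered pair is counted at most once, as the cells are disjoint and the past
  -- precedes the cell.
  have hsumX : ∑ i ∈ Finset.range n, (a i + ∫⁻ ω, pairMass (X ω).1 (Q i) ∂P) ≤
      ∫⁻ ω, ∫⁻ x, (X ω).1 {y | y ≠ x ∧ dist y x ≤ R} ∂(X ω).1 ∂P := by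
    have h1 : ∀ i, a i + ∫⁻ ω, pairMass (X ω).1 (Q i) ∂P =
        ∫⁻ ω, ((X ω).1 (U i ∩ N i) * (X ω).1 (Q i) + pairMass (X ω).1 (Q i)) ∂P := fun i =>
      (lintegral_add_right _ (measurable_pairMass hX (hQ i))).symm
    simp_rw [h1]
    rw [← lintegral_finsetSum]
    · refine lintegral_mono fun ω => ?_
      have h2 : ∀ i, (X ω).1 (U i ∩ N i) * (X ω).1 (Q i) + pairMass (X ω).1 (Q i) ≤
          ∫⁻ x in Q i, (X ω).1 {y | y ≠ x ∧ dist y x ≤ R} ∂(X ω).1 := by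
        intro i
        rw [pairMass, ← setLIntegral_const, ← lintegral_add_left measurable_const]
        refine setLIntegral_mono' (hQ i) fun x hx => ?_
        rw [← measure_union]
        · refine measure_mono ?_
          rintro y (hy | hy)
          · refine ⟨fun h => ?_, hNdist i y hy.2 x hx⟩
            exact Set.disjoint_left.1 (dU i) hy.1 (h ▸ hx)
          · exact ⟨hy.2, by linarith [hQdist i y hy.1 x hx]⟩
        · exact (dU i).mono Set.inter_subset_left Set.sdiff_subset
        · exact (hQ i).diff (measurableSet_singleton x)
      refine (Finset.sum_le_sum fun i _ => h2 i).trans ?_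
      rw [← lintegral_biUnion_finset (fun i _ j _ hij => hQd hij) fun i _ => hQ i]
      exact setLIntegral_le_lintegral _ _
    · intro i _
      exact (((Config.measurable_eval (hUN i)).comp hX).mul
        ((Config.measurable_eval (hQ i)).comp hX)).add (measurable_pairMass hX (hQ i))
  have hsumm : ∀ (m : Measure (Euc d)) (S : ℕ → Set (Euc d)),
      (∀ i, ∀ y ∈ S i, ∀ x ∈ Q i, dist y x ≤ R) →
      ∑ i ∈ Finset.range n, m (S i) * mY (Q i) ≤ ∫⁻ x, m (Metric.closedBall x R) ∂mY := by
    intro m S hS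
    have h2 : ∀ i, m (S i) * mY (Q i) ≤ ∫⁻ x in Q i, m (Metric.closedBall x R) ∂mY := by
      intro i
      rw [← setLIntegral_const]
      exact setLIntegral_mono' (hQ i) fun x hx => measure_mono fun y hy => hS i y hy x hx
    refine (Finset.sum_le_sum fun i _ => h2 i).trans ?_
    rw [← lintegral_biUnion_finset (fun i _ j _ hij => hQd hij) fun i _ => hQ i]
    exact setLIntegral_le_lintegral _ _
  have hsumσ : ∑ i ∈ Finset.range n, σ (Q i) ≤ σ Set.univ := by
    rw [← measure_biUnion_finset (fun i _ j _ hij => hQd hij) fun i _ => hQ i]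
    exact measure_mono (Set.subset_univ _)
  have htot : ∑ i ∈ Finset.range n, (a i + a' i + e i) ≤ ENNReal.ofReal b := by
    refine le_trans ?_ hb
    have h1 : ∀ i, a i + a' i + e i = (a i + ∫⁻ ω, pairMass (X ω).1 (Q i) ∂P) +
        mX (U i ∩ N i) * mY (Q i) + mY (Q i) * mY (Q i) + σ (Q i) := by
      intro i
      simp only [e, a', hpY]
      ring
    simp_rw [h1, Finset.sum_add_distrib]
    rw [← Finset.sum_add_distrib]
    gcongr
    · exact hsumm mX _ fun i y hy => hNdist i y hy.2
    · exact hsumm mY _ fun i y hy x hx => by linarith [hQdist i y hy x hx]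
  have hfini : ∀ i ∈ Finset.range n, a i + a' i + e i ≠ ∞ := fun i hi =>
    ((Finset.single_le_sum (f := fun i => a i + a' i + e i) (fun _ _ => zero_le) hi).trans_lt
      (htot.trans_lt ENNReal.ofReal_lt_top)).ne
  have key := comparison_of_cells (P := P) hX hYm n Q N hQ hN hQd
    (hXK.mono fun ω hω => measure_mono_null (Set.compl_subset_compl.2 hn) hω)
    (by
      have h1 : ∫⁻ ω, (Y ω).1 Kᶜ ∂P = 0 := by
        rw [hY.lintegral_eval hK.measurableSet.compl, hYK]
      rw [lintegral_eq_zero_iff (hY.measurable_eval hK.measurableSet.compl)] at h1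
      exact h1.mono fun ω hω => measure_mono_null (Set.compl_subset_compl.2 hn) hω)
    (fun i _ => hloc _ _ ((hU i).diff (hN i)) (hQ i) fun x hx y hy => by
      by_contra! hle
      refine hx.2 (Metric.mem_cthickening_iff.2 ((Metric.infEDist_le_edist_of_mem hy).trans ?_))
      rw [edist_dist]
      exact ENNReal.ofReal_le_ofReal hle)
    (fun i _ => hY.indepFun_res (Finset.measurableSet_biUnion _ fun j _ => hQ j) (hQ i) (by
      simp only [Set.disjoint_iUnion_left]
      intro j hj
      exact hQd (by have := (Finset.mem_Ico.1 hj).1; omega)))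
    (fun i => 2 * (e i).toReal)
    (fun i hi F hF hb h0 => cell_comparison hX hYm hXf hY.ae_finite hXs (hY.ae_simple hdiff)
      hmX hmY hσ hσ' (hQ i)
      (ENNReal.add_ne_top.1 (hfini i (Finset.mem_range.2 hi))).2 le_rfl hF hb h0) hA
  refine key.trans ?_
  gcongr
  have hterm : ∀ i ∈ Finset.range n,
      (2 * P.real {ω | (X ω).1 (U i ∩ N i) ≠ 0 ∧ (X ω).1 (Q i) ≠ 0} +
        2 * (P.real {ω | (X ω).1 (U i ∩ N i) ≠ 0} * P.real {ω | (Y ω).1 (Q i) ≠ 0}) +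
          2 * (e i).toReal) ≤ 2 * (a i + a' i + e i).toReal := by
    intro i hi
    have hf := hfini i hi
    -- Counts and products of counts are at least 1 where they do not vanish, so Markov's inequality
    -- bounds the probabilities by the means.
    have hmarkov : ∀ {Z : Ω → ℝ≥0∞}, Measurable Z → (∀ ω, Z ω ≠ 0 → 1 ≤ Z ω) →
        P {ω | Z ω ≠ 0} ≤ ∫⁻ ω, Z ω ∂P := by
      intro Z hZ h1
      have hset : {ω | Z ω ≠ 0} ⊆ {ω | 1 ≤ Z ω} := fun ω hω => h1 ω hω
      refine (measure_mono hset).trans ?_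
      simpa using meas_ge_le_lintegral_div hZ.aemeasurable one_ne_zero ENNReal.one_ne_top
    have hone : ∀ {μ : Config d} {B : Set (Euc d)}, MeasurableSet B → μ.1 B ≠ 0 → 1 ≤ μ.1 B :=
      fun hB h => Config.one_le_of_pos _ hB (pos_iff_ne_zero.2 h)
    have hmX1 := (Config.measurable_eval (hUN i)).comp hX
    have hmX2 := (Config.measurable_eval (hQ i)).comp hX
    have h1 : P {ω | (X ω).1 (U i ∩ N i) ≠ 0 ∧ (X ω).1 (Q i) ≠ 0} ≤ a i := by
      have := hmarkov (Z := fun ω => (X ω).1 (U i ∩ N i) * (X ω).1 (Q i)) (hmX1.mul hmX2) (by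
        intro ω hω
        obtain ⟨h1, h2⟩ := mul_ne_zero_iff.1 hω
        exact one_le_mul (hone (hUN i) h1) (hone (hQ i) h2))
      simpa only [mul_ne_zero_iff] using this
    have h2 : P {ω | (X ω).1 (U i ∩ N i) ≠ 0} * P {ω | (Y ω).1 (Q i) ≠ 0} ≤ a' i := by
      refine mul_le_mul' ?_ ?_
      · rw [← hmean (hUN i)]
        exact hmarkov hmX1 fun ω h => hone (hUN i) h
      · rw [← hY.lintegral_eval (hQ i)]
        exact hmarkov ((Config.measurable_eval (hQ i)).comp hYm) fun ω h => hone (hQ i) h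
    obtain ⟨hf1, hfe⟩ := ENNReal.add_ne_top.1 hf
    obtain ⟨hfa, hfa'⟩ := ENNReal.add_ne_top.1 hf1
    rw [ENNReal.toReal_add hf1 hfe, ENNReal.toReal_add hfa hfa']
    have h1' := ENNReal.toReal_mono hfa h1
    have h2' := ENNReal.toReal_mono hfa' h2
    rw [ENNReal.toReal_mul] at h2'
    simp only [measureReal_def]
    linarith
  refine (Finset.sum_le_sum hterm).trans ?_
  rw [← Finset.mul_sum, ← ENNReal.toReal_sum hfini]
  gcongr
  exact ENNReal.toReal_le_of_le_ofReal hb0 htot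

end PoissonComparison

/-! ### Balls in the unit cube -/

section Geometry

variable {d : ℕ}

theorem Euc.abs_apply_le_norm (v : Euc d) (i : Fin d) : |v i| ≤ ‖v‖ := by
  simpa using PiLp.norm_apply_le v i

theorem Euc.norm_sq (v : Euc d) : ‖v‖ ^ 2 = ∑ i, v i ^ 2 := by
  rw [EuclideanSpace.norm_sq_eq]
  simp

theorem Euc.inner_eq (v w : Euc d) : inner ℝ v w = ∑ i, v i * w i := by
  rw [PiLp.inner_apply]
  exact Finset.sum_congr rfl fun i _ => by simp [mul_comm]

/-- The volume of the unit ball. -/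
def ballVol (d : ℕ) : ℝ := volume.real (Metric.ball (0 : Euc d) 1)

theorem ballVol_pos (d : ℕ) : 0 < ballVol d :=
  ENNReal.toReal_pos (Metric.measure_ball_pos _ _ one_pos).ne' measure_ball_lt_top.ne

theorem volume_closedBall_eq (x : Euc d) {r : ℝ} (hr : 0 ≤ r) :
    volume (Metric.closedBall x r) = ENNReal.ofReal (ballVol d * r ^ d) := by
  rw [Measure.addHaar_closedBall _ _ hr, finrank_euclideanSpace_fin, ballVol, measureReal_def,
    mul_comm, ENNReal.ofReal_mul ENNReal.toReal_nonneg,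
    ENNReal.ofReal_toReal measure_ball_lt_top.ne]

/-- Lower bound for the share of the cube in small balls centred in the cube. -/
def cubeVol (d : ℕ) : ℝ := ballVol d * (1 / (2 * √d)) ^ d

theorem cubeVol_pos (hd : 2 ≤ d) : 0 < cubeVol d := by
  have := ballVol_pos d
  have : (0 : ℝ) < d := by positivity
  unfold cubeVol
  positivity

/-- The inward direction at a point of the cube. -/
def inward (x : Euc d) (i : Fin d) : ℝ := if x i ≤ 1 / 2 then 1 else -1

theorem inward_sq (x : Euc d) (i : Fin d) : inward x i * inward x i = 1 := by
  unfold inward; split_ifs <;> norm_num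

theorem inward_cases (x : Euc d) (i : Fin d) :
    (inward x i = 1 ∧ x i ≤ 1 / 2) ∨ (inward x i = -1 ∧ 1 / 2 < x i) := by
  unfold inward
  split_ifs with h
  · exact Or.inl ⟨rfl, h⟩
  · exact Or.inr ⟨rfl, not_le.1 h⟩

/-- Shift `z` inward by `e = t / (2 √d)` in every coordinate. The ball of radius `e` there stays in
the cube, and its points differ from `z` by at most `2 * e` per coordinate, hence by at most `t` in
norm. -/
theorem volume_cube_inter_closedBall (hd : 2 ≤ d) {z : Euc d} (hz : z ∈ unitCube d) {t : ℝ}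
    (h0 : 0 ≤ t) (ht : t ≤ 1 / 2) :
    ENNReal.ofReal (cubeVol d * t ^ d) ≤ volume (Metric.closedBall z t ∩ unitCube d) := by
  have hd0 : (1 : ℝ) ≤ d := by exact_mod_cast (by omega : 1 ≤ d)
  have hsq : 1 ≤ √(d : ℝ) := Real.one_le_sqrt.2 hd0
  set e : ℝ := t / (2 * √d) with he
  have he0 : 0 ≤ e := by positivity
  have h2e : 2 * e * √d = t := by rw [he]; field_simp
  have he4 : 2 * e ≤ 1 / 2 := by nlinarith
  let z' : Euc d := WithLp.toLp 2 fun i => z i + inward z i * e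
  have hsub : Metric.closedBall z' e ⊆ Metric.closedBall z t ∩ unitCube d := by
    intro p hp
    rw [Metric.mem_closedBall, dist_eq_norm] at hp
    have hi : ∀ i, |p i - (z i + inward z i * e)| ≤ e := fun i =>
      (Euc.abs_apply_le_norm (p - z') i).trans hp
    refine ⟨?_, fun i => ?_⟩
    · rw [Metric.mem_closedBall, dist_eq_norm]
      have h1 : ‖p - z‖ ^ 2 ≤ t ^ 2 := by
        rw [Euc.norm_sq]
        calc ∑ i, (p - z) i ^ 2 ≤ ∑ _i : Fin d, (2 * e) ^ 2 := by
              refine Finset.sum_le_sum fun i _ => ?_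
              have h1 := abs_le.1 (hi i)
              have h2 : (p - z) i = p i - z i := rfl
              rw [h2, sq_le_sq, abs_of_nonneg (by linarith : 0 ≤ 2 * e), abs_le]
              rcases inward_cases z i with ⟨h, -⟩ | ⟨h, -⟩ <;> rw [h] at h1 <;>
                constructor <;> linarith
          _ = t ^ 2 := by
              rw [Finset.sum_const, Finset.card_univ, Fintype.card_fin, nsmul_eq_mul, ← h2e,
                mul_pow _ (√(d : ℝ)), Real.sq_sqrt (by linarith)]
              ring
      exact (sq_le_sq₀ (norm_nonneg _) h0).1 h1
    · have h1 := abs_le.1 (hi i)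
      have h2 := hz i
      rw [Set.mem_Icc] at h2 ⊢
      rcases inward_cases z i with ⟨h, h'⟩ | ⟨h, h'⟩ <;> rw [h] at h1 <;>
        constructor <;> linarith
  refine le_trans (le_of_eq ?_) (measure_mono hsub)
  rw [volume_closedBall_eq _ he0, cubeVol, he, mul_assoc, ← mul_pow]
  congr 3
  ring

/-- Moving inward from a point of the cube does not leave the cube. -/
theorem add_smul_mem_unitCube {x p w : Euc d} (hp : p ∈ unitCube d) (hpx : dist p x ≤ 1 / 4)
    (hw : ‖w‖ = 1) (hwx : ∀ i, 0 ≤ inward x i * w i) {t : ℝ} (h0 : 0 ≤ t) (ht : t ≤ 1 / 4) :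
    p + t • w ∈ unitCube d := by
  intro i
  have h1 := hp i
  have h2 : |p i - x i| ≤ 1 / 4 := (Euc.abs_apply_le_norm (p - x) i).trans
    (by rwa [← dist_eq_norm])
  have h3 : |w i| ≤ 1 := hw ▸ Euc.abs_apply_le_norm w i
  have h4 : (p + t • w) i = p i + t * w i := rfl
  rw [h4]
  have h2 := abs_le.1 h2
  have h3 := abs_le.1 h3
  have h5 := hwx i
  rw [Set.mem_Icc] at h1 ⊢
  rcases inward_cases x i with ⟨h, h'⟩ | ⟨h, h'⟩
  · rw [h] at h5
    constructor <;> nlinarith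
  · rw [h] at h5
    constructor <;> nlinarith

theorem closedBall_subset_diff {x y z : Euc d} {rx ry e : ℝ} (h1 : dist z x + e ≤ rx)
    (h2 : ry + e < dist z y) :
    Metric.closedBall z e ⊆ Metric.closedBall x rx \ Metric.closedBall y ry := by
  intro p hp
  rw [Metric.mem_closedBall] at hp
  refine ⟨?_, fun h => ?_⟩
  · rw [Metric.mem_closedBall]
    linarith [dist_triangle p z x]
  · rw [Metric.mem_closedBall] at h
    linarith [dist_triangle z p y, dist_comm z p]

theorem dist_add_smul_sq (x y w : Euc d) (hw : ‖w‖ = 1) (t : ℝ) :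
    dist (x + t • w) y ^ 2 = dist x y ^ 2 + 2 * t * inner ℝ (x - y) w + t ^ 2 := by
  rw [dist_eq_norm, dist_eq_norm, show x + t • w - y = (x - y) + t • w by abel,
    norm_add_sq_real, inner_smul_right, norm_smul, hw, mul_one, Real.norm_eq_abs, sq_abs]
  ring

theorem dist_add_smul_self (x w : Euc d) (hw : ‖w‖ = 1) {t : ℝ} (ht : 0 ≤ t) :
    dist (x + t • w) x = t := by
  rw [dist_eq_norm, add_sub_cancel_left, norm_smul, hw, mul_one, Real.norm_of_nonneg ht]

/-- The small ball is placed near the rim of one ball in an inward direction, so that it is centred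
in the cube. Split `x - y = vp - vm`, where `vp` and `vm` both point inward and are orthogonal, so
that their squared norms add up to `u ^ 2`. If `vp` is not small, one moves from `x` along it, away
from `y`. Otherwise `vm` carries nearly all of the length; if `rx` is not much larger than `ry`, one
moves from `y` along `vm`, away from `x`. If `rx` is much larger, the first ball sticks out in every
inward direction that does not point too directly at `y`. -/
theorem exists_closedBall_subset_crescent_of_le (hd : 2 ≤ d) {x y : Euc d} (hx : x ∈ unitCube d)
    (hy : y ∈ unitCube d) {rx ry m : ℝ} (hrx : rx ≤ 1 / 4)
    (hu : dist x y ≤ 1 / 4) (hm : 0 < m) (hmu : m ≤ dist x y) (hmx : m ≤ rx) (hmy : m ≤ ry)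
    (hle : ry ≤ rx) :
    ∃ z ∈ unitCube d,
      Metric.closedBall z (m / 32) ⊆ Metric.closedBall x rx \ Metric.closedBall y ry ∨
      Metric.closedBall z (m / 32) ⊆ Metric.closedBall y ry \ Metric.closedBall x rx := by
  set u := dist x y with hudef
  have hu0 : 0 < u := hm.trans_le hmu
  let v : Euc d := x - y
  have hv : ‖v‖ = u := (dist_eq_norm x y).symm
  let vp : Euc d := WithLp.toLp 2 fun i => if 0 ≤ inward x i * v i then v i else 0
  let vm : Euc d := WithLp.toLp 2 fun i => if 0 ≤ inward x i * v i then 0 else -v i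
  have hvp : ∀ i, vp i = if 0 ≤ inward x i * v i then v i else 0 := fun i => rfl
  have hvm : ∀ i, vm i = if 0 ≤ inward x i * v i then 0 else -v i := fun i => rfl
  have hvpx : ∀ i, 0 ≤ inward x i * vp i := fun i => by
    rw [hvp]; split_ifs with h
    exacts [h, by simp]
  have hvmx : ∀ i, 0 ≤ inward x i * vm i := fun i => by
    rw [hvm]; split_ifs with h
    exacts [by simp, by linarith [not_le.1 h]]
  have hinp : inner ℝ v vp = ‖vp‖ ^ 2 := by
    rw [Euc.inner_eq, Euc.norm_sq]
    refine Finset.sum_congr rfl fun i _ => ?_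
    rw [hvp]; split_ifs <;> ring
  have hinm : inner ℝ v vm = -‖vm‖ ^ 2 := by
    rw [Euc.inner_eq, Euc.norm_sq, ← Finset.sum_neg_distrib]
    refine Finset.sum_congr rfl fun i _ => ?_
    rw [hvm]; split_ifs <;> ring
  have hpyth : ‖vp‖ ^ 2 + ‖vm‖ ^ 2 = u ^ 2 := by
    rw [← hv, Euc.norm_sq, Euc.norm_sq, Euc.norm_sq, ← Finset.sum_add_distrib]
    refine Finset.sum_congr rfl fun i _ => ?_
    rw [hvp, hvm]; split_ifs <;> ring
  have hunit : ∀ {w : Euc d}, 0 < ‖w‖ → ‖(‖w‖⁻¹ • w : Euc d)‖ = 1 := fun {w} hw => by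
    rw [norm_smul, norm_inv, norm_norm, inv_mul_cancel₀ hw.ne']
  have hdir : ∀ {w : Euc d}, (∀ i, 0 ≤ inward x i * w i) →
      ∀ i, 0 ≤ inward x i * (‖w‖⁻¹ • w : Euc d) i := fun {w} h i => by
    have : (‖w‖⁻¹ • w : Euc d) i = ‖w‖⁻¹ * w i := rfl
    rw [this, mul_left_comm]
    exact mul_nonneg (inv_nonneg.2 (norm_nonneg _)) (h i)
  have hyx : dist y x ≤ 1 / 4 := by rwa [dist_comm]
  have hxx : dist x x ≤ 1 / 4 := by simp
  by_cases c1 : u / 10 ≤ ‖vp‖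
  · have hpos : 0 < ‖vp‖ := by linarith
    let w : Euc d := ‖vp‖⁻¹ • vp
    have hw : ‖w‖ = 1 := hunit hpos
    have hvw : inner ℝ v w = ‖vp‖ := by
      rw [inner_smul_right, hinp]; field_simp
    have ht : 0 ≤ rx - m / 32 := by linarith
    refine ⟨x + (rx - m / 32) • w,
      add_smul_mem_unitCube hx hxx hw (hdir hvpx) ht (by linarith), Or.inl ?_⟩
    refine closedBall_subset_diff ?_ ?_
    · rw [dist_add_smul_self _ _ hw ht]; linarith
    · refine lt_of_pow_lt_pow_left₀ 2 dist_nonneg ?_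
      rw [dist_add_smul_sq _ _ _ hw, show inner ℝ (x - y) w = ‖vp‖ from hvw, ← hudef]
      have h1 : (ry + m / 32) ^ 2 ≤ (rx - m / 32 + m / 16) ^ 2 := by
        apply pow_le_pow_left₀ <;> linarith
      nlinarith [mul_le_mul_of_nonneg_left c1 ht, mul_le_mul_of_nonneg_left hmu ht]
  · rw [not_le] at c1
    -- The threshold leaves room for the loss `m / 16 ≤ u / 16` caused by the small ball on either
    -- side: `4 / 5 + 1 / 16 < 9 / 10` here and `4 / 5 - 1 / 16 > 73 / 100` in the other case.
    by_cases c2 : rx ≤ ry + 4 / 5 * u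
    · have hvm9 : 9 / 10 * u ≤ ‖vm‖ := by
        refine le_of_sq_le_sq ?_ (norm_nonneg _)
        nlinarith [norm_nonneg vp]
      have hpos : 0 < ‖vm‖ := by linarith
      let w : Euc d := ‖vm‖⁻¹ • vm
      have hw : ‖w‖ = 1 := hunit hpos
      have hvw : inner ℝ v w = -‖vm‖ := by
        rw [inner_smul_right, hinm]; field_simp
      have hvw' : inner ℝ (y - x) w = ‖vm‖ := by
        rw [← neg_sub, inner_neg_left, show inner ℝ (x - y) w = -‖vm‖ from hvw, neg_neg]
      have ht : 0 ≤ ry - m / 32 := by linarith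
      refine ⟨y + (ry - m / 32) • w,
        add_smul_mem_unitCube hy hyx hw (hdir hvmx) ht (by linarith), Or.inr ?_⟩
      refine closedBall_subset_diff ?_ ?_
      · rw [dist_add_smul_self _ _ hw ht]; linarith
      · refine lt_of_pow_lt_pow_left₀ 2 dist_nonneg ?_
        rw [dist_add_smul_sq _ _ _ hw, hvw', dist_comm, ← hudef]
        have h1 : (rx + m / 32) ^ 2 ≤ (ry - m / 32 + 9 / 10 * u) ^ 2 := by
          apply pow_le_pow_left₀ <;> linarith
        nlinarith [mul_le_mul_of_nonneg_left hvm9 ht]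
    · rw [not_le] at c2
      -- This is where `d ≥ 2` enters: of two coordinates one carries at most half of the squared
      -- length. The inward axis direction there has inner product at least `-u / √2 > -(71 / 100) *
      -- u` with `v`.
      obtain ⟨i, hi⟩ : ∃ i, v i ^ 2 ≤ u ^ 2 / 2 := by
        let i0 : Fin d := ⟨0, by omega⟩
        let i1 : Fin d := ⟨1, by omega⟩
        have hne : i0 ≠ i1 := by simp [i0, i1]
        have h2 : v i0 ^ 2 + v i1 ^ 2 ≤ u ^ 2 := by
          rw [← hv, Euc.norm_sq, ← Finset.sum_pair (f := fun i => v i ^ 2) hne]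
          exact Finset.sum_le_sum_of_subset_of_nonneg (Finset.subset_univ _)
            fun _ _ _ => sq_nonneg _
        by_cases h : v i0 ^ 2 ≤ u ^ 2 / 2
        · exact ⟨i0, h⟩
        · exact ⟨i1, by linarith⟩
      let w : Euc d := EuclideanSpace.single i (inward x i)
      have hw : ‖w‖ = 1 := by
        rw [PiLp.norm_single]
        rcases inward_cases x i with ⟨h, -⟩ | ⟨h, -⟩ <;> simp [h]
      have hwx : ∀ j, 0 ≤ inward x j * w j := by
        intro j
        by_cases hj : j = i
        · subst hj; simp [w, inward_sq]
        · simp [w, hj]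
      have hvw : inner ℝ v w = inward x i * v i := by
        simp [w, EuclideanSpace.inner_single_right]
      have hvw' : -(71 / 100) * u ≤ inward x i * v i := by
        have : (inward x i * v i) ^ 2 ≤ (71 / 100 * u) ^ 2 := by
          rw [mul_pow, sq, inward_sq]
          nlinarith
        have := abs_le.1 (abs_le_of_sq_le_sq this (by positivity))
        linarith
      have ht : 0 ≤ rx - m / 32 := by linarith
      refine ⟨x + (rx - m / 32) • w,
        add_smul_mem_unitCube hx hxx hw hwx ht (by linarith), Or.inl ?_⟩
      refine closedBall_subset_diff ?_ ?_
      · rw [dist_add_smul_self _ _ hw ht]; linarith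
      · refine lt_of_pow_lt_pow_left₀ 2 dist_nonneg ?_
        rw [dist_add_smul_sq _ _ _ hw, show inner ℝ (x - y) w = inward x i * v i from hvw, ← hudef]
        have h1 : (ry + m / 32) ^ 2 ≤ (rx - m / 32 - 73 / 100 * u) ^ 2 := by
          apply pow_le_pow_left₀ <;> linarith
        nlinarith [mul_le_mul_of_nonneg_left hvw' ht, mul_nonneg ht hu0.le]

/-- For two balls centred at different points of the cube, one of the two crescents contains a
ball, centred in the cube, of comparable size. -/
theorem exists_closedBall_subset_crescent (hd : 2 ≤ d) {x y : Euc d} (hx : x ∈ unitCube d)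
    (hy : y ∈ unitCube d) {rx ry m : ℝ} (hrx : rx ≤ 1 / 4) (hry : ry ≤ 1 / 4)
    (hu : dist x y ≤ 1 / 4) (hm : 0 < m) (hmu : m ≤ dist x y) (hmx : m ≤ rx) (hmy : m ≤ ry) :
    ∃ z ∈ unitCube d,
      Metric.closedBall z (m / 32) ⊆ Metric.closedBall x rx \ Metric.closedBall y ry ∨
      Metric.closedBall z (m / 32) ⊆ Metric.closedBall y ry \ Metric.closedBall x rx := by
  rcases le_total ry rx with h | h
  · exact exists_closedBall_subset_crescent_of_le hd hx hy hrx hu hm hmu hmx hmy h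
  · obtain ⟨z, hz, h'⟩ := exists_closedBall_subset_crescent_of_le hd hy hx hry (by rwa [dist_comm])
      hm (by rwa [dist_comm]) hmy hmx h
    exact ⟨z, hz, h'.symm⟩

end Geometry

/-! ### Lower tails of the Poisson distribution -/

/-- The probability that a Poisson variable with mean `t` is smaller than `n`. -/
def poissonTail (n : ℕ) (t : ℝ) : ℝ := Real.exp (-t) * ∑ j ∈ Finset.range n, t ^ j / j !

theorem poissonTail_nonneg (n : ℕ) {t : ℝ} (ht : 0 ≤ t) : 0 ≤ poissonTail n t := by
  unfold poissonTail
  positivity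

/-- A constant for the quadratic decay of the lower Poisson tails. -/
def tailConst (n : ℕ) : ℝ := ∑ j ∈ Finset.range n, ((j + 1 : ℝ) * (j + 2))

theorem tailConst_nonneg (n : ℕ) : 0 ≤ tailConst n := by
  unfold tailConst
  positivity

theorem tailConst_succ_pos (n : ℕ) : 0 < tailConst (n + 1) := by
  unfold tailConst
  exact Finset.sum_pos (fun _ _ => by positivity) (by simp)

/-- Termwise, `t ^ (j + 2) / (j + 2)!` is at most `exp t`. The second power suffices: for content of
order dist^d it gives the integrable decay dist^(-2d), and it beats a neighbourhood of content of
order `t`. -/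
theorem poissonTail_le_div_sq (n : ℕ) {t : ℝ} (ht : 0 < t) :
    poissonTail n t ≤ tailConst n / t ^ 2 := by
  rw [le_div_iff₀ (by positivity), poissonTail, tailConst, Finset.mul_sum, Finset.sum_mul]
  refine Finset.sum_le_sum fun j _ => ?_
  have h1 := Real.pow_div_factorial_le_exp (x := t) ht.le (j + 2)
  have h2 : (((j + 2) ! : ℕ) : ℝ) = (j + 2) * (j + 1) * j ! := by
    rw [Nat.factorial_succ, Nat.factorial_succ]
    push_cast
    ring
  have h3 : (0 : ℝ) < j ! := by positivity
  rw [h2, div_le_iff₀ (by positivity)] at h1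
  have h4 : Real.exp (-t) * Real.exp t = 1 := by rw [← Real.exp_add]; simp
  calc Real.exp (-t) * (t ^ j / j !) * t ^ 2 = Real.exp (-t) * t ^ (j + 2) / j ! := by ring
    _ ≤ Real.exp (-t) * (Real.exp t * ((j + 2) * (j + 1) * j !)) / j ! := by gcongr
    _ = (Real.exp (-t) * Real.exp t) * ((j + 1) * (j + 2)) := by field_simp
    _ = (j + 1) * (j + 2) := by rw [h4, one_mul]

theorem poissonTail_le_one (n : ℕ) {t : ℝ} (ht : 0 ≤ t) : poissonTail n t ≤ 1 := by
  have h1 : ∑ j ∈ Finset.range n, t ^ j / j ! ≤ Real.exp t := Real.sum_le_exp_of_nonneg ht n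
  calc poissonTail n t ≤ Real.exp (-t) * Real.exp t := by
        unfold poissonTail
        gcongr
    _ = 1 := by rw [← Real.exp_add]; simp

/-- The gain when one of the allowed places in a ball is already taken: each term equals the next
one times `(j + 1) / t`. -/
theorem poissonTail_le_succ (k : ℕ) {t : ℝ} (ht : 0 < t) :
    poissonTail k t ≤ k / t * poissonTail (k + 1) t := by
  unfold poissonTail
  rw [mul_left_comm]
  gcongr
  rw [Finset.sum_range_succ', mul_add, Finset.mul_sum]
  have h1 : ∀ j ∈ Finset.range k, t ^ j / j ! ≤ k / t * (t ^ (j + 1) / (j + 1)!) := by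
    intro j hj
    rw [Nat.factorial_succ]
    push_cast
    have hjk : ((j : ℝ) + 1) ≤ k := by exact_mod_cast Finset.mem_range.1 hj
    have h3 : (0 : ℝ) < j ! := by positivity
    calc t ^ j / j ! = (j + 1 : ℝ) / t * (t ^ (j + 1) / ((j + 1) * j !)) := by
          field_simp
          ring
      _ ≤ _ := by gcongr
  refine (Finset.sum_le_sum h1).trans ?_
  have : (0 : ℝ) ≤ k / t * (t ^ 0 / 0 !) := by positivity
  linarith

theorem IsPoissonProcess.measure_lt {d : ℕ} {Ω : Type*} [MeasurableSpace Ω] {P : Measure Ω}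
    {η : Ω → Config d} {Λ : Measure (Euc d)} [IsFiniteMeasure Λ] (h : IsPoissonProcess P η Λ)
    {B : Set (Euc d)} (hB : MeasurableSet B) (n : ℕ) :
    P {ω | (η ω).1 B < n} = ENNReal.ofReal (poissonTail n (Λ.real B)) := by
  have h1 : {ω | (η ω).1 B < n} = ⋃ j ∈ Finset.range n, {ω | (η ω).1 B = (j : ℕ)} := by
    ext ω
    simp only [Set.mem_ofPred_eq, Set.mem_iUnion, Finset.mem_range, exists_prop]
    constructor
    · intro hω
      obtain ⟨j, hj⟩ := (η ω).exists_nat hB (hω.trans (ENNReal.natCast_lt_top n)).ne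
      exact ⟨j, by rw [hj] at hω; exact_mod_cast hω, hj⟩
    · rintro ⟨j, hj, hω⟩
      rw [hω]
      exact_mod_cast hj
  rw [h1, measure_biUnion_finset]
  · rw [poissonTail, Finset.mul_sum, ENNReal.ofReal_sum_of_nonneg fun j _ => by positivity]
    refine Finset.sum_congr rfl fun j _ => ?_
    rw [h.law_of_finite B hB (measure_ne_top _ _), poissonMeasure_singleton]
    congr 1
    rw [ENNReal.coe_toNNReal_eq_toReal, mul_div_assoc]
    rfl
  · intro i _ j _ hij
    refine Set.disjoint_left.2 fun ω (h1 : _ = _) (h2 : _ = _) => hij ?_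
    exact_mod_cast h1.symm.trans h2
  · exact fun j _ => h.measurable_eval hB (measurableSet_singleton _)

/-! ### Measures comparable to Lebesgue measure on the cube -/

section CubeDensity

variable {d : ℕ} {Λ : Measure (Euc d)} {L q : ℝ}

/-- The measure `Λ` is concentrated on the unit cube, with density between `L` and `q * L`. -/
structure IsCubeDensity (Λ : Measure (Euc d)) (L q : ℝ) : Prop where
  pos : 0 < L
  one_le : 1 ≤ q
  lower : ∀ B, MeasurableSet B → ENNReal.ofReal L * volume (B ∩ unitCube d) ≤ Λ B
  upper : ∀ B, MeasurableSet B → Λ B ≤ ENNReal.ofReal (q * L) * volume (B ∩ unitCube d)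

theorem isCompact_unitCube (d : ℕ) : IsCompact (unitCube d) := by
  have hcl : IsClosed (unitCube d) := by
    have : unitCube d = ⋂ i, (fun x : Euc d => x i) ⁻¹' Set.Icc (0 : ℝ) 1 := by
      ext x; simp [unitCube]
    rw [this]
    exact isClosed_iInter fun i => isClosed_Icc.preimage (by fun_prop)
  refine Metric.isCompact_of_isClosed_isBounded hcl ?_
  refine (Metric.isBounded_closedBall (x := (0 : Euc d)) (r := d)).subset fun x hx => ?_
  rw [mem_closedBall_zero_iff]
  refine le_of_sq_le_sq ?_ (by positivity)
  rw [Euc.norm_sq]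
  calc ∑ i, x i ^ 2 ≤ ∑ _i : Fin d, (1 : ℝ) := by
        refine Finset.sum_le_sum fun i _ => ?_
        have := hx i
        exact pow_le_one₀ this.1 this.2
    _ = d := by simp
    _ ≤ (d : ℝ) ^ 2 := by exact_mod_cast Nat.le_self_pow two_ne_zero d

theorem IsCubeDensity.isFiniteMeasure (h : IsCubeDensity Λ L q) : IsFiniteMeasure Λ :=
  ⟨(h.upper _ MeasurableSet.univ).trans_lt (ENNReal.mul_lt_top ENNReal.ofReal_lt_top
    ((measure_mono Set.inter_subset_right).trans_lt (isCompact_unitCube d).measure_lt_top))⟩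

theorem IsCubeDensity.le_smul (h : IsCubeDensity Λ L q) :
    Λ ≤ ENNReal.ofReal (q * L) • volume := by
  refine Measure.le_iff.2 fun B hB => (h.upper B hB).trans ?_
  rw [Measure.smul_apply, smul_eq_mul]
  gcongr
  exact Set.inter_subset_left

theorem IsCubeDensity.null (h : IsCubeDensity Λ L q) {B : Set (Euc d)} (hB : volume B = 0) :
    Λ B = 0 := by
  have := h.le_smul B
  simpa [hB] using this

theorem IsCubeDensity.compl_cube (h : IsCubeDensity Λ L q) : Λ (unitCube d)ᶜ = 0 := by
  have := h.upper _ (measurableSet_unitCube d).compl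
  simpa using this

theorem IsCubeDensity.singleton (h : IsCubeDensity Λ L q) (hd : 2 ≤ d) (x : Euc d) :
    Λ {x} = 0 := by
  have : Nonempty (Fin d) := ⟨⟨0, by omega⟩⟩
  exact h.null (measure_singleton x)

theorem IsCubeDensity.le_closedBall (h : IsCubeDensity Λ L q) (hd : 2 ≤ d) {z : Euc d}
    (hz : z ∈ unitCube d) {t : ℝ} (h0 : 0 ≤ t) (ht : t ≤ 1 / 2) :
    ENNReal.ofReal (L * (cubeVol d * t ^ d)) ≤ Λ (Metric.closedBall z t) := by
  rw [ENNReal.ofReal_mul h.pos.le]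
  refine le_trans ?_ (h.lower _ measurableSet_closedBall)
  gcongr
  exact volume_cube_inter_closedBall hd hz h0 ht

theorem IsCubeDensity.closedBall_le (h : IsCubeDensity Λ L q) (z : Euc d) {t : ℝ} (h0 : 0 ≤ t) :
    Λ (Metric.closedBall z t) ≤ ENNReal.ofReal (q * L * (ballVol d * t ^ d)) := by
  have := h.le_smul (Metric.closedBall z t)
  rw [Measure.smul_apply, smul_eq_mul, volume_closedBall_eq z h0, ← ENNReal.ofReal_mul
    (mul_nonneg (zero_le_one.trans h.one_le) h.pos.le)] at this
  exact this

/-! ### The radius at which a given content is reached -/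

/-- The level radius as a real number. -/
def radius (Λ : Measure (Euc d)) (a : ℝ) (x : Euc d) : ℝ := (levelRadius Λ a x).toReal

theorem radius_nonneg (Λ : Measure (Euc d)) (a : ℝ) (x : Euc d) : 0 ≤ radius Λ a x :=
  ENNReal.toReal_nonneg

theorem levelRadius_le {Λ : Measure (Euc d)} {a : ℝ} {x : Euc d} {r : ℝ} (hr : 0 < r)
    (h : ENNReal.ofReal a ≤ Λ (Metric.closedBall x r)) :
    levelRadius Λ a x ≤ ENNReal.ofReal r :=
  iInf₂_le r ⟨hr, h⟩

theorem le_closedBall_of_levelRadius_lt {Λ : Measure (Euc d)} {a : ℝ} {x : Euc d} {r : ℝ}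
    (h : levelRadius Λ a x < ENNReal.ofReal r) :
    ENNReal.ofReal a ≤ Λ (Metric.closedBall x r) := by
  simp only [levelRadius, iInf_lt_iff] at h
  obtain ⟨r', ⟨_, h1⟩, h2⟩ := h
  refine h1.trans (measure_mono (Metric.closedBall_subset_closedBall ?_))
  exact (ENNReal.ofReal_lt_ofReal_iff'.1 h2).1.le

theorem levelRadius_ne_top {Λ : Measure (Euc d)} {a : ℝ} (ha : ENNReal.ofReal a < Λ Set.univ)
    (x : Euc d) : levelRadius Λ a x ≠ ∞ := by
  have hlim : Tendsto (fun n : ℕ => Λ (Metric.closedBall x n)) atTop (𝓝 (Λ Set.univ)) := by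
    rw [← Metric.iUnion_closedBall_nat x]
    refine tendsto_measure_iUnion_atTop fun m n hmn => ?_
    exact Metric.closedBall_subset_closedBall (by exact_mod_cast hmn)
  obtain ⟨n, hn, hn0⟩ := ((hlim.eventually_const_lt ha).and (eventually_gt_atTop 0)).exists
  exact ((levelRadius_le (by exact_mod_cast hn0) hn.le).trans_lt ENNReal.ofReal_lt_top).ne

theorem ofReal_radius {Λ : Measure (Euc d)} {a : ℝ} (ha : ENNReal.ofReal a < Λ Set.univ)
    (x : Euc d) : ENNReal.ofReal (radius Λ a x) = levelRadius Λ a x :=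
  ENNReal.ofReal_toReal (levelRadius_ne_top ha x)

theorem radius_le {Λ : Measure (Euc d)} {a : ℝ} {x : Euc d} {r : ℝ} (hr : 0 < r)
    (h : ENNReal.ofReal a ≤ Λ (Metric.closedBall x r)) : radius Λ a x ≤ r :=
  ENNReal.toReal_le_of_le_ofReal hr.le (levelRadius_le hr h)

/-- The infimum is attained because the content of closed balls is right continuous in the radius.
-/
theorem le_closedBall_radius {Λ : Measure (Euc d)} [IsFiniteMeasure Λ] {a : ℝ}
    (ha : ENNReal.ofReal a < Λ Set.univ) (x : Euc d) :
    ENNReal.ofReal a ≤ Λ (Metric.closedBall x (radius Λ a x)) := by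
  refine ge_of_tendsto' (tendsto_measure_closedBall Λ x _ (measure_ne_top _ _)) fun n => ?_
  refine le_closedBall_of_levelRadius_lt ?_
  have hpos : (0 : ℝ) < 1 / ((n : ℝ) + 1) := Nat.one_div_pos_of_nat
  rw [← ofReal_radius ha, ENNReal.ofReal_lt_ofReal_iff (by linarith [radius_nonneg Λ a x])]
  linarith

theorem IsCubeDensity.radius_pos (h : IsCubeDensity Λ L q) (hd : 2 ≤ d) {a : ℝ} (ha0 : 0 < a)
    (ha : ENNReal.ofReal a < Λ Set.univ) (x : Euc d) : 0 < radius Λ a x := by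
  have := h.isFiniteMeasure
  refine lt_of_le_of_ne (radius_nonneg _ _ _) fun h0 => ?_
  have h1 := le_closedBall_radius ha x
  rw [← h0, Metric.closedBall_zero, h.singleton hd] at h1
  simp only [nonpos_iff_eq_zero, ENNReal.ofReal_eq_zero] at h1
  linarith

/-- The ball whose radius is the level radius has exactly the prescribed content. -/
theorem IsCubeDensity.closedBall_radius (h : IsCubeDensity Λ L q) (hd : 2 ≤ d) {a : ℝ}
    (ha : ENNReal.ofReal a < Λ Set.univ) (x : Euc d) :
    Λ (Metric.closedBall x (radius Λ a x)) = ENNReal.ofReal a := by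
  have := h.isFiniteMeasure
  refine le_antisymm ?_ (le_closedBall_radius ha x)
  set ρ := radius Λ a x with hρ
  have : Nontrivial (Euc d) := by
    have : Nonempty (Fin d) := ⟨⟨0, by omega⟩⟩
    infer_instance
  -- Smaller radii miss the level; since the sphere is null, the content does not jump at `ρ` and
  -- cannot overshoot it.
  have hs : Λ (Metric.sphere x ρ) = 0 := h.null (Measure.addHaar_sphere _ _ _)
  have hb : Metric.ball x ρ = ⋃ n : ℕ, Metric.closedBall x (ρ - 1 / ((n : ℝ) + 1)) := by
    ext y
    simp only [Metric.mem_ball, Set.mem_iUnion, Metric.mem_closedBall]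
    refine ⟨fun hy => ?_, fun ⟨n, hn⟩ => ?_⟩
    · obtain ⟨n, hn⟩ := exists_nat_one_div_lt (sub_pos.2 hy)
      exact ⟨n, by linarith⟩
    · have hpos : (0 : ℝ) < 1 / ((n : ℝ) + 1) := Nat.one_div_pos_of_nat
      linarith
  have hlim : Tendsto (fun n : ℕ => Λ (Metric.closedBall x (ρ - 1 / ((n : ℝ) + 1)))) atTop
      (𝓝 (Λ (Metric.ball x ρ))) := by
    rw [hb]
    refine tendsto_measure_iUnion_atTop fun m n hmn => ?_
    refine Metric.closedBall_subset_closedBall ?_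
    gcongr
  rw [← Metric.ball_union_sphere]
  refine (measure_union_le _ _).trans ?_
  rw [hs, add_zero]
  refine le_of_tendsto' hlim fun n => ?_
  have hpos : (0 : ℝ) < 1 / ((n : ℝ) + 1) := Nat.one_div_pos_of_nat
  rcases le_or_gt (ρ - 1 / ((n : ℝ) + 1)) 0 with hle | hgt
  · have : Λ (Metric.closedBall x (ρ - 1 / ((n : ℝ) + 1))) ≤ Λ {x} := by
      rw [← Metric.closedBall_zero]
      exact measure_mono (Metric.closedBall_subset_closedBall hle)
    rw [h.singleton hd] at this
    exact this.trans zero_le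
  · by_contra! hcon
    have := radius_le hgt hcon.le
    linarith

/-- The level ball of `y` is contained in the ball about `x` with radius enlarged by the distance.
Measurability of the thinning rests on this continuity. -/
theorem lipschitzWith_radius {Λ : Measure (Euc d)} [IsFiniteMeasure Λ] {a : ℝ}
    (ha : ENNReal.ofReal a < Λ Set.univ) : LipschitzWith 1 (radius Λ a) := by
  refine LipschitzWith.of_le_add fun x y => ?_
  refine le_of_forall_pos_le_add fun ε hε => ?_
  refine radius_le (by linarith [radius_nonneg Λ a y, dist_nonneg (x := x) (y := y)])
    ((le_closedBall_radius ha y).trans (measure_mono ?_))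
  refine Metric.closedBall_subset_closedBall' ?_
  rw [dist_comm y x]
  linarith

theorem measurable_radius {Λ : Measure (Euc d)} [IsFiniteMeasure Λ] {a : ℝ}
    (ha : ENNReal.ofReal a < Λ Set.univ) : Measurable (radius Λ a) :=
  (lipschitzWith_radius ha).continuous.measurable

theorem IsCubeDensity.radius_le_of_cube (h : IsCubeDensity Λ L q) (hd : 2 ≤ d) {a ρ : ℝ}
    (hρ0 : 0 < ρ) (hρ : ρ ≤ 1 / 2) (ha : L * (cubeVol d * ρ ^ d) = a) {x : Euc d}
    (hx : x ∈ unitCube d) : radius Λ a x ≤ ρ :=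
  radius_le hρ0 (ha ▸ h.le_closedBall hd hx hρ0.le hρ)

theorem IsCubeDensity.le_radius_pow (h : IsCubeDensity Λ L q) {a : ℝ}
    (ha : ENNReal.ofReal a < Λ Set.univ) (x : Euc d) :
    a ≤ q * L * (ballVol d * radius Λ a x ^ d) := by
  have := h.isFiniteMeasure
  have h1 := (le_closedBall_radius ha x).trans (h.closedBall_le x (radius_nonneg Λ a x))
  refine (ENNReal.ofReal_le_ofReal_iff ?_).1 h1
  have := h.pos
  have := h.one_le
  have := ballVol_pos d
  have := radius_nonneg Λ a x
  positivity

end CubeDensity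

/-! ### The mean number of close pairs of kept points. -/

section PairBound

variable {d : ℕ}

/-! ### A scale invariant integral -/

/-- The integral of `min 1 (‖z‖ ^ (-2 * d))`. -/
def tailIntegral (d : ℕ) : ℝ≥0∞ := ∫⁻ z : Euc d, ENNReal.ofReal (min 1 ((1 / ‖z‖) ^ (2 * d)))

theorem tailIntegral_lt_top (hd : 2 ≤ d) : tailIntegral d < ∞ := by
  have h1 : ∀ z : Euc d, ENNReal.ofReal (min 1 ((1 / ‖z‖) ^ (2 * d))) ≤
      ENNReal.ofReal (2 ^ (2 * d)) * ENNReal.ofReal ((1 + ‖z‖) ^ (-((2 * d : ℕ) : ℝ))) := by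
    intro z
    have hz := norm_nonneg z
    rw [← ENNReal.ofReal_mul (by positivity), Real.rpow_neg (by positivity), Real.rpow_natCast]
    apply ENNReal.ofReal_le_ofReal
    rw [← div_eq_mul_inv, ← div_pow]
    rcases le_or_gt ‖z‖ 1 with h | h
    · refine (min_le_left _ _).trans (one_le_pow₀ ?_)
      rw [le_div_iff₀ (by positivity)]
      linarith
    · refine (min_le_right _ _).trans (pow_le_pow_left₀ (by positivity) ?_ _)
      rw [div_le_div_iff₀ (by positivity) (by positivity)]
      linarith
  refine (lintegral_mono h1).trans_lt ?_
  rw [lintegral_const_mul _ (by fun_prop)]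
  refine ENNReal.mul_lt_top ENNReal.ofReal_lt_top (finite_integral_one_add_norm ?_)
  rw [finrank_euclideanSpace_fin]
  exact_mod_cast (by omega : d < 2 * d)

theorem lintegral_min_one_div (x : Euc d) {b : ℝ} (hb : 0 < b) :
    ∫⁻ y, ENNReal.ofReal (min 1 ((b / ‖y - x‖) ^ (2 * d))) =
      ENNReal.ofReal (b ^ d) * tailIntegral d := by
  have hm : Measurable fun z : Euc d => ENNReal.ofReal (min 1 ((1 / ‖z‖) ^ (2 * d))) := by
    fun_prop
  rw [lintegral_sub_right_eq_self
    (fun y : Euc d => ENNReal.ofReal (min 1 ((b / ‖y‖) ^ (2 * d)))) x]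
  have h1 : ∀ y : Euc d, ENNReal.ofReal (min 1 ((b / ‖y‖) ^ (2 * d))) =
      (fun z : Euc d => ENNReal.ofReal (min 1 ((1 / ‖z‖) ^ (2 * d)))) (b⁻¹ • y) := by
    intro y
    simp only [norm_smul, norm_inv, Real.norm_of_nonneg hb.le]
    congr 3
    rw [one_div, mul_inv, inv_inv, div_eq_mul_inv]
  simp_rw [h1]
  rw [← lintegral_map hm (measurable_const_smul (b⁻¹)),
    Measure.map_addHaar_smul _ (inv_ne_zero hb.ne'), lintegral_smul_measure,
    finrank_euclideanSpace_fin, inv_pow, inv_inv, abs_of_pos (by positivity)]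
  rfl

/-! ### Two close points are rarely both kept -/

variable {Ω : Type*} [MeasurableSpace Ω] {P : Measure Ω} {η : Ω → Config d} {Λ : Measure (Euc d)}

theorem IsPoissonProcess.measure_lt_inter_lt [IsFiniteMeasure Λ] (h : IsPoissonProcess P η Λ)
    {B C : Set (Euc d)} (hB : MeasurableSet B) (hC : MeasurableSet C) (hBC : Disjoint B C)
    (m n : ℕ) :
    P ({ω | (η ω).1 B < m} ∩ {ω | (η ω).1 C < n}) =
      ENNReal.ofReal (poissonTail m (Λ.real B) * poissonTail n (Λ.real C)) := by
  have h1 := h.iIndepFun (C := ![B, C]) (by intro i; fin_cases i <;> simpa) (by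
    intro i j hij
    fin_cases i <;> fin_cases j <;> simp_all [hBC.symm])
  have h2 := (h1.indepFun (i := 0) (j := 1) (by decide)).measure_inter_preimage_eq_mul
    (Set.Iio (m : ℝ≥0∞)) (Set.Iio (n : ℝ≥0∞)) measurableSet_Iio measurableSet_Iio
  rw [ENNReal.ofReal_mul (poissonTail_nonneg _ measureReal_nonneg), ← h.measure_lt hB,
    ← h.measure_lt hC]
  exact h2

theorem add_pt_pt_apply (μ : Config d) (x y : Euc d) {B : Set (Euc d)} (hB : MeasurableSet B) :
    (Config.add (Config.add μ (Config.pt y)) (Config.pt x)).1 B =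
      μ.1 B + B.indicator 1 y + B.indicator 1 x := by
  rw [Config.add_pt_apply _ _ hB, Config.add_pt_apply _ _ hB]

/-- The event that both points `x`, `y` would be kept after being added to the process. -/
def bothKept (k : ℕ) (η : Ω → Config d) (B : Euc d → Set (Euc d)) (x y : Euc d) : Set Ω :=
  {ω | (Config.add (Config.add (η ω) (Config.pt y)) (Config.pt x)).1 (B x) ≤ ((k + 1 : ℕ) : ℝ≥0∞) ∧
    (Config.add (Config.add (η ω) (Config.pt y)) (Config.pt x)).1 (B y) ≤ ((k + 1 : ℕ) : ℝ≥0∞)}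

/-- The point `x` occupies one of the `k + 1` places in its own ball, and `y` a second one if it
lies there. The remaining count in `B x` is independent of the count in the part of `B y` outside
it. -/
theorem IsPoissonProcess.measure_bothKept_le [IsFiniteMeasure Λ] (h : IsPoissonProcess P η Λ)
    (k : ℕ) {B : Euc d → Set (Euc d)} (hB : ∀ x, MeasurableSet (B x)) (hmem : ∀ x, x ∈ B x)
    (x y : Euc d) :
    P (bothKept k η B x y) ≤ ENNReal.ofReal (poissonTail (k + 1) (Λ.real (B x)) *
        poissonTail (k + 1) (Λ.real (B y \ B x))) ∧
    (y ∈ B x → P (bothKept k η B x y) ≤ ENNReal.ofReal (poissonTail k (Λ.real (B x)) *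
        poissonTail (k + 1) (Λ.real (B y \ B x)))) := by
  have hle : ∀ {ω : Ω}, ω ∈ bothKept k η B x y →
      (η ω).1 (B x) + (B x).indicator 1 y < ((k + 1 : ℕ) : ℝ≥0∞) ∧
        (η ω).1 (B y \ B x) < ((k + 1 : ℕ) : ℝ≥0∞) := by
    rintro ω ⟨h1, h2⟩
    rw [add_pt_pt_apply _ _ _ (hB _)] at h1 h2
    rw [Set.indicator_of_mem (hmem x)] at h1
    rw [Set.indicator_of_mem (hmem y)] at h2
    push_cast at h1 h2 ⊢
    have h1 := (ENNReal.add_le_add_iff_right ENNReal.one_ne_top).1 h1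
    have h2 := (ENNReal.add_le_add_iff_right ENNReal.one_ne_top).1 (le_self_add.trans h2)
    have h3 : (k : ℝ≥0∞) < k + 1 := ENNReal.lt_add_right (ENNReal.natCast_ne_top k) one_ne_zero
    exact ⟨h1.trans_lt h3, ((measure_mono Set.sdiff_subset).trans h2).trans_lt h3⟩
  constructor
  · rw [← h.measure_lt_inter_lt (hB x) ((hB y).diff (hB x)) Set.disjoint_sdiff_right]
    exact measure_mono fun ω hω => ⟨le_self_add.trans_lt (hle hω).1, (hle hω).2⟩
  · intro hy
    rw [← h.measure_lt_inter_lt (hB x) ((hB y).diff (hB x)) Set.disjoint_sdiff_right]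
    refine measure_mono fun ω hω => ⟨?_, (hle hω).2⟩
    have := (hle hω).1
    rw [Set.indicator_of_mem hy] at this
    push_cast at this
    exact lt_of_add_lt_add_right this

/-- The ratio of the contents of small balls of equal radius is at least this constant. -/
def contentRatio (d : ℕ) (q : ℝ) : ℝ := cubeVol d / (q * ballVol d)

theorem contentRatio_pos (hd : 2 ≤ d) {q : ℝ} (hq : 1 ≤ q) : 0 < contentRatio d q := by
  have := cubeVol_pos hd
  have := ballVol_pos d
  unfold contentRatio
  positivity

theorem contentRatio_le_one (hd : 2 ≤ d) {q : ℝ} (hq : 1 ≤ q) : contentRatio d q ≤ 1 := by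
  have h1 := ballVol_pos d
  have hd0 : (1 : ℝ) ≤ d := by exact_mod_cast (by omega : 1 ≤ d)
  have hsq : 1 ≤ √(d : ℝ) := Real.one_le_sqrt.2 hd0
  rw [contentRatio, div_le_one (by positivity), cubeVol, mul_comm]
  refine mul_le_mul_of_nonneg_right (le_trans (pow_le_one₀ (by positivity) ?_) hq) h1.le
  rw [div_le_one (by positivity)]
  linarith

/-- The setting of the pair estimate: the content `a` is that of a ball of radius `ρ` in a corner
of the cube, say. -/
structure LevelSetting (Λ : Measure (Euc d)) (L q a ρ : ℝ) : Prop where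
  dim : 2 ≤ d
  density : IsCubeDensity Λ L q
  level_lt : ENNReal.ofReal a < Λ Set.univ
  radius_pos : 0 < ρ
  radius_le : ρ ≤ 1 / 32
  level_eq : L * (cubeVol d * ρ ^ d) = a

/-! ### Crescents of level balls and the resulting pair estimate. -/

namespace LevelSetting

variable {L q a ρ : ℝ}

theorem level_pos (h : LevelSetting Λ L q a ρ) : 0 < a := by
  have := h.density.pos
  have := cubeVol_pos h.dim
  have := h.radius_pos
  rw [← h.level_eq]
  positivity

theorem radius_le_rho (h : LevelSetting Λ L q a ρ) {x : Euc d} (hx : x ∈ unitCube d) :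
    radius Λ a x ≤ ρ :=
  h.density.radius_le_of_cube h.dim h.radius_pos (by linarith [h.radius_le]) h.level_eq hx

/-- With `radius_le_rho` this makes all level radii at points of the cube comparable to `ρ`, so that
a crescent as wide as a radius has content of order `a`. -/
theorem rho_pow_le (h : LevelSetting Λ L q a ρ) (x : Euc d) :
    contentRatio d q * ρ ^ d ≤ radius Λ a x ^ d := by
  have h1 := h.density.le_radius_pow h.level_lt x
  have hL := h.density.pos
  have hq := h.density.one_le
  have hb := ballVol_pos d
  rw [contentRatio, div_mul_eq_mul_div, div_le_iff₀ (by positivity)]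
  have h2 : L * (cubeVol d * ρ ^ d) ≤ L * (radius Λ a x ^ d * (q * ballVol d)) := by
    rw [h.level_eq]
    linarith
  exact le_of_mul_le_mul_left h2 hL

/-- Both balls have content `a`, so removing their intersection leaves equal contents; hence it does
not matter which crescent contains the small ball. -/
theorem crescent_ge (h : LevelSetting Λ L q a ρ) {x y : Euc d} (hx : x ∈ unitCube d)
    (hy : y ∈ unitCube d) (hu : dist x y ≤ 1 / 4) {m : ℝ} (hm : 0 < m) (hmu : m ≤ dist x y)
    (hmx : m ≤ radius Λ a x) (hmy : m ≤ radius Λ a y) :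
    L * cubeVol d / 32 ^ d * m ^ d ≤
      Λ.real (Metric.closedBall y (radius Λ a y) \ Metric.closedBall x (radius Λ a x)) := by
  have := h.density.isFiniteMeasure
  set Bx := Metric.closedBall x (radius Λ a x)
  set By := Metric.closedBall y (radius Λ a y)
  have hrx : radius Λ a x ≤ 1 / 4 := by linarith [h.radius_le_rho hx, h.radius_le]
  have hry : radius Λ a y ≤ 1 / 4 := by linarith [h.radius_le_rho hy, h.radius_le]
  have heq : Λ (By \ Bx) = Λ (Bx \ By) := by
    have h1 := measure_sdiff_add_inter (μ := Λ) By (t := Bx) measurableSet_closedBall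
    have h2 := measure_sdiff_add_inter (μ := Λ) Bx (t := By) measurableSet_closedBall
    have hBx : Λ Bx = ENNReal.ofReal a := h.density.closedBall_radius h.dim h.level_lt x
    have hBy : Λ By = ENNReal.ofReal a := h.density.closedBall_radius h.dim h.level_lt y
    rw [hBy] at h1
    rw [hBx, Set.inter_comm] at h2
    exact (ENNReal.add_left_inj (measure_ne_top _ _)).1 (h1.trans h2.symm)
  obtain ⟨z, hz, hsub⟩ := exists_closedBall_subset_crescent h.dim hx hy hrx hry hu hm hmu hmx hmy
  have h1 := h.density.le_closedBall h.dim hz (t := m / 32) (by positivity) (by linarith)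
  have h2 : Λ (Metric.closedBall z (m / 32)) ≤ Λ (By \ Bx) := by
    rcases hsub with hsub | hsub
    · rw [heq]; exact measure_mono hsub
    · exact measure_mono hsub
  rw [measureReal_def, ← ENNReal.ofReal_le_iff_le_toReal (measure_ne_top _ _)]
  refine le_trans (le_of_eq ?_) (h1.trans h2)
  congr 1
  rw [div_pow]
  ring

/-- The length scale on which the crescents become substantial. -/
theorem exists_scale (h : LevelSetting Λ L q a ρ) (k : ℕ) :
    ∃ b : ℝ, 0 < b ∧
      b ^ d * (L * cubeVol d / 32 ^ d * contentRatio d q) = √(tailConst (k + 1)) := by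
  have hL := h.density.pos
  have hc := cubeVol_pos h.dim
  have hr := contentRatio_pos h.dim h.density.one_le
  have hC := tailConst_succ_pos k
  set G := L * cubeVol d / 32 ^ d * contentRatio d q with hG
  have hG0 : 0 < G := by positivity
  have hv : 0 < √(tailConst (k + 1)) / G := div_pos (Real.sqrt_pos.2 hC) hG0
  refine ⟨(√(tailConst (k + 1)) / G) ^ ((d : ℝ)⁻¹), Real.rpow_pos_of_pos hv _, ?_⟩
  rw [Real.rpow_inv_natCast_pow hv.le (by have := h.dim; omega)]
  field_simp

/-- The first summand covers `y` inside the ball of `x`, where a place is lost and the crescent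
grows like dist^d. The second covers `y` outside, where the crescent content is of order `a`. -/
theorem measure_bothKept_le (h : LevelSetting Λ L q a ρ) (hη : IsPoissonProcess P η Λ) (k : ℕ)
    {b : ℝ} (hb : 0 < b)
    (hbd : b ^ d * (L * cubeVol d / 32 ^ d * contentRatio d q) = √(tailConst (k + 1)))
    {x y : Euc d} (hx : x ∈ unitCube d) (hy : y ∈ unitCube d) (hne : y ≠ x)
    (hu : dist y x ≤ 1 / 4) :
    P (bothKept k η (fun x => Metric.closedBall x (radius Λ a x)) x y) ≤
      ENNReal.ofReal (poissonTail k a) * ENNReal.ofReal (min 1 ((b / ‖y - x‖) ^ (2 * d))) +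
      ENNReal.ofReal (poissonTail (k + 1) a *
        (tailConst (k + 1) / (contentRatio d q * a / 32 ^ d) ^ 2)) := by
  have := h.density.isFiniteMeasure
  have ha := h.level_pos
  have hL := h.density.pos
  have hc := cubeVol_pos h.dim
  have hr := contentRatio_pos h.dim h.density.one_le
  have hr1 := contentRatio_le_one h.dim h.density.one_le
  have hC := tailConst_succ_pos k
  have hρ := h.radius_pos
  have hpos : ∀ x, 0 < radius Λ a x := h.density.radius_pos h.dim ha h.level_lt
  have hu0 : 0 < dist x y := dist_pos.2 hne.symm
  have hu' : dist x y ≤ 1 / 4 := by rwa [dist_comm]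
  set Bx := Metric.closedBall x (radius Λ a x) with hBx
  set By := Metric.closedBall y (radius Λ a y) with hBy
  set G := L * cubeVol d / 32 ^ d with hG
  have hG0 : 0 < G := by positivity
  have hBxa : Λ.real Bx = a := by
    rw [measureReal_def, hBx, h.density.closedBall_radius h.dim h.level_lt,
      ENNReal.toReal_ofReal ha.le]
  obtain ⟨hgen, hin⟩ := hη.measure_bothKept_le k
    (B := fun x => Metric.closedBall x (radius Λ a x)) (fun _ => measurableSet_closedBall)
    (fun x => Metric.mem_closedBall_self (hpos x).le) x y
  simp only [← hBx, ← hBy, hBxa] at hgen hin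
  have htail : ∀ {t : ℝ}, 0 < t → t ≤ Λ.real (By \ Bx) →
      poissonTail (k + 1) (Λ.real (By \ Bx)) ≤ tailConst (k + 1) / t ^ 2 := by
    intro t ht htΛ
    refine (poissonTail_le_div_sq _ (ht.trans_le htΛ)).trans ?_
    gcongr
  by_cases hxy : dist x y ≤ radius Λ a x
  · have hyB : y ∈ Bx := by rwa [hBx, Metric.mem_closedBall, dist_comm]
    refine (hin hyB).trans (le_add_right ?_)
    rw [← ENNReal.ofReal_mul (poissonTail_nonneg _ ha.le)]
    refine ENNReal.ofReal_le_ofReal (mul_le_mul_of_nonneg_left ?_ (poissonTail_nonneg _ ha.le))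
    refine le_min (poissonTail_le_one _ measureReal_nonneg) ?_
    -- the crescent has content at least `G * contentRatio * dist ^ d`
    have hcr : G * contentRatio d q * dist x y ^ d ≤ Λ.real (By \ Bx) := by
      refine le_trans ?_ (h.crescent_ge hx hy hu' (m := min (dist x y) (radius Λ a y))
        (lt_min hu0 (hpos y)) (min_le_left _ _) ((min_le_left _ _).trans hxy) (min_le_right _ _))
      rw [mul_assoc]
      refine mul_le_mul_of_nonneg_left ?_ hG0.le
      rcases min_cases (dist x y) (radius Λ a y) with ⟨hm, -⟩ | ⟨hm, -⟩ <;> rw [hm]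
      · exact mul_le_of_le_one_left (by positivity) hr1
      · refine le_trans ?_ (h.rho_pow_le y)
        have := h.radius_le_rho hx
        gcongr
        linarith
    refine (htail (by positivity) hcr).trans (le_of_eq ?_)
    -- The scale `b` was chosen to absorb the constants, so that the tail bound is exactly `(b /
    -- dist x y) ^ (2 * d)`.
    have h1 : tailConst (k + 1) = (b ^ d * (G * contentRatio d q)) ^ 2 := by
      rw [hbd, Real.sq_sqrt hC.le]
    rw [h1, ← dist_eq_norm, dist_comm y x, div_pow, pow_mul' (dist x y), pow_mul' b]
    field_simp
  · rw [not_le] at hxy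
    refine hgen.trans (le_add_left ?_)
    refine ENNReal.ofReal_le_ofReal (mul_le_mul_of_nonneg_left ?_ (poissonTail_nonneg _ ha.le))
    refine htail (by positivity) ?_
    refine le_trans ?_ (h.crescent_ge hx hy hu' (m := min (radius Λ a x) (radius Λ a y))
      (lt_min (hpos x) (hpos y)) ((min_le_left _ _).trans hxy.le) (min_le_left _ _)
      (min_le_right _ _))
    have h2 : contentRatio d q * a / 32 ^ d = G * (contentRatio d q * ρ ^ d) := by
      rw [← h.level_eq, hG]
      ring
    rw [h2]
    refine mul_le_mul_of_nonneg_left ?_ hG0.le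
    rcases min_cases (radius Λ a x) (radius Λ a y) with ⟨hm, -⟩ | ⟨hm, -⟩ <;> rw [hm]
    exacts [h.rho_pow_le x, h.rho_pow_le y]

end LevelSetting

/-- The constant in the pair estimate. -/
def pairConst (d k : ℕ) (q : ℝ) : ℝ :=
  k * (q * √(tailConst (k + 1)) * 32 ^ d / (cubeVol d * contentRatio d q)) *
      (tailIntegral d).toReal +
    tailConst (k + 1) * (32 ^ d) ^ 2 * 8 ^ d / contentRatio d q ^ 3

theorem pairConst_nonneg (hd : 2 ≤ d) (k : ℕ) {q : ℝ} (hq : 1 ≤ q) : 0 ≤ pairConst d k q := by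
  have := cubeVol_pos hd
  have := contentRatio_pos hd hq
  have := tailConst_nonneg (k + 1)
  have : 0 ≤ (tailIntegral d).toReal := ENNReal.toReal_nonneg
  unfold pairConst
  positivity

theorem LevelSetting.lintegral_bothKept_le {L q a ρ : ℝ} (h : LevelSetting Λ L q a ρ)
    (hη : IsPoissonProcess P η Λ) (k : ℕ) {x : Euc d} (hx : x ∈ unitCube d)
    {p : Euc d → ℝ≥0∞}
    (hp : ∀ y, y ∈ unitCube d → y ≠ x → dist y x ≤ 8 * ρ →
      p y ≤ P (bothKept k η (fun x => Metric.closedBall x (radius Λ a x)) x y))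
    (hp0 : ∀ y, ¬ (y ∈ unitCube d ∧ y ≠ x ∧ dist y x ≤ 8 * ρ) → p y = 0) :
    ∫⁻ y, p y ∂Λ ≤ ENNReal.ofReal (pairConst d k q * (poissonTail (k + 1) a / a)) := by
  obtain ⟨b, hb, hbd⟩ := h.exists_scale k
  have ha := h.level_pos
  have hL := h.density.pos
  have hq := h.density.one_le
  have hc := cubeVol_pos h.dim
  have hbv := ballVol_pos d
  have hr := contentRatio_pos h.dim h.density.one_le
  have hC := tailConst_succ_pos k
  have hρ := h.radius_pos
  have hT := poissonTail_nonneg k ha.le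
  have hT' := poissonTail_nonneg (k + 1) ha.le
  have hI := tailIntegral_lt_top h.dim
  set M := tailConst (k + 1) / (contentRatio d q * a / 32 ^ d) ^ 2 with hM
  have hM0 : 0 ≤ M := by positivity
  have hbound : ∀ y, p y ≤
      ENNReal.ofReal (poissonTail k a) * ENNReal.ofReal (min 1 ((b / ‖y - x‖) ^ (2 * d))) +
      (Metric.closedBall x (8 * ρ)).indicator
        (fun _ => ENNReal.ofReal (poissonTail (k + 1) a * M)) y := by
    intro y
    by_cases hy : y ∈ unitCube d ∧ y ≠ x ∧ dist y x ≤ 8 * ρ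
    · obtain ⟨h1, h2, h3⟩ := hy
      rw [Set.indicator_of_mem (Metric.mem_closedBall.2 h3)]
      exact (hp y h1 h2 h3).trans
        (h.measure_bothKept_le hη k hb hbd hx h1 h2 (by linarith [h.radius_le]))
    · rw [hp0 y hy]
      exact zero_le
  have hmeas : Measurable fun y : Euc d =>
      ENNReal.ofReal (min 1 ((b / ‖y - x‖) ^ (2 * d))) := by fun_prop
  refine (lintegral_mono hbound).trans ?_
  rw [lintegral_add_left (hmeas.const_mul _), lintegral_const_mul _ hmeas,
    lintegral_indicator_const measurableSet_closedBall]
  have h1 : ∫⁻ y, ENNReal.ofReal (min 1 ((b / ‖y - x‖) ^ (2 * d))) ∂Λ ≤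
      ENNReal.ofReal (q * L * b ^ d * (tailIntegral d).toReal) := by
    refine (lintegral_mono' h.density.le_smul le_rfl).trans ?_
    rw [lintegral_smul_measure, lintegral_min_one_div x hb, smul_eq_mul, ← mul_assoc,
      ← ENNReal.ofReal_mul (by positivity), ENNReal.ofReal_mul (p := q * L * b ^ d) (by positivity),
      ENNReal.ofReal_toReal hI.ne]
  have h2 := h.density.closedBall_le x (t := 8 * ρ) (by positivity)
  have h3 : ENNReal.ofReal (poissonTail k a) *
      ∫⁻ y, ENNReal.ofReal (min 1 ((b / ‖y - x‖) ^ (2 * d))) ∂Λ +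
      ENNReal.ofReal (poissonTail (k + 1) a * M) * Λ (Metric.closedBall x (8 * ρ)) ≤
      ENNReal.ofReal (poissonTail k a * (q * L * b ^ d * (tailIntegral d).toReal) +
        poissonTail (k + 1) a * M * (q * L * (ballVol d * (8 * ρ) ^ d))) := by
    have hI0 : 0 ≤ (tailIntegral d).toReal := ENNReal.toReal_nonneg
    rw [ENNReal.ofReal_add (by positivity) (by positivity), ENNReal.ofReal_mul hT,
      ENNReal.ofReal_mul (p := poissonTail (k + 1) a * M) (by positivity)]
    gcongr
  refine h3.trans (ENNReal.ofReal_le_ofReal ?_)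
  have hI0 : 0 ≤ (tailIntegral d).toReal := ENNReal.toReal_nonneg
  -- The density `L` cancels: the partners near `x` fill a region of bounded content, whatever the
  -- intensity.
  have e1 : q * L * b ^ d = q * √(tailConst (k + 1)) * 32 ^ d / (cubeVol d * contentRatio d q) := by
    rw [← hbd]
    field_simp
  -- `M` is of order `1 / a ^ 2` and the ball of radius `8 * ρ` has content at most of order `a`,
  -- which leaves `1 / a`.
  have e2 : M * (q * L * (ballVol d * (8 * ρ) ^ d)) =
      tailConst (k + 1) * (32 ^ d) ^ 2 * 8 ^ d / contentRatio d q ^ 3 / a := by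
    have e3 : contentRatio d q * (q * ballVol d) = cubeVol d := by
      rw [contentRatio]; field_simp
    have e4 : q * L * (ballVol d * (8 * ρ) ^ d) = 8 ^ d * a / contentRatio d q := by
      rw [← h.level_eq, ← e3, mul_pow]
      field_simp
    rw [e4, hM]
    field_simp
  rw [e1, mul_assoc (poissonTail (k + 1) a) M, e2, pairConst]
  have h4 := poissonTail_le_succ k ha
  set A := q * √(tailConst (k + 1)) * 32 ^ d / (cubeVol d * contentRatio d q) with hA
  have hA0 : 0 ≤ A := by positivity
  have h5 := mul_le_mul_of_nonneg_right h4 (mul_nonneg hA0 hI0)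
  refine (add_le_add_left h5 _).trans (le_of_eq ?_)
  ring

end PairBound

/-! ### The thinning -/

section Thinning

variable {d : ℕ} {Ω : Type*} [MeasurableSpace Ω] {P : Measure Ω} {η : Ω → Config d}
  {Λ : Measure (Euc d)} {k : ℕ} {a : ℝ}

/-- The places of the cube whose ball contains at most `k + 1` points. -/
def keepSet (k : ℕ) (Λ : Measure (Euc d)) (a : ℝ) (μ : Config d) : Set (Euc d) :=
  {x | x ∈ unitCube d ∧ μ.1 (Metric.closedBall x (radius Λ a x)) ≤ ((k + 1 : ℕ) : ℝ≥0∞)}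

theorem measurableSet_mem_keepSet [IsFiniteMeasure Λ] (ha : ENNReal.ofReal a < Λ Set.univ)
    (k : ℕ) : MeasurableSet {p : Config d × Euc d | p.2 ∈ keepSet k Λ a p.1} := by
  have hm : MeasurableSet {p : (Config d × Euc d) × Euc d | dist p.2 p.1.2 ≤ radius Λ a p.1.2} :=
    measurableSet_le (measurable_snd.dist (measurable_snd.comp measurable_fst))
      ((measurable_radius ha).comp (measurable_snd.comp measurable_fst))
  have h1 := Config.measurable_section (F := fun p : Config d × Euc d => p.1) measurable_fst hm
  exact (measurable_snd (measurableSet_unitCube d)).inter (h1 measurableSet_Iic)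

theorem measurableSet_keepSet [IsFiniteMeasure Λ] (ha : ENNReal.ofReal a < Λ Set.univ)
    (k : ℕ) (μ : Config d) : MeasurableSet (keepSet k Λ a μ) :=
  measurable_prodMk_left (measurableSet_mem_keepSet ha k)

theorem closedEBall_levelRadius (ha : ENNReal.ofReal a < Λ Set.univ) (x : Euc d) :
    Metric.closedEBall x (levelRadius Λ a x) = Metric.closedBall x (radius Λ a x) := by
  rw [← ofReal_radius ha, Metric.closedEBall_ofReal (radius_nonneg _ _ _)]

/-- A configuration is carried by its atoms, and at an atom "at most `k` others" means "at most `k +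
1` in all". This removes the measure subtraction and allows `keepSet` to be evaluated at any place.
-/
theorem thinning_eq_res (ha : ENNReal.ofReal a < Λ Set.univ) (μ : Config d) :
    thinning k (levelRadius Λ a) μ = Config.res (keepSet k Λ a μ) μ := by
  refine Subtype.ext (Measure.restrict_congr_set ?_)
  filter_upwards [μ.ae_atom] with x hx
  refine propext ?_
  have h1 := μ.sub_dirac_le_iff hx (B := Metric.closedBall x (radius Λ a x))
    measurableSet_closedBall (Metric.mem_closedBall_self (radius_nonneg _ _ _)) k
  change (x ∈ cubePoints μ.1 ∧ (μ.1 - Measure.dirac x)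
    (Metric.closedEBall x (levelRadius Λ a x)) ≤ k) ↔ x ∈ keepSet k Λ a μ
  rw [closedEBall_levelRadius ha, h1]
  simp [cubePoints, keepSet, hx]

theorem measurable_thinning [IsFiniteMeasure Λ] (ha : ENNReal.ofReal a < Λ Set.univ) (k : ℕ) :
    Measurable (thinning (d := d) k (levelRadius Λ a)) := by
  refine Config.measurable_of_eval fun B hB => ?_
  have h1 : ∀ μ : Config d, (thinning k (levelRadius Λ a) μ).1 B = μ.1 (B ∩ keepSet k Λ a μ) :=
    fun μ => by
      rw [thinning_eq_res ha]
      exact Measure.restrict_apply hB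
  simp_rw [h1]
  exact Config.measurable_section (F := fun μ : Config d => μ) measurable_id
    ((measurable_snd hB).inter (measurableSet_mem_keepSet ha k))

theorem lintegral_thinning [IsFiniteMeasure Λ] (ha : ENNReal.ofReal a < Λ Set.univ) (μ : Config d)
    (f : Euc d → ℝ≥0∞) : ∫⁻ x, f x ∂(thinning k (levelRadius Λ a) μ).1 =
      ∫⁻ x, (keepSet k Λ a μ).indicator f x ∂μ.1 := by
  rw [thinning_eq_res ha, lintegral_indicator (measurableSet_keepSet ha k μ)]
  rfl

/-- The thinning in a set `S` is determined by the points in a neighbourhood of `S`. -/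
theorem res_thinning_eq [IsFiniteMeasure Λ] (ha : ENNReal.ofReal a < Λ Set.univ) {ρ : ℝ}
    (hρ : ∀ x ∈ unitCube d, radius Λ a x ≤ ρ) {S : Set (Euc d)} (hS : MeasurableSet S)
    (μ : Config d) :
    Config.res S (thinning k (levelRadius Λ a) μ) =
      Config.res S (thinning k (levelRadius Λ a) (Config.res (Metric.cthickening ρ S) μ)) := by
  set C := Metric.cthickening ρ S
  have hC : MeasurableSet C := Metric.isClosed_cthickening.measurableSet
  have hset : S ∩ keepSet k Λ a μ = S ∩ keepSet k Λ a (Config.res C μ) ∩ C := by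
    ext x
    simp only [Set.mem_inter_iff, keepSet, Set.mem_ofPred_eq]
    have hx : x ∈ S → x ∈ unitCube d →
        (Config.res C μ).1 (Metric.closedBall x (radius Λ a x)) =
          μ.1 (Metric.closedBall x (radius Λ a x)) := by
      intro hxS hxc
      change μ.1.restrict C _ = _
      rw [Measure.restrict_apply measurableSet_closedBall, Set.inter_eq_left.2]
      exact (Metric.closedBall_subset_closedBall (hρ x hxc)).trans
        (Metric.closedBall_subset_cthickening hxS ρ)
    have hxC : x ∈ S → x ∈ C := fun h => Metric.self_subset_cthickening S h
    constructor
    · rintro ⟨h1, h2, h3⟩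
      exact ⟨⟨h1, h2, by rwa [hx h1 h2]⟩, hxC h1⟩
    · rintro ⟨⟨h1, h2, h3⟩, -⟩
      exact ⟨h1, h2, by rwa [hx h1 h2] at h3⟩
  rw [thinning_eq_res ha, thinning_eq_res ha, Config.res_res hS, Config.res_res hS,
    Config.res_res (hS.inter (measurableSet_keepSet ha k _)), hset]

/-- Each restriction depends only on the process in a `ρ`-thickening, and the two thickenings are
disjoint at this distance. -/
theorem IsPoissonProcess.indepFun_thinning [IsProbabilityMeasure P] [IsFiniteMeasure Λ]
    (h : IsPoissonProcess P η Λ) (ha : ENNReal.ofReal a < Λ Set.univ) {ρ : ℝ} (hρ0 : 0 < ρ)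
    (hρ : ∀ x ∈ unitCube d, radius Λ a x ≤ ρ) {S T : Set (Euc d)} (hS : MeasurableSet S)
    (hT : MeasurableSet T) (hST : ∀ x ∈ S, ∀ y ∈ T, 3 * ρ < dist x y) :
    IndepFun (fun ω => Config.res S (thinning k (levelRadius Λ a) (η ω)))
      (fun ω => Config.res T (thinning k (levelRadius Λ a) (η ω))) P := by
  have hd : Disjoint (Metric.cthickening ρ S) (Metric.cthickening ρ T) := by
    rw [Set.disjoint_left]
    intro z hzS hzT
    have hlt : ENNReal.ofReal ρ < ENNReal.ofReal (3 / 2 * ρ) :=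
      (ENNReal.ofReal_lt_ofReal_iff (by positivity)).2 (by linarith)
    obtain ⟨x, hx, hzx⟩ := Metric.infEDist_lt_iff.1
      ((Metric.mem_cthickening_iff.1 hzS).trans_lt hlt)
    obtain ⟨y, hy, hzy⟩ := Metric.infEDist_lt_iff.1
      ((Metric.mem_cthickening_iff.1 hzT).trans_lt hlt)
    rw [edist_dist, ENNReal.ofReal_lt_ofReal_iff (by positivity)] at hzx hzy
    linarith [hST x hx y hy, dist_triangle_left x y z]
  have hi := h.indepFun_res (Metric.isClosed_cthickening (δ := ρ) (E := S)).measurableSet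
    (Metric.isClosed_cthickening (δ := ρ) (E := T)).measurableSet hd
  have := hi.comp ((Config.measurable_res hS).comp (measurable_thinning ha k))
    ((Config.measurable_res hT).comp (measurable_thinning ha k))
  convert this using 1
  · funext ω; exact res_thinning_eq ha hρ hS (η ω)
  · funext ω; exact res_thinning_eq ha hρ hT (η ω)

/-- The mean measure of the thinning. -/
theorem IsPoissonProcess.lintegral_thinning {L q : ℝ} [IsProbabilityMeasure P]
    (h : IsPoissonProcess P η Λ) (hΛ : IsCubeDensity Λ L q) (hd : 2 ≤ d) (ha0 : 0 < a)
    (ha : ENNReal.ofReal a < Λ Set.univ) {f : Euc d → ℝ≥0∞} (hf : Measurable f) :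
    ∫⁻ ω, ∫⁻ x, f x ∂(thinning k (levelRadius Λ a) (η ω)).1 ∂P =
      ∫⁻ x, f x ∂(ENNReal.ofReal (poissonTail (k + 1) a) • Λ) := by
  have := hΛ.isFiniteMeasure
  simp_rw [_root_.lintegral_thinning ha]
  have hg : Measurable (Function.uncurry fun (x : Euc d) (μ : Config d) =>
      (keepSet k Λ a μ).indicator f x) := by
    have hs : MeasurableSet {p : Euc d × Config d | p.1 ∈ keepSet k Λ a p.2} :=
      measurable_swap (measurableSet_mem_keepSet ha k)
    exact Measurable.indicator (f := fun p : Euc d × Config d => f p.1)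
      (hf.comp measurable_fst) hs
  rw [h.mecke hg, lintegral_smul_measure, smul_eq_mul, ← lintegral_const_mul _ hf]
  have hae : ∀ᵐ x ∂Λ, x ∈ unitCube d := by
    rw [ae_iff]
    exact hΛ.compl_cube
  refine lintegral_congr_ae ?_
  filter_upwards [hae] with x hx
  have hset : MeasurableSet {ω | (η ω).1 (Metric.closedBall x (radius Λ a x)) <
      ((k + 1 : ℕ) : ℝ≥0∞)} := h.measurable_eval measurableSet_closedBall measurableSet_Iio
  have h1 : ∀ ω, (keepSet k Λ a (Config.add (η ω) (Config.pt x))).indicator f x =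
      {ω | (η ω).1 (Metric.closedBall x (radius Λ a x)) < ((k + 1 : ℕ) : ℝ≥0∞)}.indicator
        (fun _ => f x) ω := by
    intro ω
    -- The added point lies in its own ball, which turns `≤ k + 1` into `< k + 1` for the original
    -- process.
    have hiff : x ∈ keepSet k Λ a (Config.add (η ω) (Config.pt x)) ↔
        (η ω).1 (Metric.closedBall x (radius Λ a x)) < ((k + 1 : ℕ) : ℝ≥0∞) := by
      simp only [keepSet, Set.mem_ofPred_eq, hx, true_and]
      rw [Config.add_pt_apply _ _ measurableSet_closedBall,
        Set.indicator_of_mem (Metric.mem_closedBall_self (radius_nonneg _ _ _)), Pi.one_apply,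
        ← not_le, ← (η ω).lt_iff_add_one_le measurableSet_closedBall, not_lt]
      push_cast
      exact ENNReal.add_le_add_iff_right ENNReal.one_ne_top
    by_cases hω : x ∈ keepSet k Λ a (Config.add (η ω) (Config.pt x))
    · rw [Set.indicator_of_mem hω]
      exact (Set.indicator_of_mem (s := {ω | (η ω).1 (Metric.closedBall x (radius Λ a x)) <
        ((k + 1 : ℕ) : ℝ≥0∞)}) (f := fun _ => f x) (by exact hiff.1 hω)).symm
    · rw [Set.indicator_of_notMem hω]
      exact (Set.indicator_of_notMem (s := {ω | (η ω).1 (Metric.closedBall x (radius Λ a x)) <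
        ((k + 1 : ℕ) : ℝ≥0∞)}) (f := fun _ => f x) (fun h => hω (hiff.2 h))).symm
  simp_rw [h1]
  rw [lintegral_indicator_const hset, h.measure_lt measurableSet_closedBall, mul_comm,
    measureReal_def, hΛ.closedBall_radius hd ha, ENNReal.toReal_ofReal ha0.le]

/-- The mean number of pairs of close points of the thinning. -/
theorem LevelSetting.lintegral_pairs_thinning_le {L q ρ : ℝ} [IsProbabilityMeasure P]
    (h : LevelSetting Λ L q a ρ) (hη : IsPoissonProcess P η Λ) :
    ∫⁻ ω, ∫⁻ x, (thinning k (levelRadius Λ a) (η ω)).1 {y | y ≠ x ∧ dist y x ≤ 8 * ρ}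
      ∂(thinning k (levelRadius Λ a) (η ω)).1 ∂P ≤
      ENNReal.ofReal (pairConst d k q * (poissonTail (k + 1) a / a)) * Λ Set.univ := by
  classical
  have := h.density.isFiniteMeasure
  have ha := h.level_lt
  let G : Set (Euc d × Euc d × Config d) := {p | p.1 ∈ keepSet k Λ a p.2.2 ∧
    p.2.1 ∈ keepSet k Λ a p.2.2 ∧ p.2.1 ≠ p.1 ∧ dist p.2.1 p.1 ≤ 8 * ρ}
  have hG : MeasurableSet G := by
    have hk := measurableSet_mem_keepSet (d := d) ha k
    have m1 : Measurable fun p : Euc d × Euc d × Config d => p.1 := measurable_fst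
    have m2 : Measurable fun p : Euc d × Euc d × Config d => p.2.1 :=
      measurable_fst.comp measurable_snd
    have m3 : Measurable fun p : Euc d × Euc d × Config d => p.2.2 :=
      measurable_snd.comp measurable_snd
    exact ((m3.prodMk m1) hk).inter (((m3.prodMk m2) hk).inter
      ((measurableSet_eq_fun m2 m1).compl.inter (measurableSet_le (m2.dist m1) measurable_const)))
  let g : Euc d → Euc d → Config d → ℝ≥0∞ := fun x y μ => G.indicator 1 (x, y, μ)
  have hg : Measurable fun p : Euc d × Euc d × Config d => g p.1 p.2.1 p.2.2 :=
    measurable_one.indicator hG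
  have hl : ∀ ω, ∫⁻ x, (thinning k (levelRadius Λ a) (η ω)).1 {y | y ≠ x ∧ dist y x ≤ 8 * ρ}
      ∂(thinning k (levelRadius Λ a) (η ω)).1 = ∫⁻ x, ∫⁻ y, g x y (η ω) ∂(η ω).1 ∂(η ω).1 := by
    intro ω
    rw [_root_.lintegral_thinning ha]
    refine lintegral_congr fun x => ?_
    have hm : MeasurableSet {y : Euc d | y ≠ x ∧ dist y x ≤ 8 * ρ} :=
      (measurableSet_singleton x).compl.inter
        (measurableSet_le (measurable_id.dist measurable_const) measurable_const)
    by_cases hx : x ∈ keepSet k Λ a (η ω)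
    · rw [Set.indicator_of_mem hx, thinning_eq_res ha]
      change (η ω).1.restrict _ _ = _
      rw [Measure.restrict_apply hm, ← lintegral_indicator_one
        (hm.inter (measurableSet_keepSet ha k (η ω)))]
      refine lintegral_congr fun y => ?_
      simp only [g, G, Set.indicator_apply, Set.mem_ofPred_eq, Set.mem_inter_iff, hx, true_and,
        Pi.one_apply]
      congr 1
      exact propext and_comm
    · rw [Set.indicator_of_notMem hx]
      simp [g, G, hx]
  simp_rw [hl]
  rw [hη.mecke_pair hg fun x μ => by simp [g, G]]
  rw [← lintegral_const]
  refine lintegral_mono fun x => ?_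
  have hmx : ∀ y, Measurable fun ω =>
      (x, y, Config.add (Config.add (η ω) (Config.pt y)) (Config.pt x)) := fun y =>
    measurable_const.prodMk (measurable_const.prodMk (Config.measurable_add_pt
      (Config.measurable_add_pt hη.measurable measurable_const) measurable_const))
  have hpy : ∀ y, ∫⁻ ω, g x y (Config.add (Config.add (η ω) (Config.pt y)) (Config.pt x)) ∂P =
      P {ω | (x, y, Config.add (Config.add (η ω) (Config.pt y)) (Config.pt x)) ∈ G} := fun y => by
    have hmE : MeasurableSet {ω | (x, y, Config.add (Config.add (η ω) (Config.pt y))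
        (Config.pt x)) ∈ G} := (hmx y) hG
    rw [← lintegral_indicator_one hmE]
    rfl
  simp_rw [hpy]
  by_cases hx : x ∈ unitCube d
  · refine h.lintegral_bothKept_le hη k hx (fun y _ _ _ => measure_mono fun ω hω => ?_)
      fun y hy => ?_
    · exact ⟨hω.1.2, hω.2.1.2⟩
    · refine measure_mono_null (fun ω hω => hy ?_) measure_empty
      exact ⟨hω.2.1.1, hω.2.2⟩
  · have : ∀ y, P {ω | (x, y, Config.add (Config.add (η ω) (Config.pt y)) (Config.pt x)) ∈ G} = 0 :=
      fun y => measure_mono_null (fun ω hω => hx hω.1.1) measure_empty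
    simp [this]

/-- The explicit error bound in the Poisson approximation of the thinning. -/
def errorBound (d k : ℕ) (q M s a τ : ℝ) : ℝ :=
  M * (pairConst d k q * (s * poissonTail (k + 1) a) / a +
    (s * poissonTail (k + 1) a * τ + τ ^ 2) * (8 ^ d / contentRatio d q) * (a / s) +
    |s * poissonTail (k + 1) a - τ|)

/-- The factor `τ` allows for levels shifted by `w`, for which the limiting intensity is `exp (-w)`
times `Λ₁`. The mean measures are multiples of `Λ₁`, so their discrepancy is `|s * T - τ|` times
`Λ₁`. -/
theorem LevelSetting.thinning_comparison {L q ρ s τ : ℝ} [IsProbabilityMeasure P]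
    {Λ₁ : Measure (Euc d)} (hΛ₁ : IsCubeDensity Λ₁ L q) (hs : 0 < s) (hτ : 0 ≤ τ)
    (h : LevelSetting (ENNReal.ofReal s • Λ₁) (s * L) q a ρ)
    (hη : IsPoissonProcess P η (ENNReal.ofReal s • Λ₁)) {Y : Ω → Config d}
    (hY : IsPoissonProcess P Y (ENNReal.ofReal τ • Λ₁)) {A : Set (Config d)}
    (hA : MeasurableSet A) :
    P.real ((fun ω => thinning k (levelRadius (ENNReal.ofReal s • Λ₁) a) (η ω)) ⁻¹' A) ≤
      P.real (Y ⁻¹' A) + 2 * errorBound d k q (Λ₁.real Set.univ) s a τ := by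
  have hfin1 := hΛ₁.isFiniteMeasure
  set Λ := ENNReal.ofReal s • Λ₁ with hΛdef
  have hfin := h.density.isFiniteMeasure
  have hfinτ : IsFiniteMeasure (ENNReal.ofReal τ • Λ₁) := Measure.smul_finite _ ENNReal.ofReal_ne_top
  have ha0 := h.level_pos
  have ha := h.level_lt
  have hρ := h.radius_pos
  have hd := h.dim
  have hq := h.density.one_le
  have hL := hΛ₁.pos
  have hcr := contentRatio_pos hd hq
  have hc := cubeVol_pos hd
  have hbv := ballVol_pos d
  set T := poissonTail (k + 1) a with hT
  have hT0 : 0 ≤ T := poissonTail_nonneg _ ha0.le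
  set M := Λ₁.real Set.univ with hM
  have hM0 : 0 ≤ M := measureReal_nonneg
  have hMe : Λ₁ Set.univ = ENNReal.ofReal M := (ofReal_measureReal (measure_ne_top _ _)).symm
  have hpc := pairConst_nonneg hd k hq
  let ξ : Ω → Config d := fun ω => thinning k (levelRadius Λ a) (η ω)
  have hξ : Measurable ξ := (measurable_thinning ha k).comp hη.measurable
  have hξη : ∀ ω B, (ξ ω).1 B ≤ (η ω).1 B := fun ω B => Measure.restrict_apply_le _ _
  have hmX : ENNReal.ofReal T • Λ = ENNReal.ofReal (s * T) • Λ₁ := by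
    rw [hΛdef, smul_smul, ← ENNReal.ofReal_mul hT0, mul_comm]
  have hsmul : ∀ {u v w : ℝ}, 0 ≤ v → 0 ≤ w → u ≤ v + w →
      ENNReal.ofReal u • Λ₁ ≤ ENNReal.ofReal v • Λ₁ + ENNReal.ofReal w • Λ₁ := by
    intro u v w hv hw huvw
    rw [← add_smul, ← ENNReal.ofReal_add hv hw]
    refine Measure.le_iff.2 fun B _ => ?_
    simp only [Measure.smul_apply, smul_eq_mul]
    gcongr
  have hball : ∀ {u v : ℝ}, 0 ≤ u → 0 ≤ v →
      ∫⁻ x, (ENNReal.ofReal u • Λ₁) (Metric.closedBall x (8 * ρ)) ∂(ENNReal.ofReal v • Λ₁) ≤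
        ENNReal.ofReal (M * (u * v * (8 ^ d / contentRatio d q) * (a / s))) := by
    intro u v hu hv
    have h1 : ∀ x, (ENNReal.ofReal u • Λ₁) (Metric.closedBall x (8 * ρ)) ≤
        ENNReal.ofReal (u * (8 ^ d / contentRatio d q * (a / s))) := by
      intro x
      rw [Measure.smul_apply, smul_eq_mul, ENNReal.ofReal_mul hu]
      gcongr
      refine (hΛ₁.closedBall_le x (by positivity)).trans (le_of_eq ?_)
      congr 1
      rw [← h.level_eq, contentRatio, mul_pow]
      field_simp
    refine (lintegral_mono h1).trans (le_of_eq ?_)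
    rw [lintegral_const, Measure.smul_apply, smul_eq_mul, hMe, ← ENNReal.ofReal_mul hv,
      ← ENNReal.ofReal_mul (by positivity)]
    congr 1
    ring
  have hb0 : 0 ≤ errorBound d k q M s a τ := by
    unfold errorBound
    have := abs_nonneg (s * T - τ)
    positivity
  -- Dependence range `3 * ρ` and cells of radius `ρ` require `R ≥ 7 * ρ`; the pair estimate holds
  -- up to `8 * ρ`.
  refine IsPoissonProcess.comparison (X := ξ) (mX := ENNReal.ofReal T • Λ)
    (σ := ENNReal.ofReal |s * T - τ| • Λ₁) (r := 3 * ρ) (δ := ρ) (R := 8 * ρ) hξ hY ?_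
    (isCompact_unitCube d) ?_ ?_ ?_ ?_ ?_ ?_ ?_ hρ (by positivity) (by linarith) ?_ hb0 ?_ hA
  · intro x
    rw [Measure.smul_apply, hΛ₁.singleton hd]
    simp
  · rw [Measure.smul_apply, hΛ₁.compl_cube]
    simp
  · have h1 : ∫⁻ ω, (η ω).1 (unitCube d)ᶜ ∂P = 0 := by
      rw [hη.lintegral_eval (measurableSet_unitCube d).compl, h.density.compl_cube]
    rw [lintegral_eq_zero_iff (hη.measurable_eval (measurableSet_unitCube d).compl)] at h1
    filter_upwards [h1] with ω hω
    exact le_antisymm ((hξη _ _).trans hω.le) zero_le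
  · filter_upwards [hη.ae_finite] with ω hω
    exact ((hξη _ _).trans_lt hω.lt_top).ne
  · filter_upwards [hη.ae_simple (h.density.singleton hd)] with ω hω x
    exact (hξη _ _).trans (hω x)
  · exact fun f hf => hη.lintegral_thinning h.density hd ha0 ha hf
  · rw [hmX]
    exact hsmul hτ (abs_nonneg _) (by linarith [le_abs_self (s * T - τ)])
  · rw [hmX]
    exact hsmul (by positivity) (abs_nonneg _) (by linarith [neg_abs_le (s * T - τ)])
  · exact fun S S' hS hS' hSS' => hη.indepFun_thinning ha hρ
      (fun x hx => h.radius_le_rho hx) hS hS' hSS'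
  · have e1 := h.lintegral_pairs_thinning_le (k := k) hη
    have e2 := hball (u := s * T) (v := τ) (by positivity) hτ
    have e3 := hball (u := τ) (v := τ) hτ hτ
    rw [hmX]
    refine (add_le_add (add_le_add (add_le_add e1 e2) e3) le_rfl).trans (le_of_eq ?_)
    rw [hΛdef, Measure.smul_apply, Measure.smul_apply, smul_eq_mul, smul_eq_mul, hMe,
      ← ENNReal.ofReal_mul hs.le, ← ENNReal.ofReal_mul (by positivity),
      ← ENNReal.ofReal_mul (abs_nonneg _), ← ENNReal.ofReal_add (by positivity) (by positivity),
      ← ENNReal.ofReal_add (by positivity) (by positivity),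
      ← ENNReal.ofReal_add (by positivity) (by have := abs_nonneg (s * T - τ); positivity)]
    congr 1
    rw [errorBound]
    ring

end Thinning

/-! ### The maximal content -/

section MaxContent

variable {d : ℕ} {Λ : Measure (Euc d)} {L q a : ℝ}

/-- Beyond the level radius, the content of a ball exceeds the level. -/
theorem IsCubeDensity.lt_closedBall_of_radius_lt (h : IsCubeDensity Λ L q) (hd : 2 ≤ d)
    (ha : ENNReal.ofReal a < Λ Set.univ) {x : Euc d} (hx : x ∈ unitCube d) {r : ℝ}
    (hr : radius Λ a x < r) : ENNReal.ofReal a < Λ (Metric.closedBall x r) := by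
  have := h.isFiniteMeasure
  set ρ := radius Λ a x with hρ
  have hρ0 : 0 ≤ ρ := radius_nonneg _ _ _
  have hρa : Λ (Metric.closedBall x ρ) = ENNReal.ofReal a := h.closedBall_radius hd ha x
  -- If the level ball covered the cube it would carry the whole mass, which exceeds `a`.
  obtain ⟨y, hy, hxy⟩ : ∃ y ∈ unitCube d, ρ < dist y x := by
    by_contra! hcon
    have hsub : Λ (unitCube d) ≤ ENNReal.ofReal a := hρa ▸ measure_mono hcon
    have hu := measure_union_le (μ := Λ) (unitCube d) (unitCube d)ᶜ
    rw [Set.union_compl_self, h.compl_cube, add_zero] at hu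
    exact absurd (hu.trans hsub) (not_le.2 ha)
  -- By convexity of the cube, a point at distance `(ρ + r) / 2` is found on the segment from `x` to
  -- `y` when `y` is too far out. A small ball about `z` then fits in the shell and has positive
  -- content.
  obtain ⟨z, hz, hzx, hzr⟩ : ∃ z ∈ unitCube d, ρ < dist z x ∧ dist z x < r := by
    rcases lt_or_ge (dist y x) r with hyr | hyr
    · exact ⟨y, hy, hxy, hyr⟩
    · have hy0 : 0 < dist y x := hρ0.trans_lt hxy
      have hr0 : 0 < r := hρ0.trans_lt hr
      set t := (ρ + r) / 2 / dist y x with ht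
      have ht0 : 0 ≤ t := by positivity
      have ht1 : t ≤ 1 := by
        rw [ht, div_le_one hy0]
        linarith
      have hdist : dist (x + t • (y - x)) x = (ρ + r) / 2 := by
        rw [dist_eq_norm, add_sub_cancel_left, norm_smul, Real.norm_of_nonneg ht0, ← dist_eq_norm,
          ht]
        field_simp
      refine ⟨x + t • (y - x), fun i => ?_, by linarith, by linarith⟩
      have h1 := hx i
      have h2 := hy i
      have h3 : (x + t • (y - x)) i = (1 - t) * x i + t * y i := by
        simp
        ring
      rw [h3]
      have h4 := h1.1
      have h5 := h1.2
      have h6 := h2.1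
      have h7 := h2.2
      constructor
      · have := sub_nonneg.2 ht1
        positivity
      · nlinarith
  set e := min (1 / 2) (min (dist z x - ρ) (r - dist z x) / 2) with he
  have he0 : 0 < e := by
    refine lt_min (by norm_num) (half_pos (lt_min ?_ ?_)) <;> linarith
  have he1 : 2 * e ≤ dist z x - ρ := by
    have h1 : e ≤ min (dist z x - ρ) (r - dist z x) / 2 := min_le_right _ _
    have h2 := min_le_left (dist z x - ρ) (r - dist z x)
    linarith
  have he2 : 2 * e ≤ r - dist z x := by
    have h1 : e ≤ min (dist z x - ρ) (r - dist z x) / 2 := min_le_right _ _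
    have h2 := min_le_right (dist z x - ρ) (r - dist z x)
    linarith
  have hpos : 0 < Λ (Metric.closedBall z e) := by
    refine lt_of_lt_of_le ?_ (h.le_closedBall hd hz he0.le (min_le_left _ _))
    have := h.pos
    have := cubeVol_pos hd
    exact ENNReal.ofReal_pos.2 (by positivity)
  have hdisj : Disjoint (Metric.closedBall x ρ) (Metric.closedBall z e) := by
    refine Metric.closedBall_disjoint_closedBall ?_
    rw [dist_comm]
    linarith
  calc ENNReal.ofReal a < ENNReal.ofReal a + Λ (Metric.closedBall z e) :=
        ENNReal.lt_add_right ENNReal.ofReal_ne_top hpos.ne'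
    _ = Λ (Metric.closedBall x ρ ∪ Metric.closedBall z e) := by
        rw [measure_union hdisj measurableSet_closedBall, hρa]
    _ ≤ Λ (Metric.closedBall x r) := by
        refine measure_mono (Set.union_subset (Metric.closedBall_subset_closedBall hr.le)
          (Metric.closedBall_subset_closedBall' ?_))
        linarith

/-- The content of the nearest neighbour ball is at most the level exactly if the level ball
contains more than `k` further points. -/
theorem IsCubeDensity.content_nnRadius_le_iff (h : IsCubeDensity Λ L q) (hd : 2 ≤ d) (ha0 : 0 < a)
    (ha : ENNReal.ofReal a < Λ Set.univ) (k : ℕ) (μ : Config d) {x : Euc d}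
    (hx : x ∈ cubePoints μ.1) :
    Λ (Metric.closedEBall x (nnRadius k x (μ.1 - Measure.dirac x))) ≤ ENNReal.ofReal a ↔
      (k : ℝ≥0∞) < (μ.1 - Measure.dirac x) (Metric.closedEBall x (levelRadius Λ a x)) := by
  rw [closedEBall_levelRadius ha]
  constructor
  · intro hle
    by_contra! hcon
    -- Counts are integers, so the ball can be enlarged without meeting new points. Thus the nearest
    -- neighbour radius lies strictly beyond the level radius, where the content exceeds `a`.
    obtain ⟨r, hr, hrμ⟩ := μ.exists_closedBall_eq x (radius Λ a x)
    have hT : ENNReal.ofReal r ≤ nnRadius k x (μ.1 - Measure.dirac x) := by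
      refine le_iInf₂ fun r' hr' => ENNReal.ofReal_le_ofReal ?_
      by_contra! hlt
      have h1 : (μ.1 - Measure.dirac x) (Metric.closedBall x r) ≤ k := by
        rw [μ.sub_dirac_le_iff hx.2 measurableSet_closedBall
          (Metric.mem_closedBall_self (radius_nonneg _ _ _))] at hcon
        rwa [μ.sub_dirac_le_iff hx.2 measurableSet_closedBall
          (Metric.mem_closedBall_self ((radius_nonneg _ _ _).trans hr.le)), hrμ]
      have h2 := measure_mono (μ := μ.1 - Measure.dirac x)
        (Metric.closedBall_subset_closedBall (x := x) hlt.le)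
      exact absurd (hr'.2.trans_le (h2.trans h1)) (lt_irrefl _)
    refine absurd (h.lt_closedBall_of_radius_lt hd ha hx.1 hr) (not_lt.2 (le_trans ?_ hle))
    rw [← Metric.closedEBall_ofReal ((radius_nonneg _ _ _).trans hr.le)]
    exact measure_mono (Metric.closedEBall_subset_closedEBall hT)
  · intro hlt
    have hT : nnRadius k x (μ.1 - Measure.dirac x) ≤ ENNReal.ofReal (radius Λ a x) :=
      iInf₂_le _ ⟨h.radius_pos hd ha0 ha x, hlt⟩
    rw [← h.closedBall_radius hd ha x, ← Metric.closedEBall_ofReal (radius_nonneg _ _ _)]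
    exact measure_mono (Metric.closedEBall_subset_closedEBall hT)

/-- The maximal content is at most the level exactly if no point survives the thinning. -/
theorem IsCubeDensity.maxContent_le_iff (h : IsCubeDensity Λ L q) (hd : 2 ≤ d) (ha0 : 0 < a)
    (ha : ENNReal.ofReal a < Λ Set.univ) (k : ℕ) (μ : Config d) :
    (maxContent k Λ μ).toReal ≤ a ↔ (thinning k (levelRadius Λ a) μ).1 Set.univ = 0 := by
  have := h.isFiniteMeasure
  have htop : maxContent k Λ μ ≠ ∞ :=
    ((iSup₂_le fun x _ => measure_mono (Set.subset_univ _)).trans_lt (measure_lt_top Λ _)).ne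
  rw [← ENNReal.le_ofReal_iff_toReal_le htop ha0.le, maxContent, iSup₂_le_iff]
  change _ ↔ μ.1.restrict _ Set.univ = 0
  rw [Measure.restrict_apply MeasurableSet.univ, Set.univ_inter]
  constructor
  · intro hall
    refine measure_mono_null (fun x hx => ?_) measure_empty
    exact absurd ((h.content_nnRadius_le_iff hd ha0 ha k μ hx.1).1 (hall x hx.1)) (not_lt.2 hx.2)
  · intro h0 x hx
    rw [h.content_nnRadius_le_iff hd ha0 ha k μ hx]
    by_contra! hcon
    exact hx.2.ne' (measure_mono_null (Set.singleton_subset_iff.2 (by exact ⟨hx, hcon⟩)) h0)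

end MaxContent

/-! ### The intensity measures -/

section Intensity

variable {d : ℕ} {c fm fp : ℝ} {f : Euc d → ℝ}

theorem IsCubeDensity.smul {Λ : Measure (Euc d)} {L q s : ℝ} (h : IsCubeDensity Λ L q)
    (hs : 0 < s) : IsCubeDensity (ENNReal.ofReal s • Λ) (s * L) q where
  pos := mul_pos hs h.pos
  one_le := h.one_le
  lower B hB := by
    rw [Measure.smul_apply, smul_eq_mul, ENNReal.ofReal_mul hs.le, mul_assoc]
    gcongr
    exact h.lower B hB
  upper B hB := by
    rw [Measure.smul_apply, smul_eq_mul, mul_left_comm, ENNReal.ofReal_mul hs.le, mul_assoc]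
    gcongr
    exact h.upper B hB

theorem IsCubeDensity.real_univ_pos {Λ : Measure (Euc d)} {L q : ℝ} (h : IsCubeDensity Λ L q)
    (hd : 2 ≤ d) : 0 < Λ.real Set.univ := by
  have := h.isFiniteMeasure
  refine ENNReal.toReal_pos (ne_of_gt ?_) (measure_ne_top _ _)
  have h0 : (0 : Euc d) ∈ unitCube d := fun i => by simp
  refine lt_of_lt_of_le ?_ ((h.le_closedBall hd h0 (by norm_num) le_rfl).trans
    (measure_mono (Set.subset_univ _)))
  have := h.pos
  have := cubeVol_pos hd
  exact ENNReal.ofReal_pos.2 (by positivity)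

theorem intensity_eq_smul {s : ℝ} (hs : 0 ≤ s) :
    intensity c f s = ENNReal.ofReal s • intensity c f 1 := by
  rw [intensity, intensity, smul_smul, ← ENNReal.ofReal_mul hs]
  congr 2
  ring

theorem intensity_one_apply {B : Set (Euc d)} (hB : MeasurableSet B) :
    intensity c f 1 B = ENNReal.ofReal c * ∫⁻ x in B ∩ unitCube d, ENNReal.ofReal (f x) := by
  rw [intensity, mul_one, Measure.smul_apply, smul_eq_mul, withDensity_apply _ hB,
    Measure.restrict_restrict hB]

theorem isCubeDensity_intensity (hc : 0 < c) (hfm : 0 < fm)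
    (hbd : ∀ x ∈ unitCube d, fm ≤ f x ∧ f x ≤ fp) :
    IsCubeDensity (intensity c f 1) (c * fm) (fp / fm) where
  pos := mul_pos hc hfm
  one_le := by
    have h0 := hbd 0 fun i => by simp
    rw [one_le_div hfm]
    linarith
  lower B hB := by
    rw [intensity_one_apply hB, ENNReal.ofReal_mul hc.le, mul_assoc, ← setLIntegral_const]
    gcongr ENNReal.ofReal c * ?_
    exact setLIntegral_mono' (hB.inter (measurableSet_unitCube d)) fun x hx =>
      ENNReal.ofReal_le_ofReal (hbd x hx.2).1
  upper B hB := by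
    have : fp / fm * (c * fm) = c * fp := by field_simp
    rw [this, intensity_one_apply hB, ENNReal.ofReal_mul hc.le, mul_assoc, ← setLIntegral_const]
    gcongr ENNReal.ofReal c * ?_
    exact setLIntegral_mono' (hB.inter (measurableSet_unitCube d)) fun x hx =>
      ENNReal.ofReal_le_ofReal (hbd x hx.2).2

theorem intensity_one_restrict : (intensity c f 1).restrict (unitCube d) = intensity c f 1 := by
  refine Measure.ext fun B hB => ?_
  rw [Measure.restrict_apply hB, intensity_one_apply hB,
    intensity_one_apply (hB.inter (measurableSet_unitCube d)), Set.inter_assoc, Set.inter_self]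

theorem intensity_one_real_univ (hc : 0 < c) (hfm : 0 < fm) (hf : ContinuousOn f (unitCube d))
    (hbd : ∀ x ∈ unitCube d, fm ≤ f x ∧ f x ≤ fp) :
    (intensity c f 1).real Set.univ = c * ∫ x in unitCube d, f x := by
  rw [measureReal_def, intensity_one_apply MeasurableSet.univ, Set.univ_inter, ENNReal.toReal_mul,
    ENNReal.toReal_ofReal hc.le, integral_eq_lintegral_of_nonneg_ae]
  · filter_upwards [ae_restrict_mem (measurableSet_unitCube d)] with x hx
    exact hfm.le.trans (hbd x hx).1
  · exact hf.aestronglyMeasurable (measurableSet_unitCube d)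

end Intensity

/-! ### Asymptotics of the error bound -/

section Asymptotic

/-- The homogeneous form of the rescaled lower Poisson tail. -/
def tailForm (k : ℕ) (p : ℝ × ℝ) : ℝ :=
  ∑ j ∈ Finset.range (k + 1), (k ! : ℝ) / j ! * p.1 ^ j * p.2 ^ (k - j)

theorem tailForm_one_zero (k : ℕ) : tailForm k (1, 0) = 1 := by
  have h : (k ! : ℝ) ≠ 0 := by positivity
  rw [tailForm, Finset.sum_range_succ, Finset.sum_eq_zero]
  · simp [h]
  · intro j hj
    have : k - j ≠ 0 := by have := Finset.mem_range.1 hj; omega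
    simp [this]

/-- The level is built so that exp(-a) = k! exp(-w) / (s (log s)^k). The factor `s` cancels, and
distributing the powers of log s over the Poisson sum leaves a polynomial in `a / log s` and `1 /
log s`; at `(1, 0)` only its top term `j = k` survives. -/
theorem mul_poissonTail_level {s : ℝ} (hs : 1 < s) (k : ℕ) (w : ℝ) :
    s * poissonTail (k + 1) (level k s + w) =
      Real.exp (-w) * tailForm k ((level k s + w) / Real.log s, 1 / Real.log s) := by
  have hs0 : 0 < s := by linarith
  have hl : 0 < Real.log s := Real.log_pos hs
  have hk : (0 : ℝ) < k ! := by positivity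
  set u := Real.log s with hu
  set a := level k s + w with ha
  have h1 : Real.exp (-a) = s⁻¹ * (u ^ k)⁻¹ * k ! * Real.exp (-w) := by
    have : -a = -Real.log s + -(k * Real.log u) + Real.log (k ! : ℝ) + -w := by
      rw [ha, level]
      ring
    rw [this, Real.exp_add, Real.exp_add, Real.exp_add, Real.exp_neg, Real.exp_log hs0,
      Real.exp_log hk, Real.exp_neg (k * _), Real.exp_nat_mul, Real.exp_log hl]
  rw [poissonTail, h1, tailForm, Finset.mul_sum, Finset.mul_sum, Finset.mul_sum]
  refine Finset.sum_congr rfl fun j hj => ?_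
  have hjk : j ≤ k := by have := Finset.mem_range.1 hj; omega
  have h2 : u ^ k = u ^ j * u ^ (k - j) := by rw [← pow_add]; congr 1; omega
  rw [h2, div_pow, div_pow, one_pow]
  field_simp

variable {p : ℝ}

theorem tendsto_log_rpow_neg (hp0 : 0 < p) :
    Tendsto (fun s : ℝ => Real.log s ^ (-p)) atTop (𝓝 0) :=
  (tendsto_rpow_neg_atTop hp0).comp Real.tendsto_log_atTop

theorem isBigO_one_div_log (hp1 : p < 1) :
    (fun s : ℝ => 1 / Real.log s) =O[atTop] fun s => Real.log s ^ (-p) := by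
  refine IsBigO.of_bound 1 ?_
  filter_upwards [Real.tendsto_log_atTop.eventually_ge_atTop 1] with s hs
  have h0 : 0 < Real.log s := by linarith
  rw [one_mul, Real.norm_of_nonneg (by positivity), Real.norm_of_nonneg (by positivity), one_div,
    ← Real.rpow_neg_one]
  exact Real.rpow_le_rpow_of_exponent_le hs (by linarith)

theorem isBigO_log_log_div_log (hp1 : p < 1) :
    (fun s : ℝ => Real.log (Real.log s) / Real.log s) =O[atTop] fun s => Real.log s ^ (-p) := by
  have h1 : (fun u : ℝ => Real.log u / u) =O[atTop] fun u => u ^ (-p) := by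
    have h2 := (isLittleO_log_rpow_atTop (r := 1 - p) (by linarith)).isBigO.mul
      (isBigO_refl (fun u : ℝ => u⁻¹) atTop)
    refine h2.congr' (Eventually.of_forall fun u => rfl) ?_
    filter_upwards [eventually_gt_atTop 0] with u hu
    rw [← Real.rpow_neg_one, ← Real.rpow_add hu]
    congr 1
    ring
  exact h1.comp_tendsto Real.tendsto_log_atTop

theorem isBigO_level_div_log_sub_one (hp1 : p < 1) (k : ℕ) (w : ℝ) :
    (fun s : ℝ => (level k s + w) / Real.log s - 1) =O[atTop] fun s => Real.log s ^ (-p) := by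
  have h1 := ((isBigO_log_log_div_log hp1).const_mul_left (k : ℝ)).add
    ((isBigO_one_div_log hp1).const_mul_left (w - Real.log (k ! : ℝ)))
  refine h1.congr' ?_ EventuallyEq.rfl
  filter_upwards [Real.tendsto_log_atTop.eventually_gt_atTop 0] with s hs
  rw [level]
  field_simp
  ring

theorem tendsto_level_div_log (k : ℕ) (w : ℝ) :
    Tendsto (fun s : ℝ => (level k s + w) / Real.log s) atTop (𝓝 1) := by
  have h := (isBigO_level_div_log_sub_one (p := 1 / 2) (by norm_num) k w).trans_tendsto
    (tendsto_log_rpow_neg (by norm_num))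
  simpa using h.add_const 1

theorem tendsto_level_atTop (k : ℕ) (w : ℝ) :
    Tendsto (fun s : ℝ => level k s + w) atTop atTop := by
  refine (((tendsto_level_div_log k w).pos_mul_atTop one_pos
    Real.tendsto_log_atTop)).congr' ?_
  filter_upwards [Real.tendsto_log_atTop.eventually_gt_atTop 0] with s hs
  field_simp

theorem isBigO_one_div_level (hp1 : p < 1) (k : ℕ) (w : ℝ) :
    (fun s : ℝ => 1 / (level k s + w)) =O[atTop] fun s => Real.log s ^ (-p) := by
  have h1 := ((tendsto_level_div_log k w).inv₀ one_ne_zero).isBigO_one ℝ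
  refine (h1.mul (isBigO_one_div_log hp1)).congr' ?_ (by simp)
  filter_upwards [Real.tendsto_log_atTop.eventually_gt_atTop 0] with s hs
  field_simp

theorem isBigO_level_div_id (hp1 : p < 1) (k : ℕ) (w : ℝ) :
    (fun s : ℝ => (level k s + w) / s) =O[atTop] fun s => Real.log s ^ (-p) := by
  have h1 := (tendsto_level_div_log k w).isBigO_one ℝ
  have h2 : (fun s : ℝ => Real.log s ^ 2 / s) =O[atTop] fun _ => (1 : ℝ) := by
    have := (Real.isLittleO_pow_log_id_atTop (n := 2)).tendsto_div_nhds_zero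
    exact this.isBigO_one ℝ
  refine ((h1.mul h2).mul (isBigO_one_div_log hp1)).congr' ?_ (by simp)
  filter_upwards [Real.tendsto_log_atTop.eventually_gt_atTop 0] with s hs
  field_simp

theorem tendsto_level_div_id (k : ℕ) (w : ℝ) :
    Tendsto (fun s : ℝ => (level k s + w) / s) atTop (𝓝 0) :=
  (isBigO_level_div_id (p := 1 / 2) (by norm_num) k w).trans_tendsto
    (tendsto_log_rpow_neg (by norm_num))

/-- `tailForm` is differentiable at `(1, 0)`, so the error is linear in the deviation of its
arguments, whose leading part is `k log log s / log s`. This is below every power `p < 1` of `1 /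
log s`. -/
theorem isBigO_mul_poissonTail_sub (hp0 : 0 < p) (hp1 : p < 1) (k : ℕ) (w : ℝ) :
    (fun s : ℝ => s * poissonTail (k + 1) (level k s + w) - Real.exp (-w)) =O[atTop]
      fun s => Real.log s ^ (-p) := by
  have hlog := isBigO_one_div_log hp1
  have hlim : Tendsto (fun s : ℝ => ((level k s + w) / Real.log s, 1 / Real.log s)) atTop
      (𝓝 ((1 : ℝ), (0 : ℝ))) :=
    (tendsto_level_div_log k w).prodMk_nhds (hlog.trans_tendsto (tendsto_log_rpow_neg hp0))
  have hdiff : DifferentiableAt ℝ (tailForm k) (1, 0) := by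
    unfold tailForm
    fun_prop
  have h1 := hdiff.isBigO_sub.comp_tendsto hlim
  have h2 : (fun s : ℝ => ((level k s + w) / Real.log s, 1 / Real.log s) - ((1 : ℝ), (0 : ℝ)))
      =O[atTop] fun s => Real.log s ^ (-p) := by
    have := (isBigO_level_div_log_sub_one hp1 k w).prod_left hlog
    simpa using this
  refine ((h1.trans h2).const_mul_left (Real.exp (-w))).congr' ?_ EventuallyEq.rfl
  filter_upwards [eventually_gt_atTop 1] with s hs
  rw [mul_poissonTail_level hs, Function.comp_apply, tailForm_one_zero]
  ring

/-- The three summands are governed by `1 / a`, `a / s` and the deviation of the mean measure, while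
`s * T` stays bounded. -/
theorem isBigO_errorBound (hp0 : 0 < p) (hp1 : p < 1) (d k : ℕ) (q M w : ℝ) :
    (fun s : ℝ => errorBound d k q M s (level k s + w) (Real.exp (-w))) =O[atTop]
      fun s => Real.log s ^ (-p) := by
  have h1 := isBigO_mul_poissonTail_sub hp0 hp1 k w
  have h2 : (fun s : ℝ => s * poissonTail (k + 1) (level k s + w)) =O[atTop]
      fun _ => (1 : ℝ) := by
    have := (h1.trans_tendsto (tendsto_log_rpow_neg hp0)).add_const (Real.exp (-w))
    simp only [sub_add_cancel] at this
    exact this.isBigO_one ℝ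
  have h3 := ((h2.const_mul_left (pairConst d k q)).mul (isBigO_one_div_level hp1 k w))
  have h4 : (fun s : ℝ => (s * poissonTail (k + 1) (level k s + w) * Real.exp (-w) +
      Real.exp (-w) ^ 2) * (8 ^ d / contentRatio d q)) =O[atTop] fun _ => (1 : ℝ) := by
    simp_rw [mul_comm _ (8 ^ d / contentRatio d q), mul_comm _ (Real.exp (-w))]
    exact ((h2.const_mul_left _).add (isBigO_const_const _ one_ne_zero _)).const_mul_left _
  have h5 := h4.mul (isBigO_level_div_id hp1 k w)
  simp only [one_mul] at h3 h5
  refine (((h3.add h5).add h1.norm_left).const_mul_left M).congr_left fun s => ?_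
  rw [errorBound, Real.norm_eq_abs]
  ring

end Asymptotic

/-! ### Poisson approximation of the thinning -/

section Approximation

variable {d k : ℕ} {Ω : Type*} [MeasurableSpace Ω] {P : Measure Ω} {Λ₁ : Measure (Euc d)}
  {L q : ℝ}

/-- The required `ρ` is the `d`-th root of `a / (s L cubeVol)`; it becomes small because `a / s`
tends to 0. -/
theorem IsCubeDensity.eventually_levelSetting (h : IsCubeDensity Λ₁ L q) (hd : 2 ≤ d) (k : ℕ)
    (w : ℝ) : ∀ᶠ s : ℝ in atTop,
      ∃ ρ, LevelSetting (ENNReal.ofReal s • Λ₁) (s * L) q (level k s + w) ρ := by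
  have hfin := h.isFiniteMeasure
  have hL := h.pos
  have hc := cubeVol_pos hd
  have hM := h.real_univ_pos hd
  have hlim := tendsto_level_div_id k w
  have hκ : 0 < L * cubeVol d * (1 / 32) ^ d := by positivity
  filter_upwards [eventually_gt_atTop 0, (tendsto_level_atTop k w).eventually_gt_atTop 0,
    hlim.eventually_lt_const hM, hlim.eventually_lt_const hκ] with s hs ha h1 h2
  set a := level k s + w
  rw [div_lt_iff₀ hs] at h1 h2
  have hd0 : d ≠ 0 := by omega
  have hb : 0 < a / (s * L * cubeVol d) := by positivity
  refine ⟨(a / (s * L * cubeVol d)) ^ (1 / (d : ℝ)), hd, h.smul hs, ?_, by positivity, ?_, ?_⟩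
  · rw [Measure.smul_apply, smul_eq_mul, ← ofReal_measureReal (measure_ne_top Λ₁ _),
      ← ENNReal.ofReal_mul hs.le, ENNReal.ofReal_lt_ofReal_iff (by positivity)]
    linarith
  · rw [← pow_le_pow_iff_left₀ (by positivity) (by norm_num) hd0, one_div,
      Real.rpow_inv_natCast_pow hb.le hd0, div_le_iff₀ (by positivity)]
    linarith
  · rw [one_div, Real.rpow_inv_natCast_pow hb.le hd0]
    field_simp

/-- The opposite inequality is the one-sided bound for the complementary event. -/
theorem LevelSetting.abs_thinning_sub_le {a ρ s τ : ℝ} [IsProbabilityMeasure P]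
    (hΛ₁ : IsCubeDensity Λ₁ L q) (hs : 0 < s) (hτ : 0 ≤ τ)
    (h : LevelSetting (ENNReal.ofReal s • Λ₁) (s * L) q a ρ) {η : Ω → Config d}
    (hη : IsPoissonProcess P η (ENNReal.ofReal s • Λ₁)) {Y : Ω → Config d}
    (hY : IsPoissonProcess P Y (ENNReal.ofReal τ • Λ₁)) {A : Set (Config d)}
    (hA : MeasurableSet A) :
    |P.real ((fun ω => thinning k (levelRadius (ENNReal.ofReal s • Λ₁) a) (η ω)) ⁻¹' A) -
      P.real (Y ⁻¹' A)| ≤ 2 * errorBound d k q (Λ₁.real Set.univ) s a τ := by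
  have := h.density.isFiniteMeasure
  have hξ : Measurable fun ω => thinning k (levelRadius (ENNReal.ofReal s • Λ₁) a) (η ω) :=
    (measurable_thinning h.level_lt k).comp hη.measurable
  have h1 := LevelSetting.thinning_comparison (k := k) hΛ₁ hs hτ h hη hY hA
  have h2 := LevelSetting.thinning_comparison (k := k) hΛ₁ hs hτ h hη hY hA.compl
  rw [Set.preimage_compl, Set.preimage_compl, probReal_compl_eq_one_sub (hξ hA),
    probReal_compl_eq_one_sub (hY.measurable hA)] at h2
  rw [abs_le]
  constructor <;> linarith

theorem IsPoissonProcess.real_univ_eq_zero [IsFiniteMeasure Λ₁] {τ : ℝ} (hτ : 0 ≤ τ)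
    {Y : Ω → Config d} (hY : IsPoissonProcess P Y (ENNReal.ofReal τ • Λ₁)) :
    P.real (Y ⁻¹' {μ | μ.1 Set.univ = 0}) = Real.exp (-(τ * Λ₁.real Set.univ)) := by
  have hfin : IsFiniteMeasure (ENNReal.ofReal τ • Λ₁) :=
    Measure.smul_finite _ ENNReal.ofReal_ne_top
  have h1 := hY.law_of_finite Set.univ MeasurableSet.univ (measure_ne_top _ _) 0
  rw [poissonMeasure_singleton] at h1
  have h2 : Y ⁻¹' {μ | μ.1 Set.univ = 0} = {ω | (Y ω).1 Set.univ = ((0 : ℕ) : ℝ≥0∞)} := by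
    ext ω
    simp
  rw [h2, measureReal_def, h1, ENNReal.toReal_ofReal (by positivity),
    ENNReal.coe_toNNReal_eq_toReal, Measure.smul_apply, smul_eq_mul, ENNReal.toReal_mul,
    ENNReal.toReal_ofReal hτ, measureReal_def]
  simp

end Approximation

end

/-! ### The rate of approximation and the Gumbel limit. -/

theorem theorem4p2 {Ω : Type*} [MeasurableSpace Ω] (P : Measure Ω) [IsProbabilityMeasure P]
    (d : ℕ) (hd : 2 ≤ d) (k : ℕ) (c : ℝ) (hc : 0 < c)
    (fm fp : ℝ) (hfm : 0 < fm) (f : Euc d → ℝ)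
    (hf : ContinuousOn f (unitCube d)) (hbd : ∀ x ∈ unitCube d, fm ≤ f x ∧ f x ≤ fp)
    (η : ℝ → Ω → Config d) (hη : ∀ s : ℝ, 0 < s → IsPoissonProcess P (η s) (intensity c f s))
    (ν : Ω → Config d)
    (hν : IsPoissonProcess P ν ((intensity c f 1).restrict (unitCube d))) :
    ((fun s : ℝ =>
        dTV P (fun ω => thinning k (levelRadius (intensity c f s) (level k s)) (η s ω)) ν)
      =O[atTop] fun s : ℝ => Real.log s ^ (-(((d : ℝ) - 1) / ((d : ℝ) + 1)))) ∧
    ∀ t : ℝ,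
      Tendsto
        (fun s : ℝ => P.real {ω |
          (maxContent k (intensity c f s) (η s ω)).toReal - level k s
            - Real.log (c * ∫ x in unitCube d, f x) ≤ t})
        atTop (𝓝 (Real.exp (-Real.exp (-t)))) := by
  have hΛ := isCubeDensity_intensity hc hfm hbd
  have hfin := hΛ.isFiniteMeasure
  rw [← intensity_one_real_univ hc hfm hf hbd]
  rw [intensity_one_restrict] at hν
  have hM := hΛ.real_univ_pos hd
  have hd2 : (2 : ℝ) ≤ d := by exact_mod_cast hd
  have hη' : ∀ s : ℝ, 0 < s → IsPoissonProcess P (η s) (ENNReal.ofReal s • intensity c f 1) :=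
    fun s hs => by
      rw [← intensity_eq_smul hs.le]
      exact hη s hs
  constructor
  · have hp0 : 0 < ((d : ℝ) - 1) / ((d : ℝ) + 1) := div_pos (by linarith) (by linarith)
    have hp1 : ((d : ℝ) - 1) / ((d : ℝ) + 1) < 1 := by
      rw [div_lt_one (by linarith)]
      linarith
    -- The unshifted level: `w = 0`, so the comparison intensity has factor `exp 0 = 1`. The density
    -- ratio is `q = fp / fm`.
    refine IsBigO.trans ?_ ((isBigO_errorBound hp0 hp1 d k (fp / fm)
      ((intensity c f 1).real Set.univ) 0).const_mul_left 2)
    refine IsBigO.of_bound 1 ?_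
    filter_upwards [eventually_gt_atTop 0, hΛ.eventually_levelSetting hd k 0] with s hs ⟨ρ, hρ⟩
    rw [one_mul, dTV, Real.norm_of_nonneg (Real.iSup_nonneg fun _ => abs_nonneg _)]
    refine le_trans ?_ (le_abs_self _)
    have : Nonempty {A : Set (Config d) // MeasurableSet A} := ⟨⟨∅, MeasurableSet.empty⟩⟩
    refine ciSup_le fun A => ?_
    have := LevelSetting.abs_thinning_sub_le (k := k) (τ := 1) hΛ hs zero_le_one hρ (hη' s hs)
      (Y := ν) (by simpa using hν) A.2
    rw [intensity_eq_smul hs.le]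
    simpa using this
  · intro t
    set M := (intensity c f 1).real Set.univ with hMdef
    -- The shift that turns the mean number `τ * M` of limit points into `exp (-t)`.
    set w := Real.log M + t with hw
    set τ := Real.exp (-w) with hτ
    have hτ0 : 0 < τ := Real.exp_pos _
    have hτM : τ * M = Real.exp (-t) := by
      rw [hτ, hw, neg_add, Real.exp_add, Real.exp_neg (Real.log M), Real.exp_log hM]
      field_simp
    have hA : MeasurableSet {μ : Config d | μ.1 Set.univ = 0} :=
      Config.measurable_eval MeasurableSet.univ (measurableSet_singleton 0)
    have herr := ((isBigO_errorBound (p := 1 / 2) (by norm_num) (by norm_num) d k (fp / fm) M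
      w).trans_tendsto (tendsto_log_rpow_neg (by norm_num))).const_mul 2
    rw [mul_zero] at herr
    rw [tendsto_iff_dist_tendsto_zero]
    refine squeeze_zero' (Eventually.of_forall fun _ => dist_nonneg) ?_ herr
    filter_upwards [eventually_gt_atTop 0, hΛ.eventually_levelSetting hd k w] with s hs ⟨ρ, hρ⟩
    -- The comparison process of intensity `τ • λ_1` is the member `η τ` of the given family; only
    -- its law matters, so no independence from `η s` is needed.
    have h1 := LevelSetting.abs_thinning_sub_le (k := k) hΛ hs hτ0.le hρ (hη' s hs)
      (hη' τ hτ0) hA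
    rw [(hη' τ hτ0).real_univ_eq_zero hτ0.le, ← hMdef, hτM] at h1
    rw [Real.dist_eq, intensity_eq_smul hs.le]
    convert h1 using 4
    ext ω
    change _ ↔ (thinning k (levelRadius (ENNReal.ofReal s • intensity c f 1) (level k s + w))
      (η s ω)).1 Set.univ = 0
    rw [← hρ.density.maxContent_le_iff hd hρ.level_pos hρ.level_lt, hw]
    change _ - _ - _ ≤ t ↔ _
    constructor <;> intro h <;> linarith
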